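/- **Corollary 1.** Let $G=(V,E)$ be an undirected graph with $n\ge 1$ vertices and $m=\lambda n$ edges, where $\lambda\ge 1/2$ (every connected graph with at least two vertices satisfies this), with non-negative edge weights $\omega$ ($\omega\equiv1$ in the unweighted case), and let $k\ge1$ be an integer. Let $\rho=\frac1k n^{k/(2k+2)}$. Give each vertex $v$ $\lceil\deg(v)/\lambda\rceil$ virtual copies, select every copy independently with probability $\rho/n$, and let the set $L$ of landmarks consist of the vertices with at least one selected copy. For every $L$ one can build a path-reporting distance oracle such that the following holds, where the oracles are queried by one fixed program in the unweighted case and one in the weighted case, on a random access machine with words of $O(\log n)$ bits that can add and compare lengths, and where all implied constants are absolute, except that those in the high-probability bounds may depend on $c$. 1. On every query $(u,v)$ of vertices in the same component, the oracle returns a $u$-$v$ path $\hat\Pi$ of $G$ (possibly with repeated vertices) and its length $\delta(u,v)$, with $d_G(u,v)\le\delta(u,v)\le(6k-1)\,d_G(u,v)$; unless $\hat\Pi$ is a shortest path, it passes through a landmark closest to $u$ and a landmark closest to $v$. If $u$ and $v$ lie in different components, the oracle reports that there is no path (and we put $|\hat\Pi|=0$ below). 2. For every $c\in\mathbb N$,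 the size of the oracle, in addition to the stored input graph (adjacency lists), is $O(n)$ with probability at least $1-n^{-c}$. 3. For every query, the expected query time, apart from an additive term $O(|\hat\Pi|)$, where $|\hat\Pi|$ is the number of edges of $\hat\Pi$, is $$O\big(n^{\frac12+\frac1{2k+2}}\cdot k\cdot\lambda\big)\ \text{ if $G$ is unweighted, and }\ O\big(n^{\frac12+\frac1{2k+2}}\cdot k\cdot\tfrac mn\cdot\log n\big)\ \text{ if $G$ is weighted.}$$ 4. For every $c\in\mathbb N$, with probability at least $1-n^{-c}$ all queries satisfy these bounds on the query time, multiplied by a further factor $\log n$ (again apart from the additive term $O(|\hat\Pi|)$). -/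

import Mathlib

open scoped NNReal ENNReal

noncomputable section

namespace DistOracle

/-! ## Weighted graphs

A weighted undirected graph on `Fin n` is a simple graph `G` with a non-negative weight
`w s(x, y)` for each edge; the unweighted case is `w = fun _ => 1`. -/

/-- The number `m` of edges. -/
def numEdges {n : ℕ} (G : SimpleGraph (Fin n)) : ℕ := G.edgeSet.ncard

open Classical in
/-- The degree of a vertex. -/
def deg {n : ℕ} (G : SimpleGraph (Fin n)) (v : Fin n) : ℕ := G.degree v

open Classical in
/-- The adjacency list of a vertex, as an array sorted by the names of the neighbours. -/
def adjList {n : ℕ} (G : SimpleGraph (Fin n)) (v : Fin n) : List (Fin n) :=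
  (G.neighborFinset v).sort (· ≤ ·)

/-- The ratio `λ = m / n`. -/
def density {n : ℕ} (G : SimpleGraph (Fin n)) : ℝ := (numEdges G : ℝ) / n

/-- The length of a walk (with repetitions allowed): the sum of the weights of its edges. -/
def walkLen {n : ℕ} {G : SimpleGraph (Fin n)} (w : Sym2 (Fin n) → ℝ≥0) {u v : Fin n}
    (p : G.Walk u v) : ℝ≥0 := (p.edges.map w).sum

/-- The distance `d_G(u, v)`, which is `∞` if there is no `u`-`v` path. -/
def wdist {n : ℕ} (G : SimpleGraph (Fin n)) (w : Sym2 (Fin n) → ℝ≥0) (u v : Fin n) : ℝ≥0∞ :=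
  ⨅ p : G.Walk u v, (walkLen w p : ℝ≥0∞)

/-! ## The machine

A random access machine that runs a fixed finite program. It has integer registers and memory
cells that hold words, that is, naturals below `wordBound`, and registers and memory cells for
lengths, on which it can only add and compare. An overflow or an access outside the memory makes
the machine stuck. The input graph is read through its adjacency lists. Every instruction and
every test takes one unit of time. -/

/-- The read-only input of a computation and the word size. -/
structure Env (n : ℕ) where
  graph : SimpleGraph (Fin n)
  weight : Sym2 (Fin n) → ℝ≥0
  wordBound : ℕ

/-- The machine's state: registers, memory, and the write-only output tape. -/
structure State where
  reg : ℕ → ℕ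
  lreg : ℕ → ℝ≥0
  mem : List ℕ
  lmem : List ℝ≥0
  out : List ℕ

/-- Elementary instructions. Arguments are names of registers, except for the literal in
`const`. -/
inductive Instr where
  | const (d c : ℕ)      -- reg d := c
  | copy (d a : ℕ)       -- reg d := reg a
  | add (d a b : ℕ)      -- reg d := reg a + reg b
  | sub (d a b : ℕ)      -- truncated difference
  | mul (d a b : ℕ)      -- product
  | div (d a b : ℕ)      -- quotient
  | mod (d a b : ℕ)      -- remainder
  | load (d a : ℕ)       -- reg d := mem[reg a]
  | store (a s : ℕ)      -- mem[reg a] := reg s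
  | lzero (d : ℕ)        -- lreg d := 0
  | lcopy (d a : ℕ)      -- lreg d := lreg a
  | ladd (d a b : ℕ)     -- lreg d := lreg a + lreg b
  | lload (d a : ℕ)      -- lreg d := lmem[reg a]
  | lstore (a s : ℕ)     -- lmem[reg a] := lreg s
  | degree (d x : ℕ)     -- reg d := degree of the vertex reg x
  | nbr (d x j : ℕ)      -- reg d := neighbour number reg j of the vertex reg x
  | wt (d x j : ℕ)       -- lreg d := weight of the edge to that neighbour
  | emit (a : ℕ)         -- append reg a to the output

/-- Write `x` to register `d`, if `x` fits into a word. -/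
def setReg (W : ℕ) (s : State) (d x : ℕ) : Option State :=
  if x < W then some { s with reg := Function.update s.reg d x } else none

/-- Write `x` to length register `d`. -/
def setLReg (s : State) (d : ℕ) (x : ℝ≥0) : State :=
  { s with lreg := Function.update s.lreg d x }

/-- The effect of an elementary instruction; `none` means that the machine is stuck. -/
def step {n : ℕ} (E : Env n) (s : State) : Instr → Option State
  | .const d c => setReg E.wordBound s d c
  | .copy d a => setReg E.wordBound s d (s.reg a)
  | .add d a b => setReg E.wordBound s d (s.reg a + s.reg b)
  | .sub d a b => setReg E.wordBound s d (s.reg a - s.reg b)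
  | .mul d a b => setReg E.wordBound s d (s.reg a * s.reg b)
  | .div d a b => setReg E.wordBound s d (s.reg a / s.reg b)
  | .mod d a b => setReg E.wordBound s d (s.reg a % s.reg b)
  | .load d a => s.mem[s.reg a]?.bind fun x => setReg E.wordBound s d x
  | .store a b =>
      if s.reg a < s.mem.length then some { s with mem := s.mem.set (s.reg a) (s.reg b) }
      else none
  | .lzero d => some (setLReg s d 0)
  | .lcopy d a => some (setLReg s d (s.lreg a))
  | .ladd d a b => some (setLReg s d (s.lreg a + s.lreg b))
  | .lload d a => s.lmem[s.reg a]?.map fun x => setLReg s d x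
  | .lstore a b =>
      if s.reg a < s.lmem.length then some { s with lmem := s.lmem.set (s.reg a) (s.lreg b) }
      else none
  | .degree d x =>
      if h : s.reg x < n then setReg E.wordBound s d (deg E.graph ⟨s.reg x, h⟩) else none
  | .nbr d x j =>
      if h : s.reg x < n then
        (adjList E.graph ⟨s.reg x, h⟩)[s.reg j]?.bind fun y => setReg E.wordBound s d y
      else none
  | .wt d x j =>
      if h : s.reg x < n then
        (adjList E.graph ⟨s.reg x, h⟩)[s.reg j]?.map fun y =>
          setLReg s d (E.weight s(⟨s.reg x, h⟩, y))
      else none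
  | .emit a => some { s with out := s.out ++ [s.reg a] }

/-- Tests. -/
inductive Test where
  | lt (a b : ℕ)
  | le (a b : ℕ)
  | eq (a b : ℕ)
  | ne (a b : ℕ)
  | llt (a b : ℕ)
  | lle (a b : ℕ)

/-- The outcome of a test, on words or on lengths. -/
def Test.Holds (s : State) : Test → Prop
  | .lt a b => s.reg a < s.reg b
  | .le a b => s.reg a ≤ s.reg b
  | .eq a b => s.reg a = s.reg b
  | .ne a b => s.reg a ≠ s.reg b
  | .llt a b => s.lreg a < s.lreg b
  | .lle a b => s.lreg a ≤ s.lreg b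

/-- Programs. -/
inductive Prog where
  | skip
  | op (i : Instr)
  | seq (p q : Prog)
  | ite (c : Test) (p q : Prog)
  | loop (c : Test) (p : Prog)

/-- `Exec E p s t s'`: started in the state `s`, the program `p` halts in the state `s'` after
exactly `t` units of time. -/
inductive Exec {n : ℕ} (E : Env n) : Prog → State → ℕ → State → Prop
  | skip (s : State) : Exec E .skip s 0 s
  | op {i : Instr} {s s' : State} (h : step E s i = some s') : Exec E (.op i) s 1 s'
  | seq {p q : Prog} {s s' s'' : State} {t t' : ℕ} (hp : Exec E p s t s')
      (hq : Exec E q s' t' s'') : Exec E (.seq p q) s (t + t') s''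
  | ite_true {c : Test} {p q : Prog} {s s' : State} {t : ℕ} (hc : c.Holds s)
      (hp : Exec E p s t s') : Exec E (.ite c p q) s (t + 1) s'
  | ite_false {c : Test} {p q : Prog} {s s' : State} {t : ℕ} (hc : ¬ c.Holds s)
      (hq : Exec E q s t s') : Exec E (.ite c p q) s (t + 1) s'
  | loop_false {c : Test} {p : Prog} {s : State} (hc : ¬ c.Holds s) : Exec E (.loop c p) s 1 s
  | loop_true {c : Test} {p : Prog} {s s' s'' : State} {t t' : ℕ} (hc : c.Holds s)
      (hp : Exec E p s t s') (hl : Exec E (.loop c p) s' t' s'') :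
      Exec E (.loop c p) s (t + t' + 1) s''

/-! ## Oracles -/

/-- The memory of an oracle, beside the input graph: an array of words, which holds the stored
data and the work space of the queries, and a number of length cells, all of them initially `0`,
for the work space of the queries. -/
structure Memory where
  words : List ℕ
  lcells : ℕ

/-- The size of an oracle, in addition to the input graph. -/
def Memory.size (D : Memory) : ℕ := D.words.length + D.lcells

/-- The state at the beginning of the query `(u, v)`. -/
def initState {n : ℕ} (D : Memory) (u v : Fin n) : State where
  reg := fun i => if i = 0 then u else if i = 1 then v else 0
  lreg := fun _ => 0
  mem := D.words
  lmem := List.replicate D.lcells 0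
  out := []

/-- On the query `(u, v)` the program `q` halts after `t` units of time, has written the list
`o` of vertices and left the length `δ` in length register `0`. The memory is
restored, so that it is ready for the next query. -/
def Answers {n : ℕ} (E : Env n) (q : Prog) (D : Memory) (u v : Fin n) (t : ℕ)
    (o : List (Fin n)) (δ : ℝ≥0) : Prop :=
  ∃ s : State, Exec E q (initState D u v) t s ∧
    s.mem = D.words ∧ s.lmem = List.replicate D.lcells 0 ∧
    s.out = o.map Fin.val ∧ s.lreg 0 = δ

/-- `|Π|`: the number of edges of the path with the vertex list `o` (`0` for the empty list,
which reports that there is no path). -/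
def hops {n : ℕ} (o : List (Fin n)) : ℕ := o.length - 1

/-! ## The random landmarks -/

/-- The number `⌈deg(v) / λ⌉` of virtual copies of the vertex `v`. -/
def numCopies {n : ℕ} (G : SimpleGraph (Fin n)) (v : Fin n) : ℕ :=
  ⌈(deg G v : ℝ) / density G⌉₊

/-- The virtual nodes. -/
abbrev VirtualNode {n : ℕ} (G : SimpleGraph (Fin n)) : Type :=
  Σ v : Fin n, Fin (numCopies G v)

/-- The parameter `ρ = n ^ (k / (2 k + 2)) / k`. -/
def rho (n k : ℕ) : ℝ := (n : ℝ) ^ ((k : ℝ) / (2 * k + 2)) / k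

/-- The probability that `S` is the set of selected virtual nodes, when each virtual node is
selected independently with probability `ρ / n`. -/
def sampleWeight {n : ℕ} (G : SimpleGraph (Fin n)) (k : ℕ) (S : Finset (VirtualNode G)) : ℝ :=
  (rho n k / n) ^ S.card * (1 - rho n k / n) ^ Sᶜ.card

/-- The landmarks: the vertices with at least one selected virtual copy. -/
def landmarks {n : ℕ} {G : SimpleGraph (Fin n)} (S : Finset (VirtualNode G)) :
    Finset (Fin n) := S.image Sigma.fst

/-- The expectation of a random variable that depends on the landmark set. -/
def expect {n : ℕ} (G : SimpleGraph (Fin n)) (k : ℕ) (X : Finset (Fin n) → ℝ) : ℝ :=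
  ∑ S : Finset (VirtualNode G), sampleWeight G k S * X (landmarks S)

open Classical in
/-- The probability of an event that depends on the landmark set. -/
def prob {n : ℕ} (G : SimpleGraph (Fin n)) (k : ℕ) (A : Finset (Fin n) → Prop) : ℝ :=
  expect G k fun L => if A L then 1 else 0

/-- `x` is a landmark closest to `u`. -/
def IsNearest {n : ℕ} (G : SimpleGraph (Fin n)) (w : Sym2 (Fin n) → ℝ≥0)
    (L : Finset (Fin n)) (u x : Fin n) : Prop :=
  x ∈ L ∧ ∀ y ∈ L, wdist G w u x ≤ wdist G w u y

/-- `o` and `δ` are a correct answer to the query `(u, v)`: the vertex list and the length of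
a `(6 k - 1)`-approximate shortest `u`-`v` path which, unless it is a shortest path, passes
through a landmark closest to `u` and a landmark closest to `v`; or the empty list, if there is
no `u`-`v` path. -/
def Correct {n : ℕ} (G : SimpleGraph (Fin n)) (w : Sym2 (Fin n) → ℝ≥0) (k : ℕ)
    (L : Finset (Fin n)) (u v : Fin n) (o : List (Fin n)) (δ : ℝ≥0) : Prop :=
  (G.Reachable u v →
    ∃ p : G.Walk u v, o = p.support ∧ δ = walkLen w p ∧
      (δ : ℝ≥0∞) ≤ ((6 * k - 1 : ℕ) : ℝ≥0∞) * wdist G w u v ∧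
      ((δ : ℝ≥0∞) = wdist G w u v ∨
        ∃ x ∈ p.support, ∃ y ∈ p.support, IsNearest G w L u x ∧ IsNearest G w L v y)) ∧
  (¬ G.Reachable u v → o = [])

/-- For the weighted graph `(G, w)` and the parameter `k`, the query program `q` on words below
`n ^ a` gives a path-reporting distance oracle built from the random landmarks, with expected
query time `O(B)`, query time `O(B log n)` with high probability (both beside the additive term
`O(|Π|)`), and size `O(n)` with high probability. The implied constant is `C` where no
probability is involved or in the expectation, and `C' c` for bounds with failure probability at
most `n ^ (-c)`. -/
def IsOracle {n : ℕ} (G : SimpleGraph (Fin n)) (w : Sym2 (Fin n) → ℝ≥0) (k : ℕ)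
    (q : Prog) (a : ℕ) (C : ℝ) (C' : ℕ → ℝ) (B : ℝ) : Prop :=
  ∃ (D : Finset (Fin n) → Memory) (T : Finset (Fin n) → Fin n → Fin n → ℕ)
    (o : Finset (Fin n) → Fin n → Fin n → List (Fin n))
    (δ : Finset (Fin n) → Fin n → Fin n → ℝ≥0),
    (∀ L, ∀ x ∈ (D L).words, x < n ^ a) ∧
    (∀ L u v, Answers ⟨G, w, n ^ a⟩ q (D L) u v (T L u v) (o L u v) (δ L u v)) ∧
    (∀ L u v, Correct G w k L u v (o L u v) (δ L u v)) ∧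
    (∀ c : ℕ, 1 - ((n : ℝ) ^ c)⁻¹ ≤ prob G k fun L => ((D L).size : ℝ) ≤ C' c * n) ∧
    (∀ u v, expect G k (fun L => max 0 ((T L u v : ℝ) - C * hops (o L u v))) ≤ C * B) ∧
    (∀ c : ℕ, 1 - ((n : ℝ) ^ c)⁻¹ ≤ prob G k fun L =>
      ∀ u v, (T L u v : ℝ) ≤ C' c * (B * Real.log n) + C * hops (o L u v))

/-- The bound `n ^ (1/2 + 1/(2k+2)) * k * (m / n)`. -/
def queryBound {n : ℕ} (G : SimpleGraph (Fin n)) (k : ℕ) : ℝ :=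
  (n : ℝ) ^ ((1 : ℝ) / 2 + 1 / (2 * k + 2)) * k * density G

end DistOracle

end

/-! A query (u, v) first searches outward from v, and then from u, among the vertices that are
strictly closer to the source than every landmark (`ball`). If one search meets the other end, a
shortest path has been found. Otherwise the nearest landmarks x of u and y of v satisfy d(u, x) ≤
d(u, v) and d(v, y) ≤ d(u, v), hence d(x, y) ≤ 3 d(u, v). The landmarks are joined by routes of
stretch 2k - 1, and the path from u to x to y to v has length at most (1 + 3(2k - 1) + 1) d(u, v) =
(6k - 1) d(u, v) (`queryCmd_spec`).

Space. Per vertex the oracle stores a pointer in a forest of shortest paths to L (`exists_forest`)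
and a component name. Routes between landmarks follow next hops in a greedy (2k - 1)-spanner of the
distance graph on L (`exists_spanner`). The spanner has no cycle of length at most 2k, hence
O(|L|^(1 + 1/k)) edges (`HighGirth.card_adj_le`). Each of its D directed edges stands for a shortest
path of G, which may be long. Ties between shortest paths are broken consistently, so that two of
the chosen paths meet in a common contiguous part. Then all vertices on the paths fit into one array
of length n in which every path is a sequence of at most 2D + 1 runs of consecutive positions
(`exists_positions`, `exists_runList`). The runs take O(D^2) words and the next-hop table |L|^2.
With high probability |L| = O(ρ + log n) (`card_landmarks_whp`), so D = O(n^(1/2)) and everything is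
O(n) (`exists_tables`, `size_le`).

Time. A search costs the sum of deg + 1 over its ball, times the cost of a queue operation. A vertex
has at least deg / λ virtual copies, so this sum is O(1 + λ · number of copies in the ball). Copies
in a ball are copies passed, in the order of distance, before the first selected one; their expected
number is at most n / ρ (`expect_ballCopies_le`), and it is O((n / ρ) log n) for all balls at once
with high probability (`ballCopies_whp`). Finally λ n / ρ is the claimed bound (`queryBound_eq`). A
FIFO queue suffices for unit weights; a tournament tree costs the additional factor log n in
general. Writing the path and resetting the work space are charged to the path and to the ball.

The statement demands actual machine programs. The query is written in a small structured language
whose compiler preserves meaning and exact running time (`AExec.sound`), and is verified by weakest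
preconditions that track time. `isOracle_of_isQueue` puts everything together for an arbitrary
priority queue satisfying `IsQueue`. -/

noncomputable section
set_option linter.unusedSimpArgs false
namespace DistOracle

/-! ## A structured language on top of the machine

The memory is organised in records of sixteen fields, preceded by a header that holds `n` and
followed by a read-only area with absolute addresses. Expressions are compiled to machine
instructions that use the registers from `32` on as temporaries. -/

/-- The adjacency lists with natural numbers as names of vertices. -/
def degN {n : ℕ} (G : SimpleGraph (Fin n)) (x : ℕ) : ℕ :=
  if h : x < n then deg G ⟨x, h⟩ else 0

def nbrN {n : ℕ} (G : SimpleGraph (Fin n)) (x j : ℕ) : ℕ :=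
  if h : x < n then (((adjList G ⟨x, h⟩)[j]?).map Fin.val).getD 0 else 0

def wtN {n : ℕ} (G : SimpleGraph (Fin n)) (w : Sym2 (Fin n) → ℝ≥0) (x j : ℕ) : ℝ≥0 :=
  if h : x < n then (((adjList G ⟨x, h⟩)[j]?).map fun y => w s(⟨x, h⟩, y)).getD 0 else 0

lemma adjList_length {n : ℕ} (G : SimpleGraph (Fin n)) (v : Fin n) :
    (adjList G v).length = deg G v := by
  classical
  simp [adjList, deg]

lemma mem_adjList {n : ℕ} (G : SimpleGraph (Fin n)) (v y : Fin n) :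
    y ∈ adjList G v ↔ G.Adj v y := by
  classical
  simp [adjList]

lemma deg_lt {n : ℕ} (G : SimpleGraph (Fin n)) (v : Fin n) : deg G v < n := by
  classical
  have := G.degree_lt_card_verts v
  simpa [deg] using this

/-- The fixed data of a computation: the machine environment, the number `R` of records, the
length `N` of the memory and the contents `x` of the read-only area. -/
structure Layout (n : ℕ) where
  E : Env n
  R : ℕ
  N : ℕ
  x : ℕ → ℕ
  hx : ∀ a, x a < E.wordBound
  hn : 1 ≤ n
  hR : n ≤ R
  hN : 16 * (R + 1) ≤ N
  hW : N ≤ E.wordBound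

/-- States of the structured language. -/
structure AS where
  r : ℕ → ℕ
  lr : ℕ → ℝ≥0
  f : ℕ → ℕ → ℕ
  lm : ℕ → ℝ≥0
  out : List ℕ

/-- `v` is a register, `fld` a field of a record, `ab` a read-only word at an absolute address;
`size` fetches the number of vertices from the header. -/
inductive Ex where
  | v (i : ℕ)
  | c (k : ℕ)
  | add (a b : Ex)
  | sub (a b : Ex)
  | div (a b : Ex)
  | fld (f : ℕ) (a : Ex)
  | ab (a : Ex)
  | size
  | deg (a : Ex)
  | nbr (a b : Ex)

inductive Cnd where
  | eq (a b : Ex)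
  | ne (a b : Ex)
  | lt (a b : Ex)
  | llt (i j : ℕ)

/-- The prefix `l` marks commands on lengths. `lstz` stores the length zero and overwrites length
register 5 for this purpose. -/
inductive Cmd where
  | skip
  | asg (x : ℕ) (e : Ex)
  | setf (f : ℕ) (i e : Ex)
  | lzero (d : ℕ)
  | ladd (d a b : ℕ)
  | lload (d : ℕ) (e : Ex)
  | lstore (e : Ex) (d : ℕ)
  | lstz (e : Ex)
  | lwt (d : ℕ) (a b : Ex)
  | emit (e : Ex)
  | seq (p q : Cmd)
  | ite (c : Cnd) (p q : Cmd)
  | loop (c : Cnd) (p : Cmd)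

variable {n : ℕ} (Λ : Layout n)

def Ex.ev (σ : AS) : Ex → ℕ
  | .v i => σ.r i
  | .c k => k
  | .add a b => a.ev σ + b.ev σ
  | .sub a b => a.ev σ - b.ev σ
  | .div a b => a.ev σ / b.ev σ
  | .fld f a => σ.f f (a.ev σ)
  | .ab a => Λ.x (a.ev σ)
  | .size => n
  | .deg a => degN Λ.E.graph (a.ev σ)
  | .nbr a b => nbrN Λ.E.graph (a.ev σ) (b.ev σ)

/-- These conditions keep the machine from getting stuck: accesses stay inside the memory and the
adjacency lists, and sums stay below the memory length, which is at most the word bound. -/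
def Ex.ok (σ : AS) : Ex → Prop
  | .v i => i < 32
  | .c k => k < 32
  | .add a b => a.ok σ ∧ b.ok σ ∧ a.ev Λ σ + b.ev Λ σ < Λ.N
  | .sub a b => a.ok σ ∧ b.ok σ
  | .div a b => a.ok σ ∧ b.ok σ
  | .fld f a => a.ok σ ∧ f < 16 ∧ a.ev Λ σ < Λ.R
  | .ab a => a.ok σ ∧ 16 * (Λ.R + 1) ≤ a.ev Λ σ ∧ a.ev Λ σ < Λ.N
  | .size => True
  | .deg a => a.ok σ ∧ a.ev Λ σ < n
  | .nbr a b => a.ok σ ∧ b.ok σ ∧ a.ev Λ σ < n ∧ b.ev Λ σ < degN Λ.E.graph (a.ev Λ σ)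

def Ex.cost : Ex → ℕ
  | .v _ => 1
  | .c _ => 1
  | .add a b => a.cost + (b.cost + 1)
  | .sub a b => a.cost + (b.cost + 1)
  | .div a b => a.cost + (b.cost + 1)
  | .fld _ a => a.cost + 5
  | .ab a => a.cost + 1
  | .size => 2
  | .deg a => a.cost + 1
  | .nbr a b => a.cost + (b.cost + 1)

/-- The value is left in register `d`, and only registers from `d` on are written. -/
def Ex.comp : Ex → ℕ → Prog
  | .v i, d => .op (.copy d i)
  | .c k, d => .op (.const d k)
  | .add a b, d => .seq (a.comp d) (.seq (b.comp (d + 1)) (.op (.add d d (d + 1))))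
  | .sub a b, d => .seq (a.comp d) (.seq (b.comp (d + 1)) (.op (.sub d d (d + 1))))
  | .div a b, d => .seq (a.comp d) (.seq (b.comp (d + 1)) (.op (.div d d (d + 1))))
  | .fld f a, d => .seq (a.comp d) (.seq (.op (.const (d + 1) 16)) (.seq (.op (.mul d d (d + 1)))
      (.seq (.op (.const (d + 1) (16 + f))) (.seq (.op (.add d d (d + 1))) (.op (.load d d))))))
  | .ab a, d => .seq (a.comp d) (.op (.load d d))
  | .size, d => .seq (.op (.const d 0)) (.op (.load d d))
  | .deg a, d => .seq (a.comp d) (.op (.degree d d))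
  | .nbr a b, d => .seq (a.comp d) (.seq (b.comp (d + 1)) (.op (.nbr d d (d + 1))))

/-- The contents of the memory as a function of the address. -/
def memFun (σ : AS) (A : ℕ) : ℕ :=
  if A < 16 then n else if A < 16 * (Λ.R + 1) then σ.f (A % 16) (A / 16 - 1) else Λ.x A

/-- All words in a state are below the word bound. -/
def Good (σ : AS) : Prop := (∀ i, σ.r i < Λ.E.wordBound) ∧ ∀ f i, σ.f f i < Λ.E.wordBound

/-- The machine state `s` represents the abstract state `σ`. -/
structure Rep (σ : AS) (s : State) : Prop where
  reg : ∀ i < 32, s.reg i = σ.r i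
  lreg : s.lreg = σ.lr
  mem : s.mem = (List.range Λ.N).map (memFun Λ σ)
  lmem : s.lmem = (List.range n).map σ.lm
  out : s.out = σ.out

variable {Λ}

lemma Layout.big : 32 ≤ Λ.E.wordBound := by
  have h1 := Λ.hn; have h2 := Λ.hR; have h3 := Λ.hN; have h4 := Λ.hW
  omega

lemma Layout.n_lt : n < Λ.E.wordBound := by
  have h1 := Λ.hn; have h2 := Λ.hR; have h3 := Λ.hN; have h4 := Λ.hW
  omega

lemma degN_lt (G : SimpleGraph (Fin n)) (hn : 1 ≤ n) (x : ℕ) : degN G x < n := by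
  unfold degN; split_ifs
  · exact deg_lt _ _
  · omega

lemma nbrN_lt (G : SimpleGraph (Fin n)) (hn : 1 ≤ n) (x j : ℕ) : nbrN G x j < n := by
  unfold nbrN; split_ifs with h
  · cases h : (adjList G ⟨x, h⟩)[j]? with
    | none => simp; omega
    | some y => simp
  · omega

lemma Ex.ev_lt {σ : AS} (hg : Good Λ σ) : ∀ e : Ex, e.ok Λ σ → e.ev Λ σ < Λ.E.wordBound
  | .v i, _ => hg.1 i
  | .c _, h => lt_of_lt_of_le h Λ.big
  | .add _ _, h => lt_of_lt_of_le h.2.2 Λ.hW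
  | .sub a _, h => lt_of_le_of_lt (Nat.sub_le _ _) (Ex.ev_lt hg a h.1)
  | .div a _, h => lt_of_le_of_lt (Nat.div_le_self _ _) (Ex.ev_lt hg a h.1)
  | .fld _ _, _ => hg.2 _ _
  | .ab _, _ => Λ.hx _
  | .size, _ => Λ.n_lt
  | .deg _, _ => (degN_lt _ Λ.hn _).trans Λ.n_lt
  | .nbr _ _, _ => (nbrN_lt _ Λ.hn _ _).trans Λ.n_lt

lemma Rep.updReg {σ : AS} {s : State} (h : Rep Λ σ s) {ρ : ℕ → ℕ}
    (hρ : ∀ i < 32, ρ i = s.reg i) : Rep Λ σ { s with reg := ρ } :=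
  ⟨fun i hi => (hρ i hi).trans (h.reg i hi), h.lreg, h.mem, h.lmem, h.out⟩

lemma Rep.mem_get {σ : AS} {s : State} (h : Rep Λ σ s) {A : ℕ} (hA : A < Λ.N) :
    s.mem[A]? = some (memFun Λ σ A) := by
  rw [h.mem]; simp [hA]

lemma memFun_field (σ : AS) {f i : ℕ} (hf : f < 16) (hi : i < Λ.R) :
    memFun Λ σ (i * 16 + (16 + f)) = σ.f f i := by
  unfold memFun
  rw [if_neg (by omega), if_pos (by omega)]
  congr 1 <;> omega

lemma step_setReg {E : Env n} {s : State} {d x : ℕ} (h : x < E.wordBound) :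
    setReg E.wordBound s d x = some { s with reg := Function.update s.reg d x } := by
  simp [setReg, h]

/-- Induction on the expression. The left operand, kept in `d`, survives because the right operand
is computed from `d + 1` on; abstract registers lie below 32 and are never touched. -/
theorem Ex.comp_exec {σ : AS} (hg : Good Λ σ) :
    ∀ (e : Ex) (d : ℕ) (s : State), 32 ≤ d → Rep Λ σ s → e.ok Λ σ →
      ∃ ρ : ℕ → ℕ, Exec Λ.E (e.comp d) s e.cost { s with reg := ρ } ∧ ρ d = e.ev Λ σ ∧
        ∀ i < d, ρ i = s.reg i := by
  -- The common argument for sums, differences, quotients and neighbours; `g` is the function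
  -- computed by the instruction `op`.
  have bin : ∀ (a b : Ex) (op : ℕ → ℕ → ℕ → Instr) (g : ℕ → ℕ → ℕ) (d : ℕ) (s : State),
      (∀ d s, 32 ≤ d → Rep Λ σ s → a.ok Λ σ →
        ∃ ρ : ℕ → ℕ, Exec Λ.E (a.comp d) s a.cost { s with reg := ρ } ∧ ρ d = a.ev Λ σ ∧
        ∀ i < d, ρ i = s.reg i) →
      (∀ d s, 32 ≤ d → Rep Λ σ s → b.ok Λ σ →
        ∃ ρ : ℕ → ℕ, Exec Λ.E (b.comp d) s b.cost { s with reg := ρ } ∧ ρ d = b.ev Λ σ ∧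
        ∀ i < d, ρ i = s.reg i) →
      (∀ s : State, s.reg d = a.ev Λ σ → s.reg (d + 1) = b.ev Λ σ →
        step Λ.E s (op d d (d + 1)) = setReg Λ.E.wordBound s d (g (a.ev Λ σ) (b.ev Λ σ))) →
      32 ≤ d → Rep Λ σ s → a.ok Λ σ → b.ok Λ σ →
      g (a.ev Λ σ) (b.ev Λ σ) < Λ.E.wordBound →
      ∃ ρ : ℕ → ℕ, Exec Λ.E (.seq (a.comp d) (.seq (b.comp (d + 1)) (.op (op d d (d + 1))))) s
        (a.cost + (b.cost + 1)) { s with reg := ρ } ∧ ρ d = g (a.ev Λ σ) (b.ev Λ σ) ∧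
        ∀ i < d, ρ i = s.reg i := by
    intro a b op g d s iha ihb hop hd hs ha hb hlt
    obtain ⟨ρ1, h1, e1, f1⟩ := iha d s hd hs ha
    have hs1 := hs.updReg (ρ := ρ1) (fun i hi => f1 i (by omega))
    obtain ⟨ρ2, h2, e2, f2⟩ := ihb (d + 1) _ (by omega) hs1 hb
    refine ⟨Function.update ρ2 d (g (a.ev Λ σ) (b.ev Λ σ)), .seq h1 (.seq h2 (.op ?_)), ?_, ?_⟩
    · rw [hop, step_setReg hlt]
      · exact (f2 d (by omega)).trans e1
      · exact e2
    · simp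
    · intro i hi
      rw [Function.update_of_ne (by omega), f2 i (by omega)]
      exact f1 i hi
  intro e
  induction e with
  | v i =>
    intro d s hd hs h
    refine ⟨Function.update s.reg d (σ.r i), .op ?_, by simp [Ex.ev], fun j hj => ?_⟩
    · simp only [step]
      rw [hs.reg i h, step_setReg (hg.1 i)]
    · rw [Function.update_of_ne (by omega)]
  | c k =>
    intro d s hd hs h
    refine ⟨Function.update s.reg d k, .op ?_, by simp [Ex.ev], fun j hj => ?_⟩
    · simp only [step]
      rw [step_setReg (lt_of_lt_of_le h Λ.big)]
    · rw [Function.update_of_ne (by omega)]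
  | add a b iha ihb =>
    intro d s hd hs h
    exact bin a b .add (· + ·) d s iha ihb (by intro s h1 h2; simp [step, h1, h2]) hd hs h.1 h.2.1
      (Ex.ev_lt hg (.add a b) h)
  | sub a b iha ihb =>
    intro d s hd hs h
    exact bin a b .sub (· - ·) d s iha ihb (by intro s h1 h2; simp [step, h1, h2]) hd hs h.1 h.2
      (Ex.ev_lt hg (.sub a b) h)
  | div a b iha ihb =>
    intro d s hd hs h
    exact bin a b .div (· / ·) d s iha ihb (by intro s h1 h2; simp [step, h1, h2]) hd hs h.1 h.2
      (Ex.ev_lt hg (.div a b) h)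
  | nbr a b iha ihb =>
    intro d s hd hs h
    refine bin a b .nbr (nbrN Λ.E.graph) d s iha ihb ?_ hd hs h.1 h.2.1
      (Ex.ev_lt hg (.nbr a b) h)
    intro s h1 h2
    have h3 := h.2.2.1
    have h4 := h.2.2.2
    simp only [degN, dif_pos h3, ← adjList_length] at h4
    simp only [step, h1, h2, dif_pos h3, nbrN]
    rw [List.getElem?_eq_getElem h4]; simp
  | fld f a iha =>
    intro d s hd hs h
    obtain ⟨ha, hf, hR⟩ := h
    obtain ⟨ρ1, h1, e1, f1⟩ := iha d s hd hs ha
    have hN := Λ.hN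
    have hW := Λ.hW
    have hb := Λ.big
    have hs1 := hs.updReg (ρ := ρ1) (fun i hi => f1 i (by omega))
    let stt : (ℕ → ℕ) → State := fun ρ => { s with reg := ρ }
    let u1 : (ℕ → ℕ) → ℕ → ℕ := fun ρ => Function.update ρ (d + 1) 16
    let u2 : (ℕ → ℕ) → ℕ → ℕ := fun ρ => Function.update (u1 ρ) d (a.ev Λ σ * 16)
    let u3 : (ℕ → ℕ) → ℕ → ℕ := fun ρ => Function.update (u2 ρ) (d + 1) (16 + f)
    let u4 : (ℕ → ℕ) → ℕ → ℕ := fun ρ => Function.update (u3 ρ) d (a.ev Λ σ * 16 + (16 + f))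
    refine ⟨Function.update (Function.update (Function.update (Function.update (Function.update ρ1
      (d + 1) 16) d (a.ev Λ σ * 16)) (d + 1) (16 + f)) d (a.ev Λ σ * 16 + (16 + f))) d
      (σ.f f (a.ev Λ σ)),
      .seq h1 (.seq (.op (s' := stt (u1 ρ1)) ?_) (.seq (.op (s' := stt (u2 ρ1)) ?_)
      (.seq (.op (s' := stt (u3 ρ1)) ?_)
      (.seq (.op (s' := stt (u4 ρ1)) ?_) (.op ?_))))), by simp [Ex.ev], fun j hj => ?_⟩
    · simp only [step, stt, u1, u2, u3, u4]
      rw [step_setReg (by omega)]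
    · simp only [step, stt, u1, u2, u3, u4]
      rw [step_setReg] <;> simp [e1]
      omega
    · simp only [step, stt, u1, u2, u3, u4]
      rw [step_setReg (by omega)]
    · simp only [step, stt, u1, u2, u3, u4]
      rw [step_setReg] <;> simp
      omega
    · simp only [step, stt, u1, u2, u3, u4]
      have hm := hs1.mem_get (A := a.ev Λ σ * 16 + (16 + f)) (by omega)
      rw [memFun_field σ hf hR] at hm
      simp only at hm
      simp only [Function.update_self, hm, Option.bind_some]
      rw [step_setReg (hg.2 _ _)]
    · rw [Function.update_of_ne (by omega), Function.update_of_ne (by omega),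
        Function.update_of_ne (by omega), Function.update_of_ne (by omega),
        Function.update_of_ne (by omega)]
      exact f1 j hj
  | ab a iha =>
    intro d s hd hs h
    obtain ⟨ha, h16, hN⟩ := h
    obtain ⟨ρ1, h1, e1, f1⟩ := iha d s hd hs ha
    have hs1 := hs.updReg (ρ := ρ1) (fun i hi => f1 i (by omega))
    refine ⟨Function.update ρ1 d (Λ.x (a.ev Λ σ)), .seq h1 (.op ?_), by simp [Ex.ev],
      fun j hj => ?_⟩
    · simp only [step]
      have hm := hs1.mem_get hN
      have : memFun Λ σ (a.ev Λ σ) = Λ.x (a.ev Λ σ) := by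
        unfold memFun; rw [if_neg (by omega), if_neg (by omega)]
      rw [this] at hm
      simp only at hm
      simp only [e1, hm, Option.bind_some]
      rw [step_setReg (Λ.hx _)]
    · rw [Function.update_of_ne (by omega)]
      exact f1 j hj
  | size =>
    intro d s hd hs h
    have hN := Λ.hN
    let s1 : State := { s with reg := Function.update s.reg d 0 }
    refine ⟨Function.update (Function.update s.reg d 0) d n, .seq (s' := s1) (.op ?_) (.op ?_),
      by simp [Ex.ev], fun j hj => ?_⟩
    · simp only [step]
      rw [step_setReg (lt_of_lt_of_le (by norm_num) Λ.big)]
    · have hm := hs.mem_get (A := 0) (by omega)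
      simp only [step, s1, Function.update_self, hm, Option.bind_some]
      simp only [memFun]
      rw [if_pos (by norm_num), step_setReg Λ.n_lt]
    · rw [Function.update_of_ne (by omega), Function.update_of_ne (by omega)]
  | deg a iha =>
    intro d s hd hs h
    obtain ⟨ha, hlt⟩ := h
    obtain ⟨ρ1, h1, e1, f1⟩ := iha d s hd hs ha
    refine ⟨Function.update ρ1 d (degN Λ.E.graph (a.ev Λ σ)), .seq h1 (.op ?_), by simp [Ex.ev],
      fun j hj => ?_⟩
    · simp only [step, e1, dif_pos hlt]
      rw [step_setReg]
      · simp [degN, dif_pos hlt]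
      · exact (deg_lt _ _).trans Λ.n_lt
    · rw [Function.update_of_ne (by omega)]
      exact f1 j hj

def Cnd.setup : Cnd → Prog
  | .eq a b | .ne a b | .lt a b => .seq (a.comp 32) (b.comp 33)
  | .llt _ _ => .skip

def Cnd.test : Cnd → Test
  | .eq _ _ => .eq 32 33
  | .ne _ _ => .ne 32 33
  | .lt _ _ => .lt 32 33
  | .llt i j => .llt i j

def Cnd.cost : Cnd → ℕ
  | .eq a b | .ne a b | .lt a b => a.cost + b.cost
  | .llt _ _ => 0

variable (Λ)

def Cnd.ok (σ : AS) : Cnd → Prop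
  | .eq a b | .ne a b | .lt a b => a.ok Λ σ ∧ b.ok Λ σ
  | .llt _ _ => True

def Cnd.holds (σ : AS) : Cnd → Prop
  | .eq a b => a.ev Λ σ = b.ev Λ σ
  | .ne a b => a.ev Λ σ ≠ b.ev Λ σ
  | .lt a b => a.ev Λ σ < b.ev Λ σ
  | .llt i j => σ.lr i < σ.lr j

variable {Λ}

theorem Cnd.setup_exec {σ : AS} (hg : Good Λ σ) (c : Cnd) (s : State) (hs : Rep Λ σ s)
    (h : c.ok Λ σ) :
    ∃ s', Exec Λ.E c.setup s c.cost s' ∧ Rep Λ σ s' ∧ (c.test.Holds s' ↔ c.holds Λ σ) := by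
  have bin : ∀ a b : Ex, a.ok Λ σ → b.ok Λ σ → ∃ s', Exec Λ.E (.seq (a.comp 32) (b.comp 33)) s
      (a.cost + b.cost) s' ∧ Rep Λ σ s' ∧ s'.reg 32 = a.ev Λ σ ∧ s'.reg 33 = b.ev Λ σ := by
    intro a b ha hb
    obtain ⟨ρ1, h1, e1, f1⟩ := Ex.comp_exec hg a 32 s le_rfl hs ha
    have hs1 := hs.updReg (ρ := ρ1) (fun i hi => f1 i (by omega))
    obtain ⟨ρ2, h2, e2, f2⟩ := Ex.comp_exec hg b 33 _ (by norm_num) hs1 hb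
    refine ⟨_, .seq h1 h2, hs1.updReg (fun i hi => f2 i (by omega)), ?_, e2⟩
    simp only
    rw [f2 32 (by omega)]
    exact e1
  cases c with
  | eq a b =>
    obtain ⟨s', h1, h2, h3, h4⟩ := bin a b h.1 h.2
    exact ⟨s', h1, h2, by simp [Cnd.test, Test.Holds, Cnd.holds, h3, h4]⟩
  | ne a b =>
    obtain ⟨s', h1, h2, h3, h4⟩ := bin a b h.1 h.2
    exact ⟨s', h1, h2, by simp [Cnd.test, Test.Holds, Cnd.holds, h3, h4]⟩
  | lt a b =>
    obtain ⟨s', h1, h2, h3, h4⟩ := bin a b h.1 h.2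
    exact ⟨s', h1, h2, by simp [Cnd.test, Test.Holds, Cnd.holds, h3, h4]⟩
  | llt i j =>
    exact ⟨s, .skip _, hs, by simp [Cnd.test, Test.Holds, Cnd.holds, hs.lreg]⟩

/-- Machine tests compare registers only, so a loop evaluates the operands of its condition once
before the first test and again at the end of every pass. -/
def Cmd.comp : Cmd → Prog
  | .skip => .skip
  | .asg x e => .seq (e.comp 32) (.op (.copy x 32))
  | .setf f i e => .seq (i.comp 32) (.seq (e.comp 33) (.seq (.op (.const 34 16))
      (.seq (.op (.mul 32 32 34)) (.seq (.op (.const 34 (16 + f))) (.seq (.op (.add 32 32 34))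
        (.op (.store 32 33)))))))
  | .lzero d => .op (.lzero d)
  | .ladd d a b => .op (.ladd d a b)
  | .lload d e => .seq (e.comp 32) (.op (.lload d 32))
  | .lstore e d => .seq (e.comp 32) (.op (.lstore 32 d))
  | .lstz e => .seq (e.comp 32) (.seq (.op (.lzero 5)) (.op (.lstore 32 5)))
  | .lwt d a b => .seq (a.comp 32) (.seq (b.comp 33) (.op (.wt d 32 33)))
  | .emit e => .seq (e.comp 32) (.op (.emit 32))
  | .seq p q => .seq p.comp q.comp
  | .ite c p q => .seq c.setup (.ite c.test p.comp q.comp)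
  | .loop c p => .seq c.setup (.loop c.test (.seq p.comp c.setup))

def AS.setr (σ : AS) (x a : ℕ) : AS := { σ with r := Function.update σ.r x a }
def AS.setl (σ : AS) (x : ℕ) (a : ℝ≥0) : AS := { σ with lr := Function.update σ.lr x a }
def AS.setm (σ : AS) (x : ℕ) (a : ℝ≥0) : AS := { σ with lm := Function.update σ.lm x a }
def AS.setf (σ : AS) (f i a : ℕ) : AS :=
  { σ with f := Function.update σ.f f (Function.update (σ.f f) i a) }
def AS.app (σ : AS) (a : ℕ) : AS := { σ with out := σ.out ++ [a] }

variable (Λ)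

/-- Big-step semantics of the structured language, with running times. -/
inductive AExec : Cmd → AS → ℕ → AS → Prop
  | skip (σ : AS) : AExec .skip σ 0 σ
  | asg {x : ℕ} {e : Ex} {σ : AS} (hx : x < 32) (h : e.ok Λ σ) :
      AExec (.asg x e) σ (e.cost + 1) (σ.setr x (e.ev Λ σ))
  | setf {f : ℕ} {i e : Ex} {σ : AS} (hf : f < 16) (hi : i.ok Λ σ) (he : e.ok Λ σ)
      (hR : i.ev Λ σ < Λ.R) :
      AExec (.setf f i e) σ (i.cost + (e.cost + 5)) (σ.setf f (i.ev Λ σ) (e.ev Λ σ))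
  | lzero {d : ℕ} {σ : AS} : AExec (.lzero d) σ 1 (σ.setl d 0)
  | ladd {d a b : ℕ} {σ : AS} : AExec (.ladd d a b) σ 1 (σ.setl d (σ.lr a + σ.lr b))
  | lload {d : ℕ} {e : Ex} {σ : AS} (h : e.ok Λ σ) (hn : e.ev Λ σ < n) :
      AExec (.lload d e) σ (e.cost + 1) (σ.setl d (σ.lm (e.ev Λ σ)))
  | lstore {d : ℕ} {e : Ex} {σ : AS} (h : e.ok Λ σ) (hn : e.ev Λ σ < n) :
      AExec (.lstore e d) σ (e.cost + 1) (σ.setm (e.ev Λ σ) (σ.lr d))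
  | lstz {e : Ex} {σ : AS} (h : e.ok Λ σ) (hn : e.ev Λ σ < n) :
      AExec (.lstz e) σ (e.cost + 2) ((σ.setl 5 0).setm (e.ev Λ σ) 0)
  | lwt {d : ℕ} {a b : Ex} {σ : AS} (ha : a.ok Λ σ) (hb : b.ok Λ σ) (hn : a.ev Λ σ < n)
      (hd : b.ev Λ σ < degN Λ.E.graph (a.ev Λ σ)) :
      AExec (.lwt d a b) σ (a.cost + (b.cost + 1))
        (σ.setl d (wtN Λ.E.graph Λ.E.weight (a.ev Λ σ) (b.ev Λ σ)))
  | emit {e : Ex} {σ : AS} (h : e.ok Λ σ) :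
      AExec (.emit e) σ (e.cost + 1) (σ.app (e.ev Λ σ))
  | seq {p q : Cmd} {σ σ' σ'' : AS} {t t' : ℕ} (hp : AExec p σ t σ') (hq : AExec q σ' t' σ'') :
      AExec (.seq p q) σ (t + t') σ''
  | ite_true {c : Cnd} {p q : Cmd} {σ σ' : AS} {t : ℕ} (ho : c.ok Λ σ) (hc : c.holds Λ σ)
      (hp : AExec p σ t σ') : AExec (.ite c p q) σ (c.cost + (t + 1)) σ'
  | ite_false {c : Cnd} {p q : Cmd} {σ σ' : AS} {t : ℕ} (ho : c.ok Λ σ) (hc : ¬ c.holds Λ σ)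
      (hq : AExec q σ t σ') : AExec (.ite c p q) σ (c.cost + (t + 1)) σ'
  | loop_false {c : Cnd} {p : Cmd} {σ : AS} (ho : c.ok Λ σ) (hc : ¬ c.holds Λ σ) :
      AExec (.loop c p) σ (c.cost + 1) σ
  | loop_true {c : Cnd} {p : Cmd} {σ σ' σ'' : AS} {t t' : ℕ} (ho : c.ok Λ σ)
      (hc : c.holds Λ σ) (hp : AExec p σ t σ') (hl : AExec (.loop c p) σ' t' σ'') :
      AExec (.loop c p) σ (c.cost + (t + t' + 1)) σ''

variable {Λ}

lemma memFun_setf (σ : AS) {f i a : ℕ} (hf : f < 16) (hi : i < Λ.R) :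
    (List.range Λ.N).map (memFun Λ (σ.setf f i a)) =
      ((List.range Λ.N).map (memFun Λ σ)).set (i * 16 + (16 + f)) a := by
  have hN := Λ.hN
  refine List.ext_getElem (by simp) fun A h1 h2 => ?_
  simp only [List.length_map, List.length_range] at h1
  rw [List.getElem_set]
  simp only [List.getElem_map, List.getElem_range]
  split_ifs with h
  · subst h
    rw [memFun_field _ hf hi]
    simp [AS.setf]
  · unfold memFun
    split_ifs with h3 h4
    · rfl
    · simp only [AS.setf]
      by_cases h5 : A % 16 = f
      · rw [h5, Function.update_self, Function.update_of_ne (by omega)]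
      · rw [Function.update_of_ne h5]
    · rfl

/-- A simulation by induction on the run: every abstract step is matched by compiled code that takes
the same time, and both `Rep` and `Good` are preserved. -/
theorem AExec.sound {c : Cmd} {σ σ' : AS} {t : ℕ} (h : AExec Λ c σ t σ') :
    Good Λ σ → ∀ s, Rep Λ σ s → Good Λ σ' ∧ ∃ s', Exec Λ.E c.comp s t s' ∧ Rep Λ σ' s' := by
  induction h with
  | skip σ => exact fun hg s hs => ⟨hg, s, .skip _, hs⟩
  | @asg x e σ hx h =>
    intro hg s hs
    obtain ⟨ρ, h1, e1, f1⟩ := Ex.comp_exec hg e 32 s le_rfl hs h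
    have hlt := Ex.ev_lt hg e h
    refine ⟨⟨fun i => ?_, hg.2⟩, { s with reg := Function.update ρ x (e.ev Λ σ) },
      .seq h1 (.op ?_), ⟨fun i hi => ?_, hs.lreg, hs.mem, hs.lmem, hs.out⟩⟩
    · simp only [AS.setr, Function.update_apply]; split_ifs
      · exact hlt
      · exact hg.1 i
    · simp only [step, e1]
      rw [step_setReg hlt]
    · simp only [AS.setr, Function.update_apply]; split_ifs
      · rfl
      · rw [f1 i hi, hs.reg i hi]
  | @setf f i e σ hf hi he hR =>
    intro hg s hs
    obtain ⟨ρ1, h1, e1, f1⟩ := Ex.comp_exec hg i 32 s le_rfl hs hi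
    have hs1 := hs.updReg (ρ := ρ1) (fun i hi => f1 i (by omega))
    obtain ⟨ρ2, h2, e2, f2⟩ := Ex.comp_exec hg e 33 _ (by norm_num) hs1 he
    have hlt := Ex.ev_lt hg e he
    have hN := Λ.hN
    have hW := Λ.hW
    have hb := Λ.big
    have e1' : ρ2 32 = i.ev Λ σ := by rw [f2 32 (by omega)]; exact e1
    let stt : (ℕ → ℕ) → State := fun ρ => { s with reg := ρ }
    let u1 : ℕ → ℕ := Function.update ρ2 34 16
    let u2 : ℕ → ℕ := Function.update u1 32 (i.ev Λ σ * 16)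
    let u3 : ℕ → ℕ := Function.update u2 34 (16 + f)
    let u4 : ℕ → ℕ := Function.update u3 32 (i.ev Λ σ * 16 + (16 + f))
    refine ⟨⟨hg.1, fun g j => ?_⟩,
      { s with reg := u4, mem := s.mem.set (i.ev Λ σ * 16 + (16 + f)) (e.ev Λ σ) },
      .seq (t := i.cost) (t' := e.cost + 5) h1 (.seq (t := e.cost) (t' := 5) h2
        (.seq (t := 1) (t' := 4) (.op (s' := stt u1) ?_)
        (.seq (t := 1) (t' := 3) (.op (s' := stt u2) ?_)
        (.seq (t := 1) (t' := 2) (.op (s' := stt u3) ?_)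
        (.seq (t := 1) (t' := 1) (.op (s' := stt u4) ?_) (.op ?_)))))),
      ⟨fun j hj => ?_, hs.lreg, ?_, hs.lmem, hs.out⟩⟩
    · simp only [AS.setf, Function.update_apply]; split_ifs
      · simp only [Function.update_apply]; split_ifs
        · exact hlt
        · exact hg.2 _ _
      · exact hg.2 _ _
    · simp only [step, stt, u1, u2, u3, u4]
      rw [step_setReg (by omega)]
    · simp only [step, stt, u1, u2, u3, u4]
      rw [step_setReg] <;> simp [e1']
      omega
    · simp only [step, stt, u1, u2, u3, u4]
      rw [step_setReg (by omega)]
    · simp only [step, stt, u1, u2, u3, u4]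
      rw [step_setReg] <;> simp
      omega
    · simp only [step, stt, u1, u2, u3, u4]
      rw [if_pos]
      · simp [e2]
      · simp only [Function.update_self, hs.mem, List.length_map, List.length_range]
        omega
    · simp only [u1, u2, u3, u4]
      rw [Function.update_of_ne (by omega), Function.update_of_ne (by omega),
        Function.update_of_ne (by omega), Function.update_of_ne (by omega), f2 j (by omega)]
      exact (f1 j hj).trans (hs.reg j hj)
    · simp only
      rw [hs.mem, memFun_setf _ hf hR]
  | @lzero d σ =>
    exact fun hg s hs => ⟨hg, _, .op rfl,
      ⟨hs.reg, by simp [setLReg, AS.setl, hs.lreg], hs.mem, hs.lmem, hs.out⟩⟩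
  | @ladd d a b σ =>
    exact fun hg s hs => ⟨hg, _, .op rfl,
      ⟨hs.reg, by simp [setLReg, AS.setl, hs.lreg], hs.mem, hs.lmem, hs.out⟩⟩
  | @lload d e σ h hn =>
    intro hg s hs
    obtain ⟨ρ, h1, e1, f1⟩ := Ex.comp_exec hg e 32 s le_rfl hs h
    refine ⟨hg, setLReg { s with reg := ρ } d (σ.lm (e.ev Λ σ)), .seq h1 (.op ?_),
      ⟨fun i hi => (f1 i hi).trans (hs.reg i hi), by simp [setLReg, AS.setl, hs.lreg], hs.mem,
      hs.lmem, hs.out⟩⟩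
    simp only [step, e1, hs.lmem, List.getElem?_map, List.getElem?_range hn]
    rfl
  | @lstore d e σ h hn =>
    intro hg s hs
    obtain ⟨ρ, h1, e1, f1⟩ := Ex.comp_exec hg e 32 s le_rfl hs h
    refine ⟨hg, { s with reg := ρ, lmem := s.lmem.set (e.ev Λ σ) (s.lreg d) },
      .seq h1 (.op ?_),
      ⟨fun i hi => (f1 i hi).trans (hs.reg i hi), hs.lreg, hs.mem, ?_, hs.out⟩⟩
    · simp only [step, e1]
      rw [if_pos (by simp [hs.lmem, hn])]
    · simp only [hs.lmem, AS.setm, hs.lreg]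
      refine List.ext_getElem (by simp) fun A h1 h2 => ?_
      simp [List.getElem_set, Function.update_apply, eq_comm]
  | @lstz e σ h hn =>
    intro hg s hs
    obtain ⟨ρ, h1, e1, f1⟩ := Ex.comp_exec hg e 32 s le_rfl hs h
    let s1 : State := { s with reg := ρ, lreg := Function.update s.lreg 5 0 }
    refine ⟨hg, { s1 with lmem := s.lmem.set (e.ev Λ σ) 0 },
      .seq h1 (.seq (t := 1) (t' := 1) (s' := s1) (.op rfl) (.op ?_)),
      ⟨fun i hi => (f1 i hi).trans (hs.reg i hi), by simp [s1, AS.setm, AS.setl, hs.lreg],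
        hs.mem, ?_, hs.out⟩⟩
    · simp only [step, s1, e1]
      rw [if_pos (by simp [hs.lmem, hn])]
      simp
    · simp only [s1, hs.lmem, AS.setm, AS.setl, hs.lreg]
      refine List.ext_getElem (by simp) fun A h1 h2 => ?_
      simp [List.getElem_set, Function.update_apply, eq_comm]
  | @lwt d a b σ ha hb hn hd =>
    intro hg s hs
    obtain ⟨ρ1, h1, e1, f1⟩ := Ex.comp_exec hg a 32 s le_rfl hs ha
    have hs1 := hs.updReg (ρ := ρ1) (fun i hi => f1 i (by omega))
    obtain ⟨ρ2, h2, e2, f2⟩ := Ex.comp_exec hg b 33 _ (by norm_num) hs1 hb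
    have e1' : ρ2 32 = a.ev Λ σ := by rw [f2 32 (by omega)]; exact e1
    refine ⟨hg, setLReg { s with reg := ρ2 } d
      (wtN Λ.E.graph Λ.E.weight (a.ev Λ σ) (b.ev Λ σ)), .seq h1 (.seq h2 (.op ?_)),
      ⟨fun i hi => ((f2 i (by omega)).trans (f1 i hi)).trans (hs.reg i hi),
        by simp [setLReg, AS.setl, hs.lreg], hs.mem, hs.lmem, hs.out⟩⟩
    simp only [degN, dif_pos hn, ← adjList_length] at hd
    simp only [step, e1', e2, dif_pos hn, wtN]
    rw [List.getElem?_eq_getElem hd]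
    rfl
  | @emit e σ h =>
    intro hg s hs
    obtain ⟨ρ, h1, e1, f1⟩ := Ex.comp_exec hg e 32 s le_rfl hs h
    refine ⟨hg, { s with reg := ρ, out := s.out ++ [e.ev Λ σ] }, .seq h1 (.op ?_),
      ⟨fun i hi => (f1 i hi).trans (hs.reg i hi), hs.lreg, hs.mem, hs.lmem, ?_⟩⟩
    · simp only [step, e1]
    · simp [AS.app, hs.out]
  | seq _ _ ihp ihq =>
    intro hg s hs
    obtain ⟨hg1, s1, h1, hs1⟩ := ihp hg s hs
    obtain ⟨hg2, s2, h2, hs2⟩ := ihq hg1 s1 hs1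
    exact ⟨hg2, s2, .seq h1 h2, hs2⟩
  | ite_true ho hc _ ih =>
    intro hg s hs
    obtain ⟨s1, h1, hs1, ht⟩ := Cnd.setup_exec hg _ s hs ho
    obtain ⟨hg2, s2, h2, hs2⟩ := ih hg s1 hs1
    exact ⟨hg2, s2, .seq h1 (.ite_true (ht.2 hc) h2), hs2⟩
  | ite_false ho hc _ ih =>
    intro hg s hs
    obtain ⟨s1, h1, hs1, ht⟩ := Cnd.setup_exec hg _ s hs ho
    obtain ⟨hg2, s2, h2, hs2⟩ := ih hg s1 hs1
    exact ⟨hg2, s2, .seq h1 (.ite_false (fun h => hc (ht.1 h)) h2), hs2⟩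
  | loop_false ho hc =>
    intro hg s hs
    obtain ⟨s1, h1, hs1, ht⟩ := Cnd.setup_exec hg _ s hs ho
    exact ⟨hg, s1, .seq h1 (.loop_false (fun h => hc (ht.1 h))), hs1⟩
  | @loop_true c p σ σ' σ'' t t' ho hc _ _ ihp ihl =>
    intro hg s hs
    obtain ⟨s1, h1, hs1, ht⟩ := Cnd.setup_exec hg _ s hs ho
    obtain ⟨hg2, s2, h2, hs2⟩ := ihp hg s1 hs1
    obtain ⟨hg3, s3, h3, hs3⟩ := ihl hg2 s2 hs2
    -- The compiled remainder begins with evaluating the condition, while the machine loop counts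
    -- this evaluation as the end of the current pass; the run is regrouped accordingly.
    cases h3 with
    | @seq _ _ _ s4 _ t4 t5 h4 h5 =>
      refine ⟨hg3, s3, .seq h1 ?_, hs3⟩
      have := Exec.loop_true (ht.2 hc) (.seq h2 h4) h5
      rwa [show t + t4 + t5 + 1 = t + (t4 + t5) + 1 by ring] at this

/-! ### Weakest preconditions with running times -/

variable (Λ)

/-- The weakest precondition: `c` halts, and the running time and the final state satisfy `Φ`. -/
def WP (c : Cmd) (Φ : ℕ → AS → Prop) (σ : AS) : Prop := ∃ t σ', AExec Λ c σ t σ' ∧ Φ t σ'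

variable {Λ}

lemma WP.mono {c : Cmd} {Φ Ψ : ℕ → AS → Prop} {σ : AS} (h : WP Λ c Φ σ)
    (hΦ : ∀ t σ', Φ t σ' → Ψ t σ') : WP Λ c Ψ σ := by
  obtain ⟨t, σ', h1, h2⟩ := h
  exact ⟨t, σ', h1, hΦ _ _ h2⟩

section rules
variable {Φ : ℕ → AS → Prop} {σ : AS}

lemma WP_skip : WP Λ .skip Φ σ ↔ Φ 0 σ :=
  ⟨by rintro ⟨_, _, ⟨⟩, h⟩; exact h, fun h => ⟨_, _, .skip _, h⟩⟩

lemma WP_asg {x : ℕ} {e : Ex} :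
    WP Λ (.asg x e) Φ σ ↔ (x < 32 ∧ e.ok Λ σ) ∧ Φ (e.cost + 1) (σ.setr x (e.ev Λ σ)) :=
  ⟨by rintro ⟨_, _, ⟨⟩, h⟩; exact ⟨⟨‹_›, ‹_›⟩, h⟩, fun h => ⟨_, _, .asg h.1.1 h.1.2, h.2⟩⟩

lemma WP_setf {f : ℕ} {i e : Ex} :
    WP Λ (.setf f i e) Φ σ ↔ (f < 16 ∧ i.ok Λ σ ∧ e.ok Λ σ ∧ i.ev Λ σ < Λ.R) ∧
      Φ (i.cost + (e.cost + 5)) (σ.setf f (i.ev Λ σ) (e.ev Λ σ)) :=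
  ⟨by rintro ⟨_, _, ⟨⟩, h⟩; exact ⟨⟨‹_›, ‹_›, ‹_›, ‹_›⟩, h⟩,
    fun h => ⟨_, _, .setf h.1.1 h.1.2.1 h.1.2.2.1 h.1.2.2.2, h.2⟩⟩

lemma WP_lzero {d : ℕ} : WP Λ (.lzero d) Φ σ ↔ Φ 1 (σ.setl d 0) :=
  ⟨by rintro ⟨_, _, ⟨⟩, h⟩; exact h, fun h => ⟨_, _, .lzero, h⟩⟩

lemma WP_ladd {d a b : ℕ} : WP Λ (.ladd d a b) Φ σ ↔ Φ 1 (σ.setl d (σ.lr a + σ.lr b)) :=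
  ⟨by rintro ⟨_, _, ⟨⟩, h⟩; exact h, fun h => ⟨_, _, .ladd, h⟩⟩

lemma WP_lload {d : ℕ} {e : Ex} :
    WP Λ (.lload d e) Φ σ ↔ (e.ok Λ σ ∧ e.ev Λ σ < n) ∧
      Φ (e.cost + 1) (σ.setl d (σ.lm (e.ev Λ σ))) :=
  ⟨by rintro ⟨_, _, ⟨⟩, h⟩; exact ⟨⟨‹_›, ‹_›⟩, h⟩, fun h => ⟨_, _, .lload h.1.1 h.1.2, h.2⟩⟩

lemma WP_lstore {d : ℕ} {e : Ex} :
    WP Λ (.lstore e d) Φ σ ↔ (e.ok Λ σ ∧ e.ev Λ σ < n) ∧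
      Φ (e.cost + 1) (σ.setm (e.ev Λ σ) (σ.lr d)) :=
  ⟨by rintro ⟨_, _, ⟨⟩, h⟩; exact ⟨⟨‹_›, ‹_›⟩, h⟩, fun h => ⟨_, _, .lstore h.1.1 h.1.2, h.2⟩⟩

lemma WP_lstz {e : Ex} :
    WP Λ (.lstz e) Φ σ ↔ (e.ok Λ σ ∧ e.ev Λ σ < n) ∧
      Φ (e.cost + 2) ((σ.setl 5 0).setm (e.ev Λ σ) 0) :=
  ⟨by rintro ⟨_, _, ⟨⟩, h⟩; exact ⟨⟨‹_›, ‹_›⟩, h⟩, fun h => ⟨_, _, .lstz h.1.1 h.1.2, h.2⟩⟩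

lemma WP_lwt {d : ℕ} {a b : Ex} :
    WP Λ (.lwt d a b) Φ σ ↔ (a.ok Λ σ ∧ b.ok Λ σ ∧ a.ev Λ σ < n ∧
      b.ev Λ σ < degN Λ.E.graph (a.ev Λ σ)) ∧ Φ (a.cost + (b.cost + 1))
        (σ.setl d (wtN Λ.E.graph Λ.E.weight (a.ev Λ σ) (b.ev Λ σ))) :=
  ⟨by rintro ⟨_, _, ⟨⟩, h⟩; exact ⟨⟨‹_›, ‹_›, ‹_›, ‹_›⟩, h⟩,
    fun h => ⟨_, _, .lwt h.1.1 h.1.2.1 h.1.2.2.1 h.1.2.2.2, h.2⟩⟩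

lemma WP_emit {e : Ex} :
    WP Λ (.emit e) Φ σ ↔ e.ok Λ σ ∧ Φ (e.cost + 1) (σ.app (e.ev Λ σ)) :=
  ⟨by rintro ⟨_, _, ⟨⟩, h⟩; exact ⟨‹_›, h⟩, fun h => ⟨_, _, .emit h.1, h.2⟩⟩

lemma WP_seq {p q : Cmd} :
    WP Λ (.seq p q) Φ σ ↔ WP Λ p (fun t σ' => WP Λ q (fun t' σ'' => Φ (t + t') σ'') σ') σ :=
  ⟨by rintro ⟨_, _, ⟨⟩, h⟩; exact ⟨_, _, ‹_›, _, _, ‹_›, h⟩,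
    fun ⟨_, _, h1, _, _, h2, h3⟩ => ⟨_, _, .seq h1 h2, h3⟩⟩

lemma WP_ite {c : Cnd} {p q : Cmd} :
    WP Λ (.ite c p q) Φ σ ↔ c.ok Λ σ ∧
      (c.holds Λ σ → WP Λ p (fun t σ' => Φ (c.cost + (t + 1)) σ') σ) ∧
      (¬ c.holds Λ σ → WP Λ q (fun t σ' => Φ (c.cost + (t + 1)) σ') σ) := by
  constructor
  · rintro ⟨t, σ', h, hΦ⟩
    cases h with
    | ite_true ho hc hp => exact ⟨ho, fun _ => ⟨_, _, hp, hΦ⟩, fun h => absurd hc h⟩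
    | ite_false ho hc hp => exact ⟨ho, fun h => absurd h hc, fun _ => ⟨_, _, hp, hΦ⟩⟩
  · rintro ⟨ho, h1, h2⟩
    by_cases hc : c.holds Λ σ
    · obtain ⟨t, σ', h, hΦ⟩ := h1 hc
      exact ⟨_, _, .ite_true ho hc h, hΦ⟩
    · obtain ⟨t, σ', h, hΦ⟩ := h2 hc
      exact ⟨_, _, .ite_false ho hc h, hΦ⟩

/-- Loops, with an invariant that depends on the remaining time budget. -/
theorem WP_loop (I : ℕ → AS → Prop) {c : Cmd} {b : Cnd} {T : ℕ} (h0 : I T σ)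
    (hI : ∀ T σ, I T σ → b.ok Λ σ ∧ (b.holds Λ σ →
      WP Λ c (fun t σ' => ∃ T', T' + t + b.cost + 1 ≤ T ∧ I T' σ') σ)) :
    WP Λ (.loop b c)
      (fun t σ' => ¬ b.holds Λ σ' ∧ ∃ T', I T' σ' ∧ t + T' ≤ T + b.cost + 1) σ := by
  -- The remaining time budget strictly decreases with every pass, so it also proves termination.
  induction T using Nat.strong_induction_on generalizing σ with
  | _ T ih =>
    obtain ⟨ho, hb⟩ := hI T σ h0
    by_cases hc : b.holds Λ σ
    · obtain ⟨t, σ', h1, T', hT, hI'⟩ := hb hc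
      obtain ⟨t', σ'', h2, h3, T'', h4, h5⟩ := ih T' (by omega) hI'
      exact ⟨_, _, .loop_true ho hc h1 h2, h3, T'', h4, by omega⟩
    · exact ⟨_, _, .loop_false ho hc, hc, T, h0, by omega⟩

/-- For loops whose passes follow a recursive object, such as a walk, and are verified by induction
on that object instead of an invariant. -/
lemma WP_loop_unfold {c : Cnd} {p : Cmd} :
    WP Λ (.loop c p) Φ σ ↔ c.ok Λ σ ∧
      (c.holds Λ σ → WP Λ p (fun t σ' => WP Λ (.loop c p)
        (fun t' σ'' => Φ (c.cost + (t + t' + 1)) σ'') σ') σ) ∧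
      (¬ c.holds Λ σ → Φ (c.cost + 1) σ) := by
  constructor
  · rintro ⟨t, σ', h, hΦ⟩
    cases h with
    | loop_false ho hc => exact ⟨ho, fun h => absurd h hc, fun _ => hΦ⟩
    | loop_true ho hc hp hl => exact ⟨ho, fun _ => ⟨_, _, hp, _, _, hl, hΦ⟩, fun h => absurd hc h⟩
  · rintro ⟨ho, h1, h2⟩
    by_cases hc : c.holds Λ σ
    · obtain ⟨t, σ', h, t', σ'', h', hΦ⟩ := h1 hc
      exact ⟨_, _, .loop_true ho hc h h', hΦ⟩
    · exact ⟨_, _, .loop_false ho hc, h2 hc⟩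

end rules

attribute [simp] WP_skip WP_asg WP_setf WP_lzero WP_ladd WP_lload WP_lstore WP_lstz WP_lwt
  WP_emit WP_seq WP_ite Ex.ok Ex.ev Ex.cost Cnd.ok Cnd.holds Cnd.cost

section projections
variable (σ : AS) (x a i j : ℕ) (l : ℝ≥0)

@[simp] lemma AS.setr_r : (σ.setr x a).r i = if i = x then a else σ.r i := by
  simp [AS.setr, Function.update_apply]
@[simp] lemma AS.setr_lr : (σ.setr x a).lr = σ.lr := rfl
@[simp] lemma AS.setr_f : (σ.setr x a).f = σ.f := rfl
@[simp] lemma AS.setr_lm : (σ.setr x a).lm = σ.lm := rfl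
@[simp] lemma AS.setr_out : (σ.setr x a).out = σ.out := rfl
@[simp] lemma AS.setl_lr : (σ.setl x l).lr i = if i = x then l else σ.lr i := by
  simp [AS.setl, Function.update_apply]
@[simp] lemma AS.setl_r : (σ.setl x l).r = σ.r := rfl
@[simp] lemma AS.setl_f : (σ.setl x l).f = σ.f := rfl
@[simp] lemma AS.setl_lm : (σ.setl x l).lm = σ.lm := rfl
@[simp] lemma AS.setl_out : (σ.setl x l).out = σ.out := rfl
@[simp] lemma AS.setm_lm : (σ.setm x l).lm = Function.update σ.lm x l := rfl
@[simp] lemma AS.setm_r : (σ.setm x l).r = σ.r := rfl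
@[simp] lemma AS.setm_f : (σ.setm x l).f = σ.f := rfl
@[simp] lemma AS.setm_lr : (σ.setm x l).lr = σ.lr := rfl
@[simp] lemma AS.setm_out : (σ.setm x l).out = σ.out := rfl
@[simp] lemma AS.setf_f :
    (σ.setf x i a).f j = if j = x then Function.update (σ.f x) i a else σ.f j := by
  simp only [AS.setf, Function.update_apply]
@[simp] lemma AS.setf_r : (σ.setf x i a).r = σ.r := rfl
@[simp] lemma AS.setf_lr : (σ.setf x i a).lr = σ.lr := rfl
@[simp] lemma AS.setf_lm : (σ.setf x i a).lm = σ.lm := rfl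
@[simp] lemma AS.setf_out : (σ.setf x i a).out = σ.out := rfl
@[simp] lemma AS.app_out : (σ.app a).out = σ.out ++ [a] := rfl
@[simp] lemma AS.app_r : (σ.app a).r = σ.r := rfl
@[simp] lemma AS.app_lr : (σ.app a).lr = σ.lr := rfl
@[simp] lemma AS.app_lm : (σ.app a).lm = σ.lm := rfl
@[simp] lemma AS.app_f : (σ.app a).f = σ.f := rfl

end projections

end DistOracle
end

noncomputable section
namespace DistOracle

/-! ## Chains of parent pointers -/

section graph
variable {n : ℕ} (G : SimpleGraph (Fin n)) (w : Sym2 (Fin n) → ℝ≥0)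

@[simp] lemma degN_val (v : Fin n) : degN G v = deg G v := by simp [degN]

lemma nbrN_val {v y : Fin n} {j : ℕ} (h : (adjList G v)[j]? = some y) : nbrN G v j = y := by
  simp [nbrN, h]

lemma wtN_val {v y : Fin n} {j : ℕ} (h : (adjList G v)[j]? = some y) :
    wtN G w v j = w s(v, y) := by
  simp only [wtN, Fin.is_lt, dif_pos, Fin.eta, h]
  rfl

lemma lt_deg {G : SimpleGraph (Fin n)} {v y : Fin n} {j : ℕ} (h : (adjList G v)[j]? = some y) :
    j < deg G v := by
  rw [← adjList_length]
  exact (List.getElem?_eq_some_iff.1 h).1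

lemma adj_of_adjList {G : SimpleGraph (Fin n)} {v y : Fin n} {j : ℕ}
    (h : (adjList G v)[j]? = some y) : G.Adj v y :=
  (mem_adjList G v y).1 (List.mem_of_getElem? h)

lemma exists_index {G : SimpleGraph (Fin n)} {v y : Fin n} (h : G.Adj v y) :
    ∃ j : ℕ, (adjList G v)[j]? = some y :=
  List.getElem?_of_mem ((mem_adjList G v y).2 h)

@[simp] lemma walkLen_nil {u : Fin n} : walkLen w (SimpleGraph.Walk.nil : G.Walk u u) = 0 := by
  simp [walkLen]

@[simp] lemma walkLen_cons {u v z : Fin n} (h : G.Adj u v) (p : G.Walk v z) :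
    walkLen w (SimpleGraph.Walk.cons h p) = w s(u, v) + walkLen w p := by
  simp [walkLen]

@[simp] lemma walkLen_append {u v z : Fin n} (p : G.Walk u v) (q : G.Walk v z) :
    walkLen w (p.append q) = walkLen w p + walkLen w q := by
  simp [walkLen]

@[simp] lemma walkLen_reverse {u v : Fin n} (p : G.Walk u v) :
    walkLen w p.reverse = walkLen w p := by
  simp [walkLen, List.sum_reverse]

end graph

variable {n : ℕ} {Λ : Layout n}

/-- The fields `p` and `q` of the vertices in `S` hold parent pointers `par` and the positions of
the vertices in the adjacency lists of their parents. -/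
def Parents (G : SimpleGraph (Fin n)) (f : ℕ → ℕ → ℕ) (p q : ℕ) (par : Fin n → Fin n)
    (S : Fin n → Prop) : Prop :=
  ∀ v, S v → f p v = par v ∧ (par v ≠ v → S (par v) ∧ (adjList G (par v))[f q v]? = some v)

/-- The walk follows the parent pointers up to a root. -/
def Climbs {G : SimpleGraph (Fin n)} (par : Fin n → Fin n) : ∀ {u z : Fin n}, G.Walk u z → Prop
  | u, _, .nil => par u = u
  | u, _, .cons (v := v) _ p => par u = v ∧ par u ≠ u ∧ Climbs par p

lemma Climbs.root {G : SimpleGraph (Fin n)} {par : Fin n → Fin n} {u z : Fin n} {p : G.Walk u z}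
    (h : Climbs par p) : par z = z := by
  induction p with
  | nil => exact h
  | cons _ p ih => exact ih h.2.2

/-- The loop that follows parent pointers and writes the vertices to the output. -/
def fwdCmd (p q : ℕ) : Cmd :=
  .loop (.ne (.fld p (.v 4)) (.v 4))
    (.seq (.lwt 2 (.fld p (.v 4)) (.fld q (.v 4)))
    (.seq (.ladd 0 0 2)
    (.seq (.asg 4 (.fld p (.v 4)))
      (.emit (.v 4)))))

/-- Induction on the climbing walk. Field `q` gives the position of a vertex in the list of its
parent, so each edge weight is read from the parent's side. -/
theorem fwdCmd_spec {p q : ℕ} (hp : p < 16) (hq : q < 16) {par : Fin n → Fin n}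
    {S : Fin n → Prop} {u z : Fin n} (P : Λ.E.graph.Walk u z) (hP : Climbs par P) :
    ∀ σ : AS, Parents Λ.E.graph σ.f p q par S → S u → σ.r 4 = u →
    WP Λ (fwdCmd p q) (fun t σ' => t ≤ 60 * (P.length + 1) ∧ σ'.r 4 = z ∧
      (∀ i ≠ 4, σ'.r i = σ.r i) ∧ σ'.lr 0 = σ.lr 0 + walkLen Λ.E.weight P ∧
      σ'.f = σ.f ∧ σ'.lm = σ.lm ∧ σ'.out = σ.out ++ P.support.tail.map Fin.val) σ := by
  induction P with
  | @nil u =>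
    intro σ hT hS h4
    have hu := hT u hS
    have hR := Λ.hR
    have := u.2
    have hroot : par u = u := hP
    rw [fwdCmd, WP_loop_unfold]
    simp [h4, hp, hu.1, hroot]
    omega
  | @cons u v z h P ih =>
    intro σ hT hS h4
    obtain ⟨rfl, hne, hP⟩ := hP
    obtain ⟨hf, hu⟩ := hT u hS
    obtain ⟨hS', hidx⟩ := hu hne
    have hR := Λ.hR
    have := u.2
    have hne' : ((par u : Fin n) : ℕ) ≠ u := fun h => hne (Fin.ext h)
    rw [fwdCmd, WP_loop_unfold]
    simp [h4, hp, hq, hf, hne', lt_deg hidx, wtN_val _ _ hidx]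
    refine ⟨by omega, (ih hP _ ?_ hS' ?_).mono ?_⟩
    · simpa using hT
    · simp
    · rintro t σ' ⟨h1, h2, h3, h5, h6, h7, h8⟩
      simp at h3 h5 h6 h7 h8
      refine ⟨by omega, h2, fun i hi => ?_, ?_, h6, h7, ?_⟩
      · rw [h3 i hi, if_neg hi]
      · rw [h5, Sym2.eq_swap]; ring
      · rw [h8, ← List.map_tail]
        rw [← List.map_cons, SimpleGraph.Walk.cons_tail_support]

/-- The loop that pushes the vertices of a chain of parent pointers on the stack. -/
def pushCmd (p : ℕ) : Cmd :=
  .seq (.asg 14 (.c 0)) (.loop (.ne (.fld p (.v 4)) (.v 4))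
    (.seq (.setf 12 (.v 14) (.v 4))
    (.seq (.asg 14 (.add (.v 14) (.c 1)))
      (.asg 4 (.fld p (.v 4))))))

/-- The loop that empties the stack and writes the vertices to the output. -/
def popCmd (p q : ℕ) : Cmd :=
  .loop (.lt (.c 0) (.v 14))
    (.seq (.asg 14 (.sub (.v 14) (.c 1)))
    (.seq (.asg 4 (.fld 12 (.v 14)))
    (.seq (.setf 12 (.v 14) (.c 0))
    (.seq (.lwt 2 (.fld p (.v 4)) (.fld q (.v 4)))
    (.seq (.ladd 0 0 2)
      (.emit (.v 4)))))))

/-- The stack holds the vertices of the walk, except for the last one, from position `b` on. -/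
def OnStack {G : SimpleGraph (Fin n)} (s : ℕ → ℕ) (b : ℕ) {u z : Fin n} (P : G.Walk u z) : Prop :=
  ∀ i < P.length, s (b + i) = P.getVert i

/-- The height `b` of the stack is arbitrary because it grows along the induction on the walk. -/
lemma push_loop {p q : ℕ} (hp : p < 16) (hp' : p ≠ 12) (hq' : q ≠ 12) {par : Fin n → Fin n}
    {S : Fin n → Prop} {u z : Fin n} (P : Λ.E.graph.Walk u z) (hP : Climbs par P) :
    ∀ (b : ℕ) (σ : AS), Parents Λ.E.graph σ.f p q par S → S u → σ.r 4 = u → σ.r 14 = b →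
    b + P.length ≤ n →
    WP Λ (.loop (.ne (.fld p (.v 4)) (.v 4))
    (.seq (.setf 12 (.v 14) (.v 4))
    (.seq (.asg 14 (.add (.v 14) (.c 1)))
      (.asg 4 (.fld p (.v 4)))))) (fun t σ' => t ≤ 60 * (P.length + 1) ∧ σ'.r 4 = z ∧
      σ'.r 14 = b + P.length ∧
      (∀ i ≠ 4, i ≠ 14 → σ'.r i = σ.r i) ∧ σ'.lr = σ.lr ∧
      (∀ g ≠ 12, σ'.f g = σ.f g) ∧ OnStack (σ'.f 12) b P ∧
      (∀ i, (i < b ∨ b + P.length ≤ i) → σ'.f 12 i = σ.f 12 i) ∧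
      σ'.lm = σ.lm ∧ σ'.out = σ.out) σ := by
  induction P with
  | @nil u =>
    intro b σ hT hS h4 h14 hb
    have hu := hT u hS
    have hR := Λ.hR
    have := u.2
    have hroot : par u = u := hP
    rw [WP_loop_unfold]
    simp [h4, hp, hu.1, hroot, h14, OnStack]
    omega
  | @cons u v z h P ih =>
    intro b σ hT hS h4 h14 hb
    obtain ⟨rfl, hne, hP⟩ := hP
    obtain ⟨hf, hu⟩ := hT u hS
    obtain ⟨hS', hidx⟩ := hu hne
    have hR := Λ.hR
    have hN := Λ.hN
    have := u.2
    have hne' : ((par u : Fin n) : ℕ) ≠ u := fun h => hne (Fin.ext h)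
    simp only [SimpleGraph.Walk.length_cons] at hb
    rw [WP_loop_unfold]
    simp [h4, hp, hf, hne', h14, hp']
    refine ⟨by omega, by omega, by omega, by omega, (ih hP (b + 1) _ ?_ hS' ?_ ?_ (by omega)).mono ?_⟩
    · intro y hy
      simpa [hp', hq'] using hT y hy
    · simp [hp', hf]
    · simp
    · rintro t σ' ⟨h1, h2, h3, h5, h6, h7, h8, h9, h10, h11⟩
      simp at h5 h6 h7 h9 h10 h11
      refine ⟨by omega, h2, by omega, fun i hi hi' => ?_, h6, fun g hg => ?_, fun i hi => ?_,
        fun i hi => ?_, h10, h11⟩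
      · rw [h5 i hi hi', if_neg hi, if_neg hi']
      · rw [h7 g hg, if_neg hg]
      · cases i with
        | zero =>
          rw [h9 _ (by omega)]
          simp
        | succ i =>
          have := h8 i (by simpa using hi)
          rw [SimpleGraph.Walk.getVert_cons_succ, ← this]
          congr 1; ring
      · rw [h9 i (by omega), Function.update_of_ne (by omega)]

theorem pushCmd_spec {p q : ℕ} (hp : p < 16) (hp' : p ≠ 12) (hq' : q ≠ 12)
    {par : Fin n → Fin n} {S : Fin n → Prop} {u z : Fin n} (P : Λ.E.graph.Walk u z)
    (hP : Climbs par P) (σ : AS) (hT : Parents Λ.E.graph σ.f p q par S) (hS : S u)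
    (h4 : σ.r 4 = u) (hn : P.length ≤ n) :
    WP Λ (pushCmd p) (fun t σ' => t ≤ 60 * (P.length + 2) ∧ σ'.r 4 = z ∧
      σ'.r 14 = P.length ∧
      (∀ i ≠ 4, i ≠ 14 → σ'.r i = σ.r i) ∧ σ'.lr = σ.lr ∧
      (∀ g ≠ 12, σ'.f g = σ.f g) ∧ OnStack (σ'.f 12) 0 P ∧
      (∀ i, P.length ≤ i → σ'.f 12 i = σ.f 12 i) ∧
      σ'.lm = σ.lm ∧ σ'.out = σ.out) σ := by
  rw [pushCmd, WP_seq, WP_asg]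
  refine ⟨by simp, (push_loop hp hp' hq' P hP 0 _ (by simpa using hT) hS (by simpa using h4)
    (by simp) (by omega)).mono ?_⟩
  rintro t σ' ⟨h1, h2, h3, h5, h6, h7, h8, h9, h10, h11⟩
  refine ⟨by simp; omega, h2, by omega, fun i hi hi' => ?_, h6, h7, h8,
    fun i hi => h9 i (by omega), h10, h11⟩
  simp [h5 i hi hi', hi']

/-- The first vertex of the walk is popped last, so the induction hypothesis describes only an
initial part of the execution of the loop. Therefore the conclusion reduces the loop from `σ` to the
same loop from a later state `σ'`, with `t` units of time already spent. -/
lemma pop_loop {p q : ℕ} (hp : p < 16) (hq : q < 16) (hp' : p ≠ 12) (hq' : q ≠ 12)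
    {par : Fin n → Fin n} {S : Fin n → Prop} {u z : Fin n} (P : Λ.E.graph.Walk u z)
    (hP : Climbs par P) :
    ∀ (b : ℕ) (σ : AS), Parents Λ.E.graph σ.f p q par S → S u →
    σ.r 14 = b + P.length → b + P.length ≤ n → OnStack (σ.f 12) b P →
    ∃ t σ', t ≤ 60 * P.length ∧ σ'.r 14 = b ∧
      (∀ i ≠ 4, i ≠ 14 → σ'.r i = σ.r i) ∧ σ'.lr 0 = σ.lr 0 + walkLen Λ.E.weight P ∧
      (∀ g ≠ 12, σ'.f g = σ.f g) ∧
      (∀ i, σ'.f 12 i = if b ≤ i ∧ i < b + P.length then 0 else σ.f 12 i) ∧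
      σ'.lm = σ.lm ∧ σ'.out = σ.out ++ P.reverse.support.tail.map Fin.val ∧
      ∀ Φ, WP Λ (popCmd p q) (fun t' => Φ (t + t')) σ' → WP Λ (popCmd p q) Φ σ := by
  induction P with
  | @nil u =>
    intro b σ hT hS h14 hb hs
    refine ⟨0, σ, by simp, by simpa using h14, fun _ _ _ => rfl, by simp, fun _ _ => rfl, ?_, rfl,
      by simp, fun Φ h => by simpa using h⟩
    intro i
    rw [if_neg (by simp)]
  | @cons u v z h P ih =>
    intro b σ hT hS h14 hb hs
    obtain ⟨rfl, hne, hP⟩ := hP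
    obtain ⟨hf, hu⟩ := hT u hS
    obtain ⟨hS', hidx⟩ := hu hne
    have hR := Λ.hR
    have hN := Λ.hN
    have hu2 := u.2
    simp only [SimpleGraph.Walk.length_cons] at hb h14
    have hs0 : σ.f 12 b = u := by simpa using hs 0 (by simp)
    obtain ⟨t, σ1, h1, h2, h3, h5, h6, h7, h8, h9, h10⟩ := ih hP (b + 1) σ hT hS' (by omega)
      (by omega) (fun i hi => by
        have := hs (i + 1) (by simpa using hi)
        rw [SimpleGraph.Walk.getVert_cons_succ] at this
        rw [← this]; congr 1; ring)
    let σ2 : AS := (((((σ1.setr 14 b).setr 4 u).setf 12 b 0).setl 2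
      (Λ.E.weight s(par u, u))).setl 0 (σ1.lr 0 + Λ.E.weight s(par u, u))).app u
    have hs1 : σ1.f 12 b = u := by rw [h7, if_neg (by omega), hs0]
    refine ⟨t + 37, σ2, by simp; omega, by simp [σ2], fun i hi hi' => ?_, ?_, fun g hg => ?_,
      fun i => ?_, ?_, ?_, fun Φ hΦ => h10 Φ ?_⟩
    · simp [σ2, hi, hi', h3 i hi hi']
    · simp [σ2, h5]
      rw [Sym2.eq_swap]; ring
    · simp [σ2, hg, h6 g hg]
    · have e : σ2.f 12 i = if i = b then 0 else σ1.f 12 i := by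
        simp [σ2, Function.update_apply]
      rw [e, h7, SimpleGraph.Walk.length_cons]
      split_ifs <;> first | rfl | omega
    · simp [σ2, h8]
    · simp [σ2, h9, SimpleGraph.Walk.support_append]
    · rw [popCmd, WP_loop_unfold]
      simp [h2, hs1, h6 p hp', h6 q hq', hf, hp, hq, hp', hq', lt_deg hidx, wtN_val _ _ hidx]
      refine ⟨by omega, by omega, ?_⟩
      refine hΦ.mono ?_
      intro t' σ' h
      convert h using 1
      omega

theorem popCmd_spec {p q : ℕ} (hp : p < 16) (hq : q < 16) (hp' : p ≠ 12) (hq' : q ≠ 12)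
    {par : Fin n → Fin n} {S : Fin n → Prop} {u z : Fin n} (P : Λ.E.graph.Walk u z)
    (hP : Climbs par P) (σ : AS) (hT : Parents Λ.E.graph σ.f p q par S) (hS : S u)
    (h14 : σ.r 14 = P.length) (hn : P.length ≤ n) (hs : OnStack (σ.f 12) 0 P)
    (h0 : ∀ i, P.length ≤ i → σ.f 12 i = 0) :
    WP Λ (popCmd p q) (fun t σ' => t ≤ 60 * (P.length + 1) ∧
      (∀ i ≠ 4, i ≠ 14 → σ'.r i = σ.r i) ∧ σ'.lr 0 = σ.lr 0 + walkLen Λ.E.weight P ∧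
      (∀ g ≠ 12, σ'.f g = σ.f g) ∧ (∀ i, σ'.f 12 i = 0) ∧
      σ'.lm = σ.lm ∧ σ'.out = σ.out ++ P.reverse.support.tail.map Fin.val) σ := by
  obtain ⟨t, σ1, h1, h2, h3, h5, h6, h7, h8, h9, h10⟩ := pop_loop hp hq hp' hq' P hP 0 σ hT hS
    (by simpa using h14) (by omega) hs
  refine h10 _ ?_
  rw [popCmd, WP_loop_unfold]
  simp [h2]
  refine ⟨by omega, h3, h5, h6, fun i => ?_, h8, by simpa using h9⟩
  rw [h7]
  split_ifs with h
  · rfl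
  · exact h0 i (by omega)

/-- Ranks decrease strictly along the pointers, so the climb never returns to a vertex: it reaches a
root along a path, of length below `n`. -/
lemma Parents.exists_climb {G : SimpleGraph (Fin n)} {f : ℕ → ℕ → ℕ} {p q : ℕ}
    {par : Fin n → Fin n} {S : Fin n → Prop} (hT : Parents G f p q par S) {rk : Fin n → ℕ}
    (hrk : ∀ v, S v → par v ≠ v → rk (par v) < rk v) (u : Fin n) (hu : S u) :
    ∃ z, ∃ P : G.Walk u z, Climbs par P ∧ P.length < n ∧ S z := by
  suffices h : ∀ (k : ℕ) (u : Fin n), rk u = k → S u → ∃ z, ∃ P : G.Walk u z, Climbs par P ∧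
      S z ∧ P.IsPath ∧ ∀ x ∈ P.support, rk x ≤ k by
    obtain ⟨z, P, h1, h2, h3, -⟩ := h _ u rfl hu
    exact ⟨z, P, h1, by simpa using h3.length_lt, h2⟩
  intro k
  induction k using Nat.strong_induction_on with
  | _ k ih =>
    intro u hk hu
    by_cases hpar : par u = u
    · exact ⟨u, .nil, hpar, hu, by simp, by simp [hk]⟩
    · obtain ⟨hS, hidx⟩ := (hT u hu).2 hpar
      have hlt := hrk u hu hpar
      obtain ⟨z, P, h1, h2, h3, h4⟩ := ih _ (hk ▸ hlt) (par u) rfl hS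
      refine ⟨z, .cons (adj_of_adjList hidx).symm P, ⟨rfl, hpar, h1⟩, h2, ?_, ?_⟩
      · rw [SimpleGraph.Walk.cons_isPath_iff]
        exact ⟨h3, fun h => by have := h4 u h; omega⟩
      · intro x hx
        rw [SimpleGraph.Walk.support_cons, List.mem_cons] at hx
        rcases hx with rfl | hx
        · omega
        · have := h4 x hx; omega

end DistOracle
end

noncomputable section
namespace DistOracle

/-! ## Distances -/

section dist
variable {n : ℕ} {G : SimpleGraph (Fin n)} {w : Sym2 (Fin n) → ℝ≥0}

lemma wdist_le {u v : Fin n} (p : G.Walk u v) : wdist G w u v ≤ walkLen w p := iInf_le _ p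

@[simp] lemma wdist_self (u : Fin n) : wdist G w u u = 0 :=
  le_antisymm ((wdist_le (G := G) (w := w) SimpleGraph.Walk.nil).trans (by simp)) zero_le

lemma wdist_comm (u v : Fin n) : wdist G w u v = wdist G w v u := by
  refine le_antisymm (le_iInf fun p => ?_) (le_iInf fun p => ?_)
  · simpa using wdist_le (w := w) p.reverse
  · simpa using wdist_le (w := w) p.reverse

lemma sum_edges_bypass_le {M : Type*} [AddCommMonoid M] [PartialOrder M] [IsOrderedAddMonoid M]
    (c : Sym2 (Fin n) → M) (hc : ∀ e, 0 ≤ c e) {u v : Fin n} (p : G.Walk u v) :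
    (p.bypass.edges.map c).sum ≤ (p.edges.map c).sum :=
  List.Sublist.sum_le_sum (p.edges_bypass_sublist_edges.map c) (by simp [hc])

/-- Bypassing loops never increases the cost, and there are finitely many paths. General costs are
allowed because the lemma serves both for lengths and for the tie-breaking costs. -/
lemma exists_path_min {M : Type*} [AddCommMonoid M] [LinearOrder M] [IsOrderedAddMonoid M]
    (c : Sym2 (Fin n) → M) (hc : ∀ e, 0 ≤ c e) {u v : Fin n} (h : G.Reachable u v) :
    ∃ p : G.Walk u v, p.IsPath ∧ ∀ q : G.Walk u v, (p.edges.map c).sum ≤ (q.edges.map c).sum := by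
  classical
  obtain ⟨p0⟩ := h
  haveI : Nonempty (G.Path u v) := ⟨p0.toPath⟩
  obtain ⟨p, hp⟩ := Finite.exists_min fun p : G.Path u v => ((p : G.Walk u v).edges.map c).sum
  exact ⟨p, p.2, fun q => (hp q.toPath).trans (sum_edges_bypass_le c hc q)⟩

lemma exists_walk_eq_wdist {u v : Fin n} (h : G.Reachable u v) :
    ∃ p : G.Walk u v, (walkLen w p : ℝ≥0∞) = wdist G w u v := by
  obtain ⟨p, -, hp⟩ := exists_path_min w (fun _ => zero_le) h
  exact ⟨p, le_antisymm (le_iInf fun q => by exact_mod_cast hp q) (wdist_le p)⟩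

lemma wdist_ne_top {u v : Fin n} : wdist G w u v ≠ ⊤ ↔ G.Reachable u v := by
  constructor
  · intro h
    by_contra hn
    haveI : IsEmpty (G.Walk u v) := ⟨fun p => hn ⟨p⟩⟩
    exact h (by simp [wdist])
  · rintro ⟨p⟩
    exact ne_top_of_le_ne_top ENNReal.coe_ne_top (wdist_le p)

lemma wdist_triangle (u v x : Fin n) : wdist G w u x ≤ wdist G w u v + wdist G w v x := by
  by_cases h1 : G.Reachable u v
  · by_cases h2 : G.Reachable v x
    · obtain ⟨p, hp⟩ := exists_walk_eq_wdist (w := w) h1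
      obtain ⟨q, hq⟩ := exists_walk_eq_wdist (w := w) h2
      rw [← hp, ← hq, ← ENNReal.coe_add, ← walkLen_append]
      exact wdist_le _
    · rw [← wdist_ne_top (w := w), not_not] at h2
      simp [h2]
  · rw [← wdist_ne_top (w := w), not_not] at h1
    simp [h1]

lemma wdist_le_edge {x y : Fin n} (h : G.Adj x y) : wdist G w x y ≤ w s(x, y) := by
  simpa using wdist_le (w := w) (SimpleGraph.Walk.cons h .nil)

lemma wdist_step {u x y : Fin n} (h : G.Adj x y) :
    wdist G w u y ≤ wdist G w u x + w s(x, y) :=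
  (wdist_triangle u x y).trans (by gcongr; exact wdist_le_edge h)

/-- The distance to the nearest vertex of a set. -/
def sdist (G : SimpleGraph (Fin n)) (w : Sym2 (Fin n) → ℝ≥0) (L : Finset (Fin n)) (u : Fin n) :
    ℝ≥0∞ := ⨅ x ∈ L, wdist G w u x

lemma sdist_le {L : Finset (Fin n)} {u x : Fin n} (h : x ∈ L) : sdist G w L u ≤ wdist G w u x :=
  iInf₂_le x h

lemma exists_sdist {L : Finset (Fin n)} {u : Fin n} (h : sdist G w L u ≠ ⊤) :
    ∃ x ∈ L, sdist G w L u = wdist G w u x := by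
  have hL : L.Nonempty := by
    by_contra hL
    rw [Finset.not_nonempty_iff_eq_empty] at hL
    exact h (by simp [sdist, hL])
  obtain ⟨x, hx, hmin⟩ := L.exists_min_image (fun x => wdist G w u x) hL
  exact ⟨x, hx, le_antisymm (sdist_le hx) (le_iInf₂ fun y hy => hmin y hy)⟩

lemma sdist_triangle {L : Finset (Fin n)} (u v : Fin n) :
    sdist G w L u ≤ wdist G w u v + sdist G w L v := by
  by_cases h : sdist G w L v = ⊤
  · simp [h]
  · obtain ⟨x, hx, e⟩ := exists_sdist h
    rw [e]
    exact (sdist_le hx).trans (wdist_triangle u v x)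

open Classical in
/-- The vertices that are closer to `u` than the vertices of `L`. -/
def ball (G : SimpleGraph (Fin n)) (w : Sym2 (Fin n) → ℝ≥0) (L : Finset (Fin n)) (u : Fin n) :
    Finset (Fin n) := Finset.univ.filter fun v => wdist G w u v < sdist G w L u

lemma mem_ball {L : Finset (Fin n)} {u v : Fin n} :
    v ∈ ball G w L u ↔ wdist G w u v < sdist G w L u := by simp [ball]

end dist

/-! ## Truncated shortest path search: the invariant -/

/-- The state of a search from `s` for the vertices at distance less than `ρ`: tentative
distances `d`, the vertices `seen` and the vertices `done` that have been expanded, the pointers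
`par`, certified by `dep` to be acyclic, the numbers `J` of edges that have been
scanned, and the distance `D` of the vertex expanded last. -/
structure SInv {n : ℕ} (G : SimpleGraph (Fin n)) (w : Sym2 (Fin n) → ℝ≥0) (s : Fin n) (ρ : ℝ≥0∞)
    (d : Fin n → ℝ≥0) (seen done : Finset (Fin n)) (par : Fin n → Fin n) (idx : Fin n → ℕ)
    (dep : Fin n → ℕ) (J : Fin n → ℕ) (D : ℝ≥0) : Prop where
  sub : done ⊆ seen
  root : s ∈ seen ∧ par s = s ∧ d s = 0
  tree : ∀ v ∈ seen, v ≠ s → par v ∈ done ∧ (adjList G (par v))[idx v]? = some v ∧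
    d v = d (par v) + w s(par v, v) ∧ dep (par v) < dep v
  lt : ∀ v ∈ seen, (d v : ℝ≥0∞) < ρ
  scan : ∀ x ∈ done, ∀ j < J x, ∀ y, (adjList G x)[j]? = some y →
    ((d x + w s(x, y) : ℝ≥0) : ℝ≥0∞) < ρ → y ∈ seen ∧ d y ≤ d x + w s(x, y)
  low : ∀ x ∈ done, d x ≤ D
  high : ∀ x ∈ seen, x ∉ done → D ≤ d x

namespace SInv
variable {n : ℕ} {G : SimpleGraph (Fin n)} {w : Sym2 (Fin n) → ℝ≥0} {s : Fin n} {ρ : ℝ≥0∞}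
  {d : Fin n → ℝ≥0} {seen done : Finset (Fin n)} {par : Fin n → Fin n} {idx dep J : Fin n → ℕ}
  {D : ℝ≥0}

lemma init (hρ : 0 < ρ) : SInv G w s ρ (fun _ => 0) {s} ∅ (fun _ => s) (fun _ => 0) (fun _ => 0)
    (fun _ => 0) 0 where
  sub := by simp
  root := by simp
  tree := by simp
  lt := by simpa using hρ
  scan := by simp
  low := by simp
  high := by simp

lemma wdist_le (h : SInv G w s ρ d seen done par idx dep J D) :
    ∀ v ∈ seen, wdist G w s v ≤ d v := by
  suffices H : ∀ k, ∀ v ∈ seen, dep v = k → wdist G w s v ≤ d v from fun v hv => H _ v hv rfl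
  intro k
  induction k using Nat.strong_induction_on with
  | _ k ih =>
    intro v hv hk
    by_cases hs : v = s
    · subst hs; simp
    · obtain ⟨h1, h2, h3, h4⟩ := h.tree v hv hs
      have := ih _ (hk ▸ h4) (par v) (h.sub h1) rfl
      rw [h3, ENNReal.coe_add]
      exact (wdist_step (adj_of_adjList h2)).trans (by gcongr)

/-- Only the data of `y` change. Parents are expanded vertices and `y` is not one, so the tree
conditions at other vertices are unaffected. The order is kept since the new distance is at least `d
x = D`. -/
lemma relax (h : SInv G w s ρ d seen done par idx dep J D) {x y : Fin n} {j : ℕ} (hx : x ∈ done)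
    (hD : d x = D) (hj : J x = j) (hy : (adjList G x)[j]? = some y)
    (hlt : ((d x + w s(x, y) : ℝ≥0) : ℝ≥0∞) < ρ) (hyd : y ∉ done)
    (hys : y ∉ seen ∨ d x + w s(x, y) < d y) :
    SInv G w s ρ (Function.update d y (d x + w s(x, y))) (insert y seen) done
      (Function.update par y x) (Function.update idx y j)
      (Function.update dep y (dep x + 1)) (Function.update J x (j + 1)) D := by
  have hs : y ≠ s := by
    rintro rfl
    rcases hys with hys | hys
    · exact hys h.root.1
    · rw [h.root.2.2] at hys; exact absurd hys (by simp)
  have hne : ∀ z ∈ done, z ≠ y := fun z hz => by rintro rfl; exact hyd hz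
  refine ⟨h.sub.trans (Finset.subset_insert _ _), ?_, ?_, ?_, ?_, ?_, ?_⟩
  · rw [Function.update_of_ne hs.symm, Function.update_of_ne hs.symm]
    exact ⟨Finset.mem_insert_of_mem h.root.1, h.root.2⟩
  · intro v hv hvs
    by_cases hvy : v = y
    · subst hvy
      simp only [Function.update_self]
      rw [Function.update_of_ne (hne x hx), Function.update_of_ne (hne x hx)]
      exact ⟨hx, hy, rfl, Nat.lt_succ_self _⟩
    · rw [Finset.mem_insert, or_iff_right hvy] at hv
      have := h.tree v hv hvs
      rw [Function.update_of_ne hvy, Function.update_of_ne hvy, Function.update_of_ne hvy,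
        Function.update_of_ne hvy, Function.update_of_ne (hne _ this.1),
        Function.update_of_ne (hne _ this.1)]
      exact this
  · intro v hv
    by_cases hvy : v = y
    · subst hvy; simpa using hlt
    · rw [Finset.mem_insert, or_iff_right hvy] at hv
      rw [Function.update_of_ne hvy]
      exact h.lt v hv
  · intro z hz i hi v hv hlt'
    rw [Function.update_of_ne (hne z hz)] at hlt' ⊢
    have key : (i < J z) ∨ (z = x ∧ i = j) := by
      by_cases hzx : z = x
      · subst hzx
        rw [Function.update_self] at hi
        omega
      · rw [Function.update_of_ne hzx] at hi; exact .inl hi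
    rcases key with hi | ⟨rfl, rfl⟩
    · obtain ⟨h1, h2⟩ := h.scan z hz i hi v hv hlt'
      refine ⟨Finset.mem_insert_of_mem h1, ?_⟩
      by_cases hvy : v = y
      · subst hvy
        rcases hys with hys | hys
        · exact absurd h1 hys
        · rw [Function.update_self]
          exact hys.le.trans h2
      · rwa [Function.update_of_ne hvy]
    · obtain rfl : y = v := by simpa [hy] using hv
      exact ⟨Finset.mem_insert_self _ _, by simp⟩
  · intro z hz
    rw [Function.update_of_ne (hne z hz)]
    exact h.low z hz
  · intro v hv hvd
    by_cases hvy : v = y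
    · subst hvy; rw [Function.update_self, hD]; exact le_self_add
    · rw [Finset.mem_insert, or_iff_right hvy] at hv
      rw [Function.update_of_ne hvy]
      exact h.high v hv hvd

lemma skip (h : SInv G w s ρ d seen done par idx dep J D) {x y : Fin n} {j : ℕ}
    (hj : J x = j) (hy : (adjList G x)[j]? = some y)
    (hlt : ((d x + w s(x, y) : ℝ≥0) : ℝ≥0∞) < ρ → y ∈ seen ∧ d y ≤ d x + w s(x, y)) :
    SInv G w s ρ d seen done par idx dep (Function.update J x (j + 1)) D := by
  refine ⟨h.sub, h.root, h.tree, h.lt, ?_, h.low, h.high⟩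
  intro z hz i hi v hv hlt'
  by_cases hzx : z = x
  · subst hzx
    rw [Function.update_self] at hi
    by_cases hij : i = j
    · subst hij
      obtain rfl : y = v := by simpa [hy] using hv
      exact hlt hlt'
    · exact h.scan z hz i (by omega) v hv hlt'
  · rw [Function.update_of_ne hzx] at hi
    exact h.scan z hz i hi v hv hlt'

/-- A minimal unexpanded vertex separates the distances again: by `high` the old bound `D` is at
most `d x`, and all other unexpanded vertices are at least as far. -/
lemma pop (h : SInv G w s ρ d seen done par idx dep J D) {x : Fin n} (hx : x ∈ seen)
    (hxd : x ∉ done) (hmin : ∀ y ∈ seen, y ∉ done → d x ≤ d y) :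
    SInv G w s ρ d seen (insert x done) par idx dep (Function.update J x 0) (d x) := by
  refine ⟨Finset.insert_subset hx h.sub, h.root, ?_, h.lt, ?_, ?_, ?_⟩
  · intro v hv hvs
    obtain ⟨h1, h2⟩ := h.tree v hv hvs
    exact ⟨Finset.mem_insert_of_mem h1, h2⟩
  · intro z hz i hi v hv hlt
    by_cases hzx : z = x
    · subst hzx; simp at hi
    · rw [Function.update_of_ne hzx] at hi
      rw [Finset.mem_insert, or_iff_right hzx] at hz
      exact h.scan z hz i hi v hv hlt
  · intro z hz
    rcases Finset.mem_insert.1 hz with rfl | hz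
    · exact le_rfl
    · exact (h.low z hz).trans (h.high x hx hxd)
  · intro v hv hvd
    rw [Finset.mem_insert, not_or] at hvd
    exact hmin v hv hvd.2

/-- When every vertex that has been seen is expanded, the search is complete. -/
lemma complete (h : SInv G w s ρ d seen done par idx dep J D) (hdone : done = seen)
    (hJ : ∀ x ∈ done, J x = deg G x) (v : Fin n) :
    (v ∈ seen ↔ wdist G w s v < ρ) ∧ (v ∈ seen → (d v : ℝ≥0∞) = wdist G w s v) := by
  -- All edges at seen vertices have been scanned, so the bound passes along any walk whose length
  -- stays below the radius.
  have key : ∀ (u : Fin n) (p : G.Walk u v), u ∈ seen →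
      ((d u + walkLen w p : ℝ≥0) : ℝ≥0∞) < ρ → v ∈ seen ∧ d v ≤ d u + walkLen w p := by
    intro u p
    induction p with
    | nil => intro hu _; simpa using hu
    | @cons u x _ hux p ih =>
      intro hu hlt
      rw [walkLen_cons, ← add_assoc] at hlt ⊢
      obtain ⟨j, hj⟩ := exists_index hux
      have hud : u ∈ done := hdone ▸ hu
      obtain ⟨h1, h2⟩ := h.scan u hud j (by rw [hJ u hud]; exact lt_deg hj) x hj
        (lt_of_le_of_lt (ENNReal.coe_le_coe.2 le_self_add) hlt)
      obtain ⟨h3, h4⟩ := ih h1 (lt_of_le_of_lt (by gcongr) hlt)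
      exact ⟨h3, h4.trans (by gcongr)⟩
  have key2 : wdist G w s v < ρ → v ∈ seen ∧ (d v : ℝ≥0∞) ≤ wdist G w s v := by
    intro hlt
    obtain ⟨p, hp⟩ := exists_walk_eq_wdist (w := w) (wdist_ne_top.1 (ne_top_of_lt hlt))
    have := key s p h.root.1 (by rw [h.root.2.2, zero_add, hp]; exact hlt)
    rw [h.root.2.2, zero_add] at this
    exact ⟨this.1, by rw [← hp]; exact_mod_cast this.2⟩
  refine ⟨⟨fun hv => (h.wdist_le v hv).trans_lt (h.lt v hv), fun hv => (key2 hv).1⟩, fun hv => ?_⟩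
  exact le_antisymm (key2 ((h.wdist_le v hv).trans_lt (h.lt v hv))).2 (h.wdist_le v hv)

end SInv

end DistOracle
end

noncomputable section
namespace DistOracle

/-! ## Truncated shortest path search: the program -/

/-- The edge from the vertex in register 7 to its neighbour in register 10 leads to a path of the
length in length register 3; record this path if it is short enough and the best so far. -/
def relaxCmd (upd : Cmd) : Cmd :=
  .seq (.asg 11 (.v 3))
  (.seq (.ite (.llt 3 1) (.asg 11 (.c 1)) .skip)
  (.ite (.eq (.v 11) (.c 1))
    (.ite (.eq (.fld 8 (.v 10)) (.c 0))
      (.seq (.setf 8 (.v 10) (.c 1))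
      (.seq (.setf 9 (.v 10) (.v 7))
      (.seq (.setf 10 (.v 10) (.v 9))
      (.seq (.lstore (.v 10) 3)
      (.seq (.setf 11 (.v 6) (.v 10))
      (.seq (.asg 6 (.add (.v 6) (.c 1))) upd))))))
      (.seq (.lload 4 (.v 10))
      (.ite (.llt 3 4)
        (.seq (.setf 9 (.v 10) (.v 7))
        (.seq (.setf 10 (.v 10) (.v 9))
        (.seq (.lstore (.v 10) 3) upd)))
        .skip)))
    .skip))

/-- Scan the edges of the vertex in register 7. -/
def scanCmd (upd : Cmd) : Cmd :=
  .loop (.lt (.v 9) (.v 8))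
    (.seq (.asg 10 (.nbr (.v 7) (.v 9)))
    (.seq (.lwt 3 (.v 7) (.v 9))
    (.seq (.ladd 3 2 3)
    (.seq (relaxCmd upd)
      (.asg 9 (.add (.v 9) (.c 1)))))))

def exploreCmd (upd pop : Cmd) : Cmd :=
  .loop (.lt (.v 5) (.v 6))
    (.seq pop
    (.seq (.lload 2 (.v 7))
    (.seq (.asg 8 (.deg (.v 7)))
    (.seq (.asg 9 (.c 0))
      (scanCmd upd)))))

def startCmd (upd : Cmd) : Cmd :=
  .seq (.asg 5 (.c 0))
  (.seq (.asg 6 (.c 0))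
  (.seq (.asg 7 (.v 2))
  (.seq (.asg 10 (.v 2))
  (.seq (.asg 9 (.c 0))
  (.seq (.lzero 3) (relaxCmd upd))))))

/-- Restore the work space of the search. -/
def cleanCmd : Cmd :=
  .seq (.asg 5 (.c 0))
  (.loop (.lt (.v 5) (.v 6))
    (.seq (.asg 10 (.fld 11 (.v 5)))
    (.seq (.setf 11 (.v 5) (.c 0))
    (.seq (.setf 8 (.v 10) (.c 0))
    (.seq (.setf 9 (.v 10) (.c 0))
    (.seq (.setf 10 (.v 10) (.c 0))
    (.seq (.lstz (.v 10))
      (.asg 5 (.add (.v 5) (.c 1))))))))))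

variable {n : ℕ} {Λ : Layout n}

/-- The commands `upd` and `pop` maintain a priority queue of the vertices in `que` that are not
in `done`. The first argument of the invariant is the work space of the queue. -/
structure IsQueue (Λ : Layout n) (upd pop : Cmd) (g : ℕ)
    (inv : (ℕ → ℕ) → (Fin n → ℝ≥0) → List (Fin n) → Finset (Fin n) → ℝ≥0 → Prop) : Prop where
  init : inv (fun _ => 0) (fun _ => 0) [] ∅ 0
  upd_spec : ∀ (σ : AS) (d : Fin n → ℝ≥0) (que que' : List (Fin n)) (done : Finset (Fin n))
    (D ld : ℝ≥0) (y : Fin n), inv (σ.f 13) d que done D → y ∉ done → (∀ v ∈ done, v ∈ que) →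
    ((y ∉ que ∧ que' = que ++ [y]) ∨ (y ∈ que ∧ que' = que ∧ ld < d y)) →
    ((que = [] ∧ ld = 0) ∨ ∃ e, ld = D + Λ.E.weight e) →
    (∀ v : Fin n, σ.lm v = Function.update d y ld v) → σ.r 10 = y →
    WP Λ upd (fun t σ' => t ≤ g ∧ inv (σ'.f 13) (Function.update d y ld) que' done D ∧
      (∀ i < 20, σ'.r i = σ.r i) ∧ (∀ i < 6, σ'.lr i = σ.lr i) ∧ (∀ g ≠ 13, σ'.f g = σ.f g) ∧
      σ'.lm = σ.lm ∧ σ'.out = σ.out) σ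
  pop_spec : ∀ (σ : AS) (d : Fin n → ℝ≥0) (que : List (Fin n)) (done : Finset (Fin n)) (D : ℝ≥0),
    inv (σ.f 13) d que done D → que.Nodup → (∀ v ∈ done, v ∈ que) → done.card < que.length →
    σ.r 5 = done.card → (∀ i, σ.f 11 i = (que.map Fin.val).getD i 0) →
    (∀ v : Fin n, σ.lm v = d v) →
    WP Λ pop (fun t σ' => t ≤ g ∧ ∃ x ∈ que, x ∉ done ∧ (∀ y ∈ que, y ∉ done → d x ≤ d y) ∧
      σ'.r 7 = x ∧ σ'.r 5 = done.card + 1 ∧ inv (σ'.f 13) d que (insert x done) (d x) ∧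
      (∀ i < 20, i ≠ 5 → i ≠ 7 → σ'.r i = σ.r i) ∧ (∀ i < 6, σ'.lr i = σ.lr i) ∧
      (∀ g ≠ 13, σ'.f g = σ.f g) ∧ σ'.lm = σ.lm ∧ σ'.out = σ.out) σ
  final : ∀ t d que done D, inv t d que done D → (∀ v ∈ que, v ∈ done) → t = fun _ => 0

/-- The work space of the state `σ` holds the data of a search; otherwise, `σ` agrees with `σ₀`. -/
structure Linked (σ₀ σ : AS) (que : List (Fin n)) (d : Fin n → ℝ≥0) (par : Fin n → Fin n)
    (idx : Fin n → ℕ) : Prop where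
  nodup : que.Nodup
  r6 : σ.r 6 = que.length
  f11 : ∀ i, σ.f 11 i = (que.map Fin.val).getD i 0
  f8 : ∀ i, σ.f 8 i = if i ∈ que.map Fin.val then 1 else 0
  f9 : ∀ v ∈ que, σ.f 9 v = par v
  f10 : ∀ v ∈ que, σ.f 10 v = idx v
  lm : ∀ v : Fin n, σ.lm v = d v
  out_que : ∀ i, i ∉ que.map Fin.val → σ.f 9 i = 0 ∧ σ.f 10 i = 0 ∧ σ.lm i = 0
  rest : ∀ g, g ≠ 8 → g ≠ 9 → g ≠ 10 → g ≠ 11 → g ≠ 13 → σ.f g = σ₀.f g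
  out : σ.out = σ₀.out
  reg : ∀ i, (i < 4 ∨ i = 12) → σ.r i = σ₀.r i
  lreg : ∀ i < 2, σ.lr i = σ₀.lr i

lemma Linked.keep {σ₀ σ σ' : AS} {que : List (Fin n)} {d : Fin n → ℝ≥0} {par : Fin n → Fin n}
    {idx : Fin n → ℕ} (h : Linked σ₀ σ que d par idx) (h6 : σ'.r 6 = σ.r 6)
    (hf : ∀ g ≠ 13, σ'.f g = σ.f g) (hlm : σ'.lm = σ.lm) (hout : σ'.out = σ.out)
    (hr : ∀ i, (i < 4 ∨ i = 12) → σ'.r i = σ.r i) (hl : ∀ i < 2, σ'.lr i = σ.lr i) :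
    Linked σ₀ σ' que d par idx where
  nodup := h.nodup
  r6 := h6.trans h.r6
  f11 := by rw [hf 11 (by norm_num)]; exact h.f11
  f8 := by rw [hf 8 (by norm_num)]; exact h.f8
  f9 := by rw [hf 9 (by norm_num)]; exact h.f9
  f10 := by rw [hf 10 (by norm_num)]; exact h.f10
  lm := by rw [hlm]; exact h.lm
  out_que := by rw [hf 9 (by norm_num), hf 10 (by norm_num), hlm]; exact h.out_que
  rest := fun g h1 h2 h3 h4 h5 => (hf g h5).trans (h.rest g h1 h2 h3 h4 h5)
  out := hout.trans h.out
  reg := fun i hi => (hr i hi).trans (h.reg i hi)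
  lreg := fun i hi => (hl i hi).trans (h.lreg i hi)

lemma Linked.insert {σ₀ σ : AS} {que : List (Fin n)} {d : Fin n → ℝ≥0} {par : Fin n → Fin n}
    {idx : Fin n → ℕ} (h : Linked σ₀ σ que d par idx) {x y : Fin n} (hy : y ∉ que) (j : ℕ)
    (ld : ℝ≥0) :
    Linked σ₀ ((((((σ.setf 8 y 1).setf 9 y x).setf 10 y j).setm y ld).setf 11 que.length y).setr 6
      (que.length + 1)) (que ++ [y]) (Function.update d y ld) (Function.update par y x)
      (Function.update idx y j) where
  nodup := by
    rw [List.nodup_append]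
    exact ⟨h.nodup, by simp, by
      intro a ha b hb hab
      simp only [List.mem_singleton] at hb
      subst hb; subst hab; exact hy ha⟩
  r6 := by simp
  f11 := by
    intro i
    by_cases hi : i = que.length
    · subst hi; simp
    · simp only [AS.setr_f, AS.setf_f, if_pos, Function.update_of_ne hi]
      rw [AS.setm_f]
      simp only [AS.setf_f]
      simp only [if_neg (show (11 : ℕ) ≠ 10 by norm_num), if_neg (show (11 : ℕ) ≠ 9 by norm_num),
        if_neg (show (11 : ℕ) ≠ 8 by norm_num)]
      rw [h.f11, List.map_append]
      rcases lt_or_gt_of_ne hi with hi | hi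
      · rw [List.getD_append _ _ _ _ (by simpa using hi)]
      · rw [List.getD_eq_default _ _ (by simpa using hi.le),
          List.getD_eq_default _ _ (by simp; omega)]
  f8 := by
    intro i
    simp only [AS.setr_f, AS.setf_f, AS.setm_f, Function.update_apply]
    by_cases h1 : i = y <;> simp [h.f8, h1, eq_comm]
  f9 := by
    intro v hv
    rw [List.mem_append, List.mem_singleton] at hv
    by_cases hvy : v = y
    · subst hvy; simp
    · rw [or_iff_left hvy] at hv
      simp [hvy, Function.update_apply, Fin.val_inj, h.f9 v hv]
  f10 := by
    intro v hv
    rw [List.mem_append, List.mem_singleton] at hv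
    by_cases hvy : v = y
    · subst hvy; simp
    · rw [or_iff_left hvy] at hv
      simp [hvy, Function.update_apply, Fin.val_inj, h.f10 v hv]
  lm := by
    intro v
    by_cases hvy : v = y
    · subst hvy; simp
    · simp [hvy, Function.update_apply, Fin.val_inj, h.lm]
  out_que := by
    intro i hi
    simp only [List.map_append, List.mem_append, not_or, List.map_cons, List.map_nil,
      List.mem_singleton] at hi
    simp [hi.2, h.out_que i hi.1]
  rest := fun g h1 h2 h3 h4 h5 => by simp [h1, h2, h3, h4, h.rest g h1 h2 h3 h4 h5]
  out := h.out
  reg := fun i hi => by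
    have : i ≠ 6 := by omega
    simp [this, h.reg i hi]
  lreg := h.lreg

lemma Linked.decrease {σ₀ σ : AS} {que : List (Fin n)} {d : Fin n → ℝ≥0} {par : Fin n → Fin n}
    {idx : Fin n → ℕ} (h : Linked σ₀ σ que d par idx) {x y : Fin n} (hy : y ∈ que) (j : ℕ)
    (ld l4 : ℝ≥0) :
    Linked σ₀ ((((σ.setl 4 l4).setf 9 y x).setf 10 y j).setm y ld) que
      (Function.update d y ld) (Function.update par y x) (Function.update idx y j) where
  nodup := h.nodup
  r6 := h.r6
  f11 := h.f11
  f8 := h.f8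
  f9 := by
    intro v hv
    by_cases hvy : v = y
    · subst hvy; simp
    · simp [hvy, Function.update_apply, Fin.val_inj, h.f9 v hv]
  f10 := by
    intro v hv
    by_cases hvy : v = y
    · subst hvy; simp
    · simp [hvy, Function.update_apply, Fin.val_inj, h.f10 v hv]
  lm := by
    intro v
    by_cases hvy : v = y
    · subst hvy; simp
    · simp [hvy, Function.update_apply, Fin.val_inj, h.lm]
  out_que := by
    intro i hi
    have : i ≠ y := by rintro rfl; exact hi (List.mem_map_of_mem hy)
    simp [this, h.out_que i hi]
  rest := fun g h1 h2 h3 h4 h5 => by simp [h1, h2, h3, h4, h.rest g h1 h2 h3 h4 h5]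
  out := h.out
  reg := h.reg
  lreg := fun i hi => by
    have : i ≠ 4 := by omega
    simp [this, h.lreg i hi]

variable {upd pop : Cmd} {g : ℕ}
  {inv : (ℕ → ℕ) → (Fin n → ℝ≥0) → List (Fin n) → Finset (Fin n) → ℝ≥0 → Prop}

/-- The two alternatives of the outcome provide the hypotheses of `SInv.relax` and `SInv.skip`. An
expanded vertex is never improved, by `hyd`. The radius is encoded by a flag for infinity in
register 3 and a length in length register 1, as `hρ` says. -/
theorem relaxCmd_spec (hQ : IsQueue Λ upd pop g inv) {σ₀ σ : AS} {que : List (Fin n)}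
    {d : Fin n → ℝ≥0} {par : Fin n → Fin n} {idx : Fin n → ℕ} {done : Finset (Fin n)}
    {D ld : ℝ≥0} {ρ : ℝ≥0∞} {x y : Fin n} {j : ℕ} (hl : Linked σ₀ σ que d par idx)
    (hi : inv (σ.f 13) d que done D) (hdone : ∀ v ∈ done, v ∈ que)
    (hρ : ∀ l : ℝ≥0, (l : ℝ≥0∞) < ρ ↔ σ₀.r 3 = 1 ∨ l < σ₀.lr 1) (h3 : σ₀.r 3 < 2)
    (h10 : σ.r 10 = y) (h7 : σ.r 7 = x) (h9 : σ.r 9 = j) (hl3 : σ.lr 3 = ld)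
    (hld : (que = [] ∧ ld = 0) ∨ ∃ e, ld = D + Λ.E.weight e) (hyd : y ∈ done → d y ≤ ld) :
    WP Λ (relaxCmd upd) (fun t σ' => t ≤ g + 150 ∧
      (∀ i < 20, i ≠ 6 → i ≠ 11 → σ'.r i = σ.r i) ∧ (∀ i < 4, σ'.lr i = σ.lr i) ∧
      (((ld : ℝ≥0∞) < ρ ∧ y ∉ done ∧ ∃ que',
          ((y ∉ que ∧ que' = que ++ [y]) ∨ (y ∈ que ∧ que' = que ∧ ld < d y)) ∧
          Linked σ₀ σ' que' (Function.update d y ld) (Function.update par y x)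
            (Function.update idx y j) ∧ inv (σ'.f 13) (Function.update d y ld) que' done D) ∨
        (((ld : ℝ≥0∞) < ρ → y ∈ que ∧ d y ≤ ld) ∧ Linked σ₀ σ' que d par idx ∧
          inv (σ'.f 13) d que done D))) σ := by
  have hR := Λ.hR
  have hN := Λ.hN
  have hy2 := y.2
  have hx2 := x.2
  have e3 : σ.r 3 = σ₀.r 3 := hl.reg 3 (by norm_num)
  have e1 : σ.lr 1 = σ₀.lr 1 := hl.lreg 1 (by norm_num)
  have hlen : que.length ≤ n := by simpa using hl.nodup.length_le_card
  set b : ℕ := if (ld : ℝ≥0∞) < ρ then 1 else 0 with hb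
  have hstep : WP Λ (.seq (.asg 11 (.v 3)) (.ite (.llt 3 1) (.asg 11 (.c 1)) .skip))
      (fun t σ' => t ≤ 10 ∧ σ'.r 11 = b ∧ (∀ i ≠ 11, σ'.r i = σ.r i) ∧ σ'.lr = σ.lr ∧
        σ'.f = σ.f ∧ σ'.lm = σ.lm ∧ σ'.out = σ.out) σ := by
    simp [hl3, e1, e3]
    have := hρ ld
    constructor
    · intro h
      refine ⟨?_, ?_⟩
      · rw [hb, if_pos (this.2 (.inr h))]
      · intro i hi; simp [hi]
    · intro h
      refine ⟨?_, ?_⟩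
      · by_cases h1 : σ₀.r 3 = 1
        · rw [hb, if_pos (this.2 (.inl h1)), h1]
        · rw [hb, if_neg (fun h2 => by rcases this.1 h2 with h2 | h2
                                       · exact h1 h2
                                       · exact absurd h2 (not_lt.2 h))]
          omega
      · intro i hi; simp [hi]
  rw [relaxCmd]
  -- Reassociate, so that the comparison with the radius is one command, whose result is the bit `b`
  -- in register 11.
  suffices H : WP Λ (.seq (.seq (.asg 11 (.v 3)) (.ite (.llt 3 1) (.asg 11 (.c 1)) .skip)) _)
      (fun t σ' => t ≤ g + 150 ∧
      (∀ i < 20, i ≠ 6 → i ≠ 11 → σ'.r i = σ.r i) ∧ (∀ i < 4, σ'.lr i = σ.lr i) ∧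
      (((ld : ℝ≥0∞) < ρ ∧ y ∉ done ∧ ∃ que',
          ((y ∉ que ∧ que' = que ++ [y]) ∨ (y ∈ que ∧ que' = que ∧ ld < d y)) ∧
          Linked σ₀ σ' que' (Function.update d y ld) (Function.update par y x)
            (Function.update idx y j) ∧ inv (σ'.f 13) (Function.update d y ld) que' done D) ∨
        (((ld : ℝ≥0∞) < ρ → y ∈ que ∧ d y ≤ ld) ∧ Linked σ₀ σ' que d par idx ∧
          inv (σ'.f 13) d que done D))) σ by
    rw [WP_seq, WP_seq] at H
    rw [WP_seq]
    refine H.mono fun t σ1 h => ?_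
    rw [WP_seq]
    simpa only [add_assoc] using h
  rw [WP_seq]
  refine hstep.mono ?_
  rintro t σ1 ⟨ht, g11, gr, glr, gf, glm, gout⟩
  have hl1 : Linked σ₀ σ1 que d par idx := hl.keep (gr 6 (by norm_num)) (fun g _ => by rw [gf]) glm
    gout (fun i hi => gr i (by omega)) (fun i _ => by rw [glr])
  have g10 : σ1.r 10 = y := by rw [gr 10 (by norm_num), h10]
  have g7 : σ1.r 7 = x := by rw [gr 7 (by norm_num), h7]
  have g9 : σ1.r 9 = j := by rw [gr 9 (by norm_num), h9]
  have gl3 : σ1.lr 3 = ld := by rw [glr, hl3]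
  have hi1 : inv (σ1.f 13) d que done D := by rw [gf]; exact hi
  by_cases hlt : (ld : ℝ≥0∞) < ρ
  · have hb1 : b = 1 := by rw [hb, if_pos hlt]
    have e8 := hl1.f8 y
    have hmem : ((y : ℕ) ∈ que.map Fin.val) ↔ y ∈ que := by simp [Fin.val_inj]
    by_cases hyq : y ∈ que
    · rw [if_pos (hmem.2 hyq)] at e8
      simp [g11, hb1, g10, e8, hl1.lm, gl3, g7, g9]
      refine ⟨by omega, fun hdec => ?_, fun hdec => ?_⟩
      · have hyd' : y ∉ done := fun h => absurd hdec (not_lt.2 (hyd h))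
        have hl2 := hl1.decrease (x := x) hyq j ld (d y)
        refine ⟨by omega, (hQ.upd_spec _ d que que done D ld y (by simpa using hi1) hyd' hdone
          (.inr ⟨hyq, rfl, hdec⟩) hld hl2.lm (by simpa using g10)).mono ?_⟩
        rintro t' σ2 ⟨k1, k2, k3, k4, k5, k6, k7⟩
        refine ⟨by omega, fun i hi h6 h11 => ?_, fun i hi => ?_, .inl ⟨hlt, hyd', que,
          .inr ⟨hyq, rfl, hdec⟩, ?_, k2⟩⟩
        · rw [k3 i hi]; simp [gr i h11]
        · have : i ≠ 4 := by omega
          rw [k4 i (by omega)]; simp [glr, this]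
        · exact hl2.keep (k3 6 (by norm_num)) k5 k6 k7 (fun i hi => k3 i (by omega))
            (fun i hi => k4 i (by omega))
      · refine ⟨by omega, fun i hi h6 h11 => gr i h11, fun i hi => ?_, .inr ⟨fun _ => ⟨hyq, hdec⟩,
          ?_, hi1⟩⟩
        · have : i ≠ 4 := by omega
          simp [glr, this]
        · exact hl1.keep rfl (fun _ _ => rfl) rfl rfl (fun _ _ => rfl)
            (fun i hi => by simp [show i ≠ 4 by omega])
    · rw [if_neg (fun h => hyq (hmem.1 h))] at e8
      have hyd' : y ∉ done := fun h => hyq (hdone y h)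
      have hl2 := hl1.insert (x := x) hyq j ld
      have hlen' : que.length < n := by
        have : (que ++ [y]).length ≤ n := by simpa using hl2.nodup.length_le_card
        simp at this; omega
      simp [g11, hb1, g10, e8, hl1.r6, gl3, g7, g9]
      refine ⟨by omega, by omega, by omega, (hQ.upd_spec _ d que (que ++ [y]) done D ld y
        (by simpa using hi1) hyd' hdone (.inl ⟨hyq, rfl⟩) hld hl2.lm (by simpa using g10)).mono ?_⟩
      rintro t' σ2 ⟨k1, k2, k3, k4, k5, k6, k7⟩
      refine ⟨by omega, fun i hi h6 h11 => ?_, fun i hi => ?_, .inl ⟨hlt, hyd', que ++ [y],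
        .inl ⟨hyq, rfl⟩, ?_, k2⟩⟩
      · rw [k3 i hi]; simp [gr i h11, h6]
      · rw [k4 i (by omega)]; simp [glr]
      · exact hl2.keep (k3 6 (by norm_num)) k5 k6 k7 (fun i hi => k3 i (by omega))
          (fun i hi => k4 i (by omega))
  · have hb1 : b = 0 := by rw [hb, if_neg hlt]
    simp [g11, hb1]
    exact ⟨by omega, fun i hi h6 h11 => gr i h11, fun i hi => by rw [glr], .inr ⟨fun h =>
      absurd h hlt, hl1, hi1⟩⟩

end DistOracle
end

/-! ### The loops of the search: scanning edges, expanding vertices, cleaning up -/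

noncomputable section
namespace DistOracle

variable {n : ℕ} {Λ : Layout n} {upd pop : Cmd} {g : ℕ}
  {inv : (ℕ → ℕ) → (Fin n → ℝ≥0) → List (Fin n) → Finset (Fin n) → ℝ≥0 → Prop}

/-- The invariant of the loop is `SInv` with `J x` equal to the edge counter; every edge not yet
scanned owns `g + 200` units of the budget. -/
theorem scanCmd_spec (hQ : IsQueue Λ upd pop g inv) {σ₀ σ : AS} {s x : Fin n}
    {que : List (Fin n)} {d : Fin n → ℝ≥0} {par : Fin n → Fin n} {idx dep J : Fin n → ℕ}
    {done : Finset (Fin n)} {D : ℝ≥0} {ρ : ℝ≥0∞}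
    (hρ : ∀ l : ℝ≥0, (l : ℝ≥0∞) < ρ ↔ σ₀.r 3 = 1 ∨ l < σ₀.lr 1) (h3 : σ₀.r 3 < 2)
    (hl : Linked σ₀ σ que d par idx) (hi : inv (σ.f 13) d que done D)
    (hS : SInv Λ.E.graph Λ.E.weight s ρ d que.toFinset done par idx dep J D) (hx : x ∈ done)
    (hxD : d x = D) (hJx : J x = 0) (hJ : ∀ z ∈ done, z ≠ x → J z = deg Λ.E.graph z)
    (h7 : σ.r 7 = x) (h8 : σ.r 8 = deg Λ.E.graph x) (h9 : σ.r 9 = 0) (h2 : σ.lr 2 = D) :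
    WP Λ (scanCmd upd) (fun t σ' => t ≤ (deg Λ.E.graph x + 1) * (g + 200) ∧
      σ'.r 5 = σ.r 5 ∧ ∃ que d par idx dep J, Linked σ₀ σ' que d par idx ∧
        inv (σ'.f 13) d que done D ∧
        SInv Λ.E.graph Λ.E.weight s ρ d que.toFinset done par idx dep J D ∧
        ∀ z ∈ done, J z = deg Λ.E.graph z) σ := by
  have hN := Λ.hN
  have hR := Λ.hR
  have hx2 := x.2
  have hdx := deg_lt Λ.E.graph x
  set I : ℕ → AS → Prop := fun T σ' => σ'.r 5 = σ.r 5 ∧ ∃ que d par idx dep J j,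
    Linked σ₀ σ' que d par idx ∧ inv (σ'.f 13) d que done D ∧
    SInv Λ.E.graph Λ.E.weight s ρ d que.toFinset done par idx dep J D ∧ d x = D ∧
    J x = j ∧ j ≤ deg Λ.E.graph x ∧ (∀ z ∈ done, z ≠ x → J z = deg Λ.E.graph z) ∧
    σ'.r 7 = x ∧ σ'.r 8 = deg Λ.E.graph x ∧ σ'.r 9 = j ∧ σ'.lr 2 = D ∧
    T = (deg Λ.E.graph x - j) * (g + 200) with hI
  have h0 : I (deg Λ.E.graph x * (g + 200)) σ :=
    ⟨rfl, que, d, par, idx, dep, J, 0, hl, hi, hS, hxD, hJx, Nat.zero_le _, hJ, h7, h8, h9, h2, rfl⟩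
  refine (WP_loop I h0 ?_).mono ?_
  · rintro T σ1 ⟨k5, que, d, par, idx, dep, J, j, hl, hi, hS, hxD, hJx, hj, hJ, k7, k8, k9, k2, rfl⟩
    refine ⟨by simp, fun hlt => ?_⟩
    simp only [Cnd.holds, Ex.ev, k8, k9] at hlt
    obtain ⟨y, hy⟩ : ∃ y, (adjList Λ.E.graph x)[j]? = some y := by
      rw [← adjList_length] at hlt
      exact ⟨_, List.getElem?_eq_getElem hlt⟩
    have hdone : ∀ v ∈ done, v ∈ que := fun v hv => List.mem_toFinset.1 (hS.sub hv)
    have hyd : y ∈ done → d y ≤ d x + Λ.E.weight s(x, y) := fun h =>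
      (hS.low y h).trans (hxD ▸ le_self_add)
    set σ2 := (((σ1.setr 10 y).setl 3 (Λ.E.weight s(x, y))).setl 3 (D + Λ.E.weight s(x, y)))
      with hσ2
    have hl2 : Linked σ₀ σ2 que d par idx := hl.keep rfl (fun _ _ => rfl) rfl rfl
      (fun i hi => by simp [hσ2, show i ≠ 10 by omega])
      (fun i hi => by simp [hσ2, show i ≠ 3 by omega])
    simp [k7, k9, nbrN_val _ hy, wtN_val _ _ hy, lt_deg hy, k2]
    refine (relaxCmd_spec hQ (x := x) (y := y) (j := j) (ld := d x + Λ.E.weight s(x, y)) hl2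
      (by simpa [hσ2] using hi) hdone hρ h3 (by simp [hσ2]) (by simpa [hσ2] using k7)
      (by simpa [hσ2] using k9) (by simp [hσ2, hxD]) (.inr ⟨_, by rw [hxD]⟩) hyd).mono ?_
    rintro t σ3 ⟨ht, fr, fl, hcase⟩
    have r9 : σ3.r 9 = j := by rw [fr 9 (by norm_num) (by norm_num) (by norm_num)]; simpa [hσ2] using k9
    have r7 : σ3.r 7 = x := by rw [fr 7 (by norm_num) (by norm_num) (by norm_num)]; simpa [hσ2] using k7
    have r8 : σ3.r 8 = deg Λ.E.graph x := by
      rw [fr 8 (by norm_num) (by norm_num) (by norm_num)]; simpa [hσ2] using k8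
    have r5 : σ3.r 5 = σ.r 5 := by
      rw [fr 5 (by norm_num) (by norm_num) (by norm_num)]; simpa [hσ2] using k5
    have l2 : σ3.lr 2 = D := by rw [fl 2 (by norm_num)]; simpa [hσ2] using k2
    rw [r9]
    refine ⟨by omega, (deg Λ.E.graph x - (j + 1)) * (g + 200), ?_, by simpa using r5, ?_⟩
    · obtain ⟨m, hm⟩ := Nat.exists_eq_add_of_lt hlt
      rw [hm, show j + m + 1 - j = m + 1 by omega, show j + m + 1 - (j + 1) = m by omega]
      have : (m + 1) * (g + 200) = m * (g + 200) + (g + 200) := by ring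
      omega
    · have hlast : ∀ (que : List (Fin n)) d par idx, Linked σ₀ σ3 que d par idx →
          Linked σ₀ (σ3.setr 9 (j + 1)) que d par idx := fun que d par idx h =>
        h.keep rfl (fun _ _ => rfl) rfl rfl (fun i hi => by simp [show i ≠ 9 by omega])
          (fun _ _ => rfl)
      rcases hcase with ⟨c1, c2, que', c3, c4, c5⟩ | ⟨c1, c2, c3⟩
      · have hys : y ∉ que.toFinset ∨ d x + Λ.E.weight s(x, y) < d y := by
          rcases c3 with c3 | c3
          · exact .inl (by simpa using c3.1)
          · exact .inr c3.2.2
        have hS' := hS.relax hx hxD hJx hy c1 c2 hys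
        have hq' : insert y que.toFinset = que'.toFinset := by
          rcases c3 with ⟨_, rfl⟩ | ⟨c3, rfl, _⟩
          · ext z; simp [or_comm]
          · exact Finset.insert_eq_of_mem (by simpa using c3)
        rw [hq'] at hS'
        have hne : x ≠ y := by rintro rfl; exact c2 hx
        refine ⟨que', _, _, _, _, _, j + 1, hlast _ _ _ _ c4, c5, hS', ?_, by simp, hlt, ?_,
          by simpa using r7, by simpa using r8, by simp, by simpa using l2, rfl⟩
        · rw [Function.update_of_ne hne, hxD]
        · intro z hz hzx
          rw [Function.update_of_ne hzx]
          exact hJ z hz hzx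
      · have hS' := hS.skip hJx hy (fun h => by simpa using c1 h)
        refine ⟨que, _, _, _, _, _, j + 1, hlast _ _ _ _ c2, c3, hS', hxD, by simp, hlt, ?_,
          by simpa using r7, by simpa using r8, by simp, by simpa using l2, rfl⟩
        intro z hz hzx
        rw [Function.update_of_ne hzx]
        exact hJ z hz hzx
  · rintro t σ1 ⟨hn, T', ⟨k5, que, d, par, idx, dep, J, j, hl, hi, hS, hxD, hJx, hj, hJ, k7, k8, k9,
      k2, rfl⟩, ht⟩
    simp only [Cnd.holds, Ex.ev, k8, k9] at hn
    refine ⟨?_, k5, que, d, par, idx, dep, J, hl, hi, hS, fun z hz => ?_⟩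
    · have : (deg Λ.E.graph x + 1) * (g + 200) = deg Λ.E.graph x * (g + 200) + (g + 200) := by ring
      simp only [Cnd.cost, Ex.cost] at ht
      omega
    · by_cases hzx : z = x
      · subst hzx; omega
      · exact hJ z hz hzx

-- Every vertex within the radius that is not yet expanded holds a credit proportional to its degree
-- plus one, which pays for its expansion. Popped vertices lie within the radius since their
-- tentative distances, upper bounds for the true ones, do.
open Classical in
theorem exploreCmd_spec (hQ : IsQueue Λ upd pop g inv) {σ₀ σ : AS} {s : Fin n}
    {que : List (Fin n)} {d : Fin n → ℝ≥0} {par : Fin n → Fin n} {idx dep J : Fin n → ℕ}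
    {D : ℝ≥0} {ρ : ℝ≥0∞}
    (hρ : ∀ l : ℝ≥0, (l : ℝ≥0∞) < ρ ↔ σ₀.r 3 = 1 ∨ l < σ₀.lr 1) (h3 : σ₀.r 3 < 2)
    (hl : Linked σ₀ σ que d par idx) (hi : inv (σ.f 13) d que ∅ D)
    (hS : SInv Λ.E.graph Λ.E.weight s ρ d que.toFinset ∅ par idx dep J D) (h5 : σ.r 5 = 0) :
    WP Λ (exploreCmd upd pop) (fun t σ' =>
      t ≤ (∑ v with wdist Λ.E.graph Λ.E.weight s v < ρ,
        (deg Λ.E.graph v + 1)) * (2 * g + 300) + 3 ∧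
      ∃ que d par idx dep J D, Linked σ₀ σ' que d par idx ∧
        inv (σ'.f 13) d que que.toFinset D ∧
        SInv Λ.E.graph Λ.E.weight s ρ d que.toFinset que.toFinset par idx dep J D ∧
        ∀ z ∈ que.toFinset, J z = deg Λ.E.graph z) σ := by
  have hR := Λ.hR
  set G := Λ.E.graph with hG
  set B : Finset (Fin n) := Finset.univ.filter fun v => wdist G Λ.E.weight s v < ρ with hB
  set I : ℕ → AS → Prop := fun T σ' => ∃ que d par idx dep J D done,
    Linked σ₀ σ' que d par idx ∧ inv (σ'.f 13) d que done D ∧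
    SInv G Λ.E.weight s ρ d que.toFinset done par idx dep J D ∧
    (∀ z ∈ done, J z = deg G z) ∧ σ'.r 5 = done.card ∧
    T = (∑ v ∈ B \ done, (deg G v + 1)) * (2 * g + 300) with hI
  have h0 : I ((∑ v ∈ B, (deg G v + 1)) * (2 * g + 300)) σ :=
    ⟨que, d, par, idx, dep, J, D, ∅, hl, hi, hS, by simp, by simpa using h5, by simp⟩
  refine (WP_loop I h0 ?_).mono ?_
  · rintro T σ1 ⟨que, d, par, idx, dep, J, D, done, hl, hi, hS, hJ, k5, rfl⟩
    refine ⟨by simp, fun hlt => ?_⟩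
    simp only [Cnd.holds, Ex.ev, k5, hl.r6] at hlt
    have hdone : ∀ v ∈ done, v ∈ que := fun v hv => List.mem_toFinset.1 (hS.sub hv)
    rw [WP_seq]
    refine (hQ.pop_spec σ1 d que done D hi hl.nodup hdone hlt k5 hl.f11 hl.lm).mono ?_
    rintro t1 σ2 ⟨ht1, x, hxq, hxd, hmin, k7, k5', hi2, fr, fl, ff, flm, fout⟩
    have hl2 : Linked σ₀ σ2 que d par idx := hl.keep
      (fr 6 (by norm_num) (by norm_num) (by norm_num)) ff flm fout
      (fun i hi => fr i (by omega) (by omega) (by omega)) (fun i hi => fl i (by omega))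
    have hS2 := hS.pop (x := x) (by simpa using hxq) hxd
      (fun y hy hyd => hmin y (by simpa using hy) hyd)
    set σ3 := ((σ2.setl 2 (d x)).setr 8 (deg G x)).setr 9 0 with hσ3
    have hx2 := x.2
    simp [k7, hl2.lm]
    have hl3 : Linked σ₀ σ3 que d par idx := hl2.keep (by simp [hσ3]) (fun _ _ => rfl) rfl rfl
      (fun i hi => by simp [hσ3, show i ≠ 8 by omega, show i ≠ 9 by omega])
      (fun i hi => by simp [hσ3, show i ≠ 2 by omega])
    refine (scanCmd_spec hQ (x := x) hρ h3 hl3 (by simpa [hσ3] using hi2) hS2 (by simp) rfl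
      (by simp) ?_ (by simpa [hσ3] using k7) (by simp [hσ3, hG]) (by simp [hσ3])
      (by simp [hσ3])).mono ?_
    · intro z hz hzx
      rw [Function.update_of_ne hzx]
      exact hJ z (by simpa [hzx] using hz)
    · rintro t2 σ4 ⟨ht2, j5, que', d', par', idx', dep', J', hl4, hi4, hS4, hJ4⟩
      have hxB : x ∈ B \ done := by
        simp only [hB, Finset.mem_sdiff, Finset.mem_filter, Finset.mem_univ, true_and]
        exact ⟨(hS.wdist_le x (by simpa using hxq)).trans_lt (hS.lt x (by simpa using hxq)), hxd⟩
      refine ⟨(∑ v ∈ B \ insert x done, (deg G v + 1)) * (2 * g + 300), ?_, que', d', par',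
        idx', dep', J', d x, insert x done, hl4, hi4, hS4, hJ4, ?_, rfl⟩
      · rw [Finset.sdiff_insert, ← Finset.add_sum_erase _ _ hxB, add_mul]
        have : (deg G x + 1) * (2 * g + 300) =
          (deg G x + 1) * (g + 200) + deg G x * (g + 100) + (g + 100) := by ring
        have h00 : 0 ≤ deg G x * (g + 100) := Nat.zero_le _
        rw [← hG] at ht2
        omega
      · rw [j5, Finset.card_insert_of_notMem hxd]
        simpa [hσ3] using k5'
  · rintro t σ1 ⟨hn, T', ⟨que, d, par, idx, dep, J, D, done, hl, hi, hS, hJ, k5, rfl⟩, ht⟩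
    simp only [Cnd.holds, Ex.ev, k5, hl.r6] at hn
    -- The head of the queue has reached its end, so the expanded vertices are as numerous as the
    -- seen ones.
    have hdone : done = que.toFinset := by
      refine Finset.eq_of_subset_of_card_le hS.sub ?_
      rw [List.toFinset_card_of_nodup hl.nodup]
      omega
    subst hdone
    simp only [Cnd.cost, Ex.cost] at ht
    exact ⟨by omega, que, d, par, idx, dep, J, D, hl, hi, hS, hJ⟩

/-- The outcome of a search from `s` with radius `ρ`. -/
structure Found (Λ : Layout n) (s : Fin n) (ρ : ℝ≥0∞) (que : List (Fin n)) (d : Fin n → ℝ≥0)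
    (par : Fin n → Fin n) (idx dep : Fin n → ℕ) : Prop where
  mem : ∀ v, v ∈ que ↔ wdist Λ.E.graph Λ.E.weight s v < ρ
  dist : ∀ v ∈ que, (d v : ℝ≥0∞) = wdist Λ.E.graph Λ.E.weight s v
  root : par s = s ∧ d s = 0
  tree : ∀ v ∈ que, v ≠ s → par v ∈ que ∧ (adjList Λ.E.graph (par v))[idx v]? = some v ∧
    d v = d (par v) + Λ.E.weight s(par v, v) ∧ dep (par v) < dep v

-- The source is entered by relaxing a fictitious edge of length zero from `s` to itself. If the
-- radius is zero, this is rejected, and correctly nothing is found.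
open Classical in
theorem startCmd_exploreCmd_spec (hQ : IsQueue Λ upd pop g inv) {σ₀ : AS} {s : Fin n} {ρ : ℝ≥0∞}
    (hρ : ∀ l : ℝ≥0, (l : ℝ≥0∞) < ρ ↔ σ₀.r 3 = 1 ∨ l < σ₀.lr 1) (h3 : σ₀.r 3 < 2)
    (h2 : σ₀.r 2 = s) (h8 : σ₀.f 8 = fun _ => 0) (h9 : σ₀.f 9 = fun _ => 0)
    (h10 : σ₀.f 10 = fun _ => 0) (h11 : σ₀.f 11 = fun _ => 0) (h13 : σ₀.f 13 = fun _ => 0)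
    (hlm : σ₀.lm = fun _ => 0) :
    WP Λ (.seq (startCmd upd) (exploreCmd upd pop)) (fun t σ' =>
      t ≤ (∑ v with wdist Λ.E.graph Λ.E.weight s v < ρ,
        (deg Λ.E.graph v + 1)) * (2 * g + 300) + g + 200 ∧ σ'.f 13 = (fun _ => 0) ∧
      ∃ que d par idx dep, Linked σ₀ σ' que d par idx ∧ Found Λ s ρ que d par idx dep) σ₀ := by
  set σ1 := (((((((σ₀.setr 5 0).setr 6 0).setr 7 s).setr 10 s).setr 9 0).setl 3 0)) with hσ1
  have hl1 : Linked σ₀ σ1 [] (fun _ => 0) (fun _ => s) (fun _ => 0) := by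
    refine ⟨by simp, by simp [hσ1], by simp [hσ1, h11], by simp [hσ1, h8], by simp, by simp,
      by simp [hσ1, hlm], by simp [hσ1, h9, h10, hlm], fun _ _ _ _ _ _ => rfl, rfl, ?_, ?_⟩
    · intro i hi
      simp [hσ1, show i ≠ 5 by omega, show i ≠ 6 by omega, show i ≠ 7 by omega,
        show i ≠ 9 by omega, show i ≠ 10 by omega]
    · intro i hi
      simp [hσ1, show i ≠ 3 by omega]
  have hi1 : inv (σ1.f 13) (fun _ => 0) [] ∅ 0 := by
    have := hQ.init
    rw [← h13] at this
    exact this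
  rw [WP_seq, startCmd]
  simp [h2]
  refine (relaxCmd_spec hQ (x := s) (y := s) (j := 0) (ld := 0) hl1 hi1 (by simp) hρ h3
    (by simp [hσ1]) (by simp [hσ1]) (by simp [hσ1]) (by simp [hσ1]) (.inl ⟨rfl, rfl⟩)
    (by simp)).mono ?_
  rintro t σ2 ⟨ht, fr, fl, hcase⟩
  have k5 : σ2.r 5 = 0 := by rw [fr 5 (by norm_num) (by norm_num) (by norm_num)]; simp [hσ1]
  rcases hcase with ⟨c1, -, que', c3, c4, c5⟩ | ⟨c1, c2, c3⟩
  · obtain rfl : que' = [s] := by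
      rcases c3 with c3 | c3
      · exact c3.2
      · simp at c3
    have hS := SInv.init (G := Λ.E.graph) (w := Λ.E.weight) (s := s) (ρ := ρ) (by simpa using c1)
    -- For the source, the updates write the values that are there already.
    simp only [Function.update_eq_self_iff.2 rfl] at c4 c5
    refine (exploreCmd_spec hQ hρ h3 c4 c5 (by simpa using hS) k5).mono ?_
    rintro t' σ3 ⟨ht', que, d, par, idx, dep, J, D, hl, hi, hS, hJ⟩
    have hc := hS.complete rfl hJ
    refine ⟨by omega, hQ.final _ _ _ _ _ hi (by simp), que, d, par, idx, hl, dep, ?_, ?_, ?_, ?_⟩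
    · exact fun v => by simpa using (hc v).1
    · exact fun v hv => (hc v).2 (by simpa using hv)
    · exact hS.root.2
    · exact fun v hv hvs => by simpa using hS.tree v (by simpa using hv) hvs
  · have hρ0 : ρ = 0 := by
      by_contra h
      exact absurd (c1 (by simpa [pos_iff_ne_zero] using h)).1 (by simp)
    rw [exploreCmd, WP_loop_unfold]
    simp [k5, c2.r6]
    refine ⟨by omega, hQ.final _ _ _ _ _ c3 (by simp), [], _, _, _, c2, fun _ => 0, ?_, ?_, ?_, ?_⟩
    · simp [hρ0]
    · simp
    · simp
    · simp

/-- Field 11 lists all vertices whose entries were touched, so resetting costs time proportional to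
their number and not to `n`. -/
theorem cleanCmd_spec {σ₀ σ : AS} {que : List (Fin n)} {d : Fin n → ℝ≥0} {par : Fin n → Fin n}
    {idx : Fin n → ℕ} (hl : Linked σ₀ σ que d par idx) (h13 : σ.f 13 = σ₀.f 13)
    (h8 : σ₀.f 8 = fun _ => 0) (h9 : σ₀.f 9 = fun _ => 0)
    (h10 : σ₀.f 10 = fun _ => 0) (h11 : σ₀.f 11 = fun _ => 0) (hlm : σ₀.lm = fun _ => 0) :
    WP Λ cleanCmd (fun t σ' => t ≤ 100 * (que.length + 1) ∧ σ'.f = σ₀.f ∧ σ'.lm = σ₀.lm ∧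
      σ'.out = σ.out ∧ (∀ i, (i < 4 ∨ i = 12) → σ'.r i = σ.r i) ∧ σ'.lr 0 = σ.lr 0) σ := by
  have hN := Λ.hN
  have hR := Λ.hR
  have hlen : que.length ≤ n := by simpa using hl.nodup.length_le_card
  rw [cleanCmd, WP_seq, WP_asg]
  refine ⟨by simp, ?_⟩
  set I : ℕ → AS → Prop := fun T σ' => ∃ k ≤ que.length, σ'.r 5 = k ∧ σ'.r 6 = que.length ∧
    T = (que.length - k) * 90 ∧ (∀ i, (i < 4 ∨ i = 12) → σ'.r i = σ.r i) ∧ σ'.lr 0 = σ.lr 0 ∧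
    σ'.out = σ.out ∧ (∀ i, σ'.f 11 i = if i < k then 0 else σ.f 11 i) ∧
    (∀ g, g ≠ 8 → g ≠ 9 → g ≠ 10 → g ≠ 11 → σ'.f g = σ₀.f g) ∧
    (∀ i, i ∉ (que.drop k).map Fin.val → σ'.f 8 i = 0 ∧ σ'.f 9 i = 0 ∧ σ'.f 10 i = 0 ∧
      σ'.lm i = 0) with hI
  have h0 : I (que.length * 90) (σ.setr 5 0) := by
    refine ⟨0, Nat.zero_le _, by simp, by simp [hl.r6], by simp, fun i hi => ?_, rfl, rfl, ?_, ?_, ?_⟩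
    · simp [show i ≠ 5 by omega]
    · simp
    · intro g g8 g9 g10 g11
      by_cases hg : g = 13
      · subst hg; exact h13
      · exact hl.rest g g8 g9 g10 g11 hg
    · intro i hi
      rw [List.drop_zero] at hi
      have := hl.out_que i hi
      refine ⟨?_, this.1, this.2.1, this.2.2⟩
      have := hl.f8 i
      rwa [if_neg hi] at this
  refine (WP_loop I h0 ?_).mono ?_
  · rintro T σ1 ⟨k, hk, k5, k6, rfl, kr, kl, kout, k11, krest, kout'⟩
    refine ⟨by simp, fun hlt => ?_⟩
    simp only [Cnd.holds, Ex.ev, k5, k6] at hlt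
    have e11 : σ1.f 11 k = (que[k] : Fin n) := by
      rw [k11, if_neg (lt_irrefl _), hl.f11]; simp [hlt]
    have hv := (que[k] : Fin n).2
    simp [k5, e11]
    refine ⟨by omega, by omega, by omega, (que.length - (k + 1)) * 90, by omega, k + 1,
      hlt, by simp, by simpa using k6, rfl, ?_, ?_, by simpa using kout, ?_, ?_, ?_⟩
    · intro i hi; simp [kr i hi, show i ≠ 5 by omega, show i ≠ 10 by omega]
    · simpa using kl
    · intro i
      simp only [AS.setr_f, AS.setm_f, AS.setl_f, AS.setf_f]
      simp [Function.update_apply, k11]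
      split_ifs <;> first | rfl | omega
    · intro g g8 g9 g10 g11
      simp [g8, g9, g10, g11, krest g g8 g9 g10 g11]
    · intro i hi
      simp only [AS.setr_f, AS.setm_f, AS.setl_f, AS.setf_f, AS.setr_lm, AS.setm_lm, AS.setl_lm,
        AS.setf_lm]
      by_cases hik : i = (que[k] : Fin n)
      · subst hik; simp
      · have hnot : i ∉ (que.drop k).map Fin.val := by
          rw [List.drop_eq_getElem_cons hlt]
          simp only [List.map_cons, List.mem_cons, not_or]
          exact ⟨hik, hi⟩
        simp [hik, kout' i hnot]
  · rintro t σ1 ⟨hn, T', ⟨k, hk, k5, k6, rfl, kr, kl, kout, k11, krest, kout'⟩, ht⟩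
    simp only [Cnd.holds, Ex.ev, k5, k6] at hn
    obtain rfl : k = que.length := by omega
    simp only [Cnd.cost, Ex.cost] at ht ⊢
    rw [List.drop_length] at kout'
    refine ⟨by omega, ?_, ?_, kout, kr, kl⟩
    · funext g
      by_cases g8 : g = 8
      · subst g8; rw [h8]; funext i; exact (kout' i (by simp)).1
      by_cases g9 : g = 9
      · subst g9; rw [h9]; funext i; exact (kout' i (by simp)).2.1
      by_cases g10 : g = 10
      · subst g10; rw [h10]; funext i; exact (kout' i (by simp)).2.2.1
      by_cases g11 : g = 11
      · subst g11; rw [h11]; funext i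
        rw [k11, hl.f11]
        split_ifs with h
        · rfl
        · rw [List.getD_eq_getElem?_getD, List.getElem?_eq_none (by simpa using h)]; rfl
      exact krest g g8 g9 g10 g11
    · rw [hlm]; funext i; exact (kout' i (by simp)).2.2.2

end DistOracle
end

noncomputable section
namespace DistOracle

/-! ## The two priority queues -/

variable {n : ℕ} {Λ : Layout n}

/-- In an unweighted graph, the vertices are expanded in the order in which they are found. -/
def fifoPop : Cmd := .seq (.asg 7 (.fld 11 (.v 5))) (.asg 5 (.add (.v 5) (.c 1)))

/-- The familiar picture of breadth-first search: the expanded vertices form a prefix of a sorted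
list, whose remainder has distances between `D` and `D + 1`. The last clause is for the insertion of
the source. The work space `tr` is not used and remains zero. -/
def FifoInv (tr : ℕ → ℕ) (d : Fin n → ℝ≥0) (que : List (Fin n)) (done : Finset (Fin n))
    (D : ℝ≥0) : Prop :=
  tr = (fun _ => 0) ∧ done.card ≤ que.length ∧ done = (que.take done.card).toFinset ∧
    que.Pairwise (fun a b => d a ≤ d b) ∧ (∀ v ∈ que, d v ≤ D + 1) ∧
    (∀ v ∈ que, v ∉ done → D ≤ d v) ∧ (que = [] → D = 0)

/-- A new tentative distance is `D + 1`, or zero for the source, hence at least every distance in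
the list: appending keeps the list sorted, and an improvement of a known vertex is impossible. -/
theorem fifo_isQueue (hw : ∀ e, Λ.E.weight e = 1) : IsQueue Λ .skip fifoPop 30 FifoInv where
  init := ⟨rfl, by simp, by simp, by simp, by simp, by simp, by simp⟩
  upd_spec := by
    rintro σ d que que' done D ld y ⟨h1, h2, h3, h4, h5, h6, h7⟩ hyd hdone hque hld hlm h10
    have hD : ld ≤ D + 1 ∧ D ≤ ld ∧ ∀ v ∈ que, d v ≤ ld := by
      rcases hld with ⟨rfl, rfl⟩ | ⟨e, rfl⟩
      · simp [h7 rfl]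
      · rw [hw]
        exact ⟨le_rfl, le_self_add, h5⟩
    rcases hque with ⟨hy, rfl⟩ | ⟨hy, rfl, hlt⟩
    · rw [WP_skip]
      have hne : ∀ v ∈ que, v ≠ y := fun v hv => by rintro rfl; exact hy hv
      refine ⟨by norm_num, ⟨h1, ?_, ?_, ?_, ?_, ?_, by simp⟩, fun _ _ => rfl, fun _ _ => rfl,
        fun _ _ => rfl, rfl, rfl⟩
      · simp; omega
      · rw [List.take_append_of_le_length h2]
        exact h3
      · rw [List.pairwise_append]
        refine ⟨h4.imp_of_mem fun {a b} ha hb h => ?_, by simp, fun a ha b hb => ?_⟩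
        · rwa [Function.update_of_ne (hne a ha), Function.update_of_ne (hne b hb)]
        · rw [List.mem_singleton] at hb
          subst hb
          rw [Function.update_self, Function.update_of_ne (hne a ha)]
          exact hD.2.2 a ha
      · intro v hv
        by_cases hvy : v = y
        · subst hvy; rw [Function.update_self]; exact hD.1
        · rw [Function.update_of_ne hvy]
          exact h5 v (by simpa [hvy] using hv)
      · intro v hv hvd
        by_cases hvy : v = y
        · subst hvy; rw [Function.update_self]; exact hD.2.1
        · rw [Function.update_of_ne hvy]
          exact h6 v (by simpa [hvy] using hv) hvd
    · exact absurd (hD.2.2 y hy) (not_le.2 hlt)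
  pop_spec := by
    rintro σ d que done D ⟨h1, h2, h3, h4, h5, h6, h7⟩ hnd hdone hlt k5 k11 klm
    have hlen : que.length ≤ n := by simpa using hnd.length_le_card
    have hR := Λ.hR
    have hN := Λ.hN
    set k := done.card with hk
    have e11 : σ.f 11 k = (que[k] : Fin n) := by
      rw [k11]; simp [hlt]
    have hxd : que[k] ∉ done := by
      rw [h3, List.mem_toFinset, List.mem_take_iff_getElem]
      rintro ⟨i, hi, he⟩
      have := (hnd.getElem_inj_iff (hi := by omega) (hj := hlt)).1 he
      omega
    have hmin : ∀ y ∈ que, y ∉ done → d que[k] ≤ d y := by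
      intro y hy hyd
      obtain ⟨i, hi, rfl⟩ := List.getElem_of_mem hy
      rcases lt_trichotomy k i with h | h | h
      · exact List.pairwise_iff_getElem.1 h4 _ _ _ _ h
      · subst h; exact le_rfl
      · refine absurd ?_ hyd
        rw [h3, List.mem_toFinset, List.mem_take_iff_getElem]
        exact ⟨i, by omega, rfl⟩
    rw [fifoPop]
    simp [k5, e11]
    refine ⟨by omega, by omega, que[k], List.getElem_mem _, hxd, hmin, rfl, ?_, ?_⟩
    · refine ⟨h1, ?_, ?_, h4, ?_, ?_, ?_⟩
      · rw [Finset.card_insert_of_notMem hxd]; exact hlt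
      · rw [Finset.card_insert_of_notMem hxd, ← hk, ← List.take_concat_get' _ _ hlt]
        rw [List.toFinset_append, ← h3]
        ext z; simp [or_comm]
      · intro v hv
        refine (h5 v hv).trans ?_
        gcongr
        exact h6 _ (List.getElem_mem _) hxd
      · intro v hv hvd
        exact hmin v hv (fun h => hvd (Finset.mem_insert_of_mem h))
      · intro h; subst h; simp at hlt
    · intro i _ i5 i7
      simp [i5, i7]
  final := fun t d que done D h _ => h.1

/-- The better of two entries of the tournament tree: `0` stands for no vertex and `v + 1` for
the vertex `v`. -/
def better (dn : ℕ → ℝ≥0) (a b : ℕ) : ℕ :=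
  if b = 0 then a else if a = 0 then b else if dn (b - 1) < dn (a - 1) then b else a

lemma better_eq (dn : ℕ → ℝ≥0) (a b : ℕ) : better dn a b = a ∨ better dn a b = b := by
  unfold better; split_ifs <;> simp

lemma better_left (dn : ℕ → ℝ≥0) {a : ℕ} (b : ℕ) (ha : a ≠ 0) :
    better dn a b ≠ 0 ∧ dn (better dn a b - 1) ≤ dn (a - 1) := by
  unfold better; split_ifs with h1 h2
  · exact ⟨ha, le_rfl⟩
  · exact ⟨h1, h2.le⟩
  · exact ⟨ha, le_rfl⟩

lemma better_right (dn : ℕ → ℝ≥0) (a : ℕ) {b : ℕ} (hb : b ≠ 0) :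
    better dn a b ≠ 0 ∧ dn (better dn a b - 1) ≤ dn (b - 1) := by
  unfold better; rw [if_neg hb]; split_ifs with h1 h2
  · exact ⟨hb, le_rfl⟩
  · exact ⟨hb, le_rfl⟩
  · exact ⟨h1, not_lt.1 h2⟩

lemma better_congr {dn dn' : ℕ → ℝ≥0} {a b : ℕ} (ha : a ≠ 0 → dn (a - 1) = dn' (a - 1))
    (hb : b ≠ 0 → dn (b - 1) = dn' (b - 1)) : better dn a b = better dn' a b := by
  unfold better
  by_cases h1 : b = 0
  · simp [h1]
  · by_cases h2 : a = 0
    · simp [h2]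
    · rw [ha h2, hb h1]

/-- Recompute the entries on the way from the node in register 20 to the root. -/
def climbCmd : Cmd :=
  .loop (.lt (.c 1) (.v 20))
    (.seq (.asg 20 (.div (.v 20) (.c 2)))
    (.seq (.asg 21 (.fld 13 (.add (.v 20) (.v 20))))
    (.seq (.asg 22 (.fld 13 (.add (.add (.v 20) (.v 20)) (.c 1))))
    (.seq (.ite (.eq (.v 22) (.c 0)) .skip
      (.ite (.eq (.v 21) (.c 0)) (.asg 21 (.v 22))
        (.seq (.lload 6 (.sub (.v 22) (.c 1)))
        (.seq (.lload 7 (.sub (.v 21) (.c 1)))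
        (.ite (.llt 6 7) (.asg 21 (.v 22)) .skip)))))
      (.setf 13 (.v 20) (.v 21))))))

def treeUpd : Cmd :=
  .seq (.asg 20 (.add .size (.v 10)))
  (.seq (.setf 13 (.v 20) (.add (.v 10) (.c 1))) climbCmd)

def treePop : Cmd :=
  .seq (.asg 7 (.sub (.fld 13 (.c 1)) (.c 1)))
  (.seq (.asg 5 (.add (.v 5) (.c 1)))
  (.seq (.asg 20 (.add .size (.v 7)))
  (.seq (.setf 13 (.v 20) (.c 0)) climbCmd)))

/-- The node `i` is `c` or lies above `c` in the tree. -/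
def Above (c i : ℕ) : Prop := ∃ k, i = c / 2 ^ k

lemma above_self (c : ℕ) : Above c c := ⟨0, by simp⟩

lemma Above.half {c i : ℕ} (h : Above c i) : Above (c / 2) (i / 2) := by
  obtain ⟨k, rfl⟩ := h
  exact ⟨k, by rw [Nat.div_div_eq_div_mul, Nat.div_div_eq_div_mul, mul_comm]⟩

lemma above_iff {c i : ℕ} : Above c i ↔ i = c ∨ Above (c / 2) i := by
  constructor
  · rintro ⟨k, rfl⟩
    cases k with
    | zero => simp
    | succ k => exact .inr ⟨k, by rw [Nat.div_div_eq_div_mul, pow_succ, mul_comm]⟩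
  · rintro (rfl | ⟨k, rfl⟩)
    · exact above_self _
    · exact ⟨k + 1, by rw [Nat.div_div_eq_div_mul, pow_succ, mul_comm]⟩

/-- The tree may be wrong only at `c / 2` and above. Recomputing the entry at `c / 2` leaves
possible errors only strictly above it, and at the root none is left; halving `c` gives the
logarithm. -/
lemma climbCmd_spec (hR : 2 * n ≤ Λ.R) : ∀ (c : ℕ) (σ : AS), 1 ≤ c → c < 2 * n → σ.r 20 = c →
    (∀ i, σ.f 13 i ≤ n) →
    (∀ i, 1 ≤ i → i < n → ¬ Above (c / 2) i →
      σ.f 13 i = better σ.lm (σ.f 13 (2 * i)) (σ.f 13 (2 * i + 1))) →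
    WP Λ climbCmd (fun t σ' => t ≤ 100 * (Nat.log 2 c + 1) ∧ (∀ i, σ'.f 13 i ≤ n) ∧
      (∀ i, 1 ≤ i → i < n →
        σ'.f 13 i = better σ.lm (σ'.f 13 (2 * i)) (σ'.f 13 (2 * i + 1))) ∧
      σ'.f 13 0 = σ.f 13 0 ∧ (∀ i, n ≤ i → σ'.f 13 i = σ.f 13 i) ∧
      (∀ i < 20, σ'.r i = σ.r i) ∧ (∀ i < 6, σ'.lr i = σ.lr i) ∧ (∀ g ≠ 13, σ'.f g = σ.f g) ∧
      σ'.lm = σ.lm ∧ σ'.out = σ.out) σ := by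
  intro c
  induction c using Nat.strong_induction_on with
  | _ c ih =>
    intro σ h1 h2 h20 hle hcon
    have hN := Λ.hN
    rw [climbCmd, WP_loop_unfold]
    refine ⟨by simp, fun hc => ?_, fun hc => ?_⟩
    · simp only [Cnd.holds, Ex.ev, h20] at hc
      set c' := c / 2 with hc'
      have hc1 : 1 ≤ c' := by omega
      have hcn : c' < n := by omega
      set m := better σ.lm (σ.f 13 (2 * c')) (σ.f 13 (2 * c' + 1)) with hm
      have key : ∀ σ1 : AS, σ1.r 20 = c' → σ1.f 13 = Function.update (σ.f 13) c' m →
          (∀ i < 20, σ1.r i = σ.r i) → (∀ i < 6, σ1.lr i = σ.lr i) →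
          (∀ g ≠ 13, σ1.f g = σ.f g) → σ1.lm = σ.lm → σ1.out = σ.out →
          WP Λ climbCmd (fun t σ' => t + 98 ≤ 100 * (Nat.log 2 c + 1) ∧
            (∀ i, σ'.f 13 i ≤ n) ∧
            (∀ i, 1 ≤ i → i < n →
              σ'.f 13 i = better σ.lm (σ'.f 13 (2 * i)) (σ'.f 13 (2 * i + 1))) ∧
            σ'.f 13 0 = σ.f 13 0 ∧ (∀ i, n ≤ i → σ'.f 13 i = σ.f 13 i) ∧
            (∀ i < 20, σ'.r i = σ.r i) ∧ (∀ i < 6, σ'.lr i = σ.lr i) ∧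
            (∀ g ≠ 13, σ'.f g = σ.f g) ∧ σ'.lm = σ.lm ∧ σ'.out = σ.out) σ1 := by
        intro σ1 k20 k13 kr kl kf klm kout
        refine (ih c' (by omega) σ1 hc1 (by omega) k20 ?_ ?_).mono ?_
        · intro i
          rw [k13, Function.update_apply]
          split_ifs
          · rcases better_eq σ.lm (σ.f 13 (2 * c')) (σ.f 13 (2 * c' + 1)) with h | h
            · rw [hm, h]; exact hle _
            · rw [hm, h]; exact hle _
          · exact hle i
        · intro i hi hin hA
          have e1 : 2 * i ≠ c' := by
            rintro h
            exact hA (by rw [← h, Nat.mul_div_cancel_left _ (by norm_num)]; exact above_self _)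
          have e2 : 2 * i + 1 ≠ c' := by
            rintro h
            exact hA (by rw [← h, show (2 * i + 1) / 2 = i by omega]; exact above_self _)
          rw [k13, klm, Function.update_of_ne e1, Function.update_of_ne e2]
          by_cases hic : i = c'
          · subst hic; rw [Function.update_self]
          · rw [Function.update_of_ne hic]
            exact hcon i hi hin (fun h => by
              rcases above_iff.1 h with h | h
              · exact hic h
              · exact hA h)
        · rintro t σ2 ⟨j1, j2, j3, j40, j4, j5, j6, j7, j8, j9⟩
          rw [klm] at j3
          refine ⟨?_, j2, j3, ?_, fun i hi => ?_, fun i hi => (j5 i hi).trans (kr i hi),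
            fun i hi => (j6 i hi).trans (kl i hi), fun g hg => (j7 g hg).trans (kf g hg),
            j8.trans klm, j9.trans kout⟩
          -- Each level climbed is paid for by one unit of the logarithm.
          · have : Nat.log 2 c = Nat.log 2 c' + 1 := by
              rw [hc', Nat.log_div_base]
              have : 0 < Nat.log 2 c := Nat.log_pos (by norm_num) (by omega)
              omega
            omega
          · rw [j40, k13, Function.update_of_ne (by omega)]
          · rw [j4 i hi, k13, Function.update_of_ne (by omega)]
      have b1 := hle (2 * c')
      have b2 := hle (2 * c' + 1)
      have e2c : c' + c' = 2 * c' := by ring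
      have hR1 : 2 * c' < Λ.R := by omega
      have hR2 : 2 * c' + 1 < Λ.R := by omega
      have hN1 : 2 * c' < Λ.N := by omega
      have hN2 : 2 * c' + 1 < Λ.N := by omega
      have hR0 : c' < Λ.R := by omega
      simp [h20, ← hc', e2c, hR1, hR2, hN1, hN2, hR0]
      refine ⟨fun h0 => ?_, fun h0 => ⟨fun h0' => ?_, fun h0' => ⟨by omega, by omega,
        fun hlt => ?_, fun hlt => ?_⟩⟩⟩
      · refine WP.mono (key _ (by simp) ?_ ?_ (by simp) ?_ rfl rfl)
          (fun t σ' h => ⟨by omega, h.2⟩)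
        · simp [hm, better, h0]
        · intro i hi; simp [show i ≠ 20 by omega, show i ≠ 21 by omega, show i ≠ 22 by omega]
        · intro g hg; simp [hg]
      · refine WP.mono (key _ (by simp) ?_ ?_ (by simp) ?_ rfl rfl)
          (fun t σ' h => ⟨by omega, h.2⟩)
        · simp [hm, better, h0, h0']
        · intro i hi; simp [show i ≠ 20 by omega, show i ≠ 21 by omega, show i ≠ 22 by omega]
        · intro g hg; simp [hg]
      · refine WP.mono (key _ (by simp) ?_ ?_ ?_ ?_ rfl rfl)
          (fun t σ' h => ⟨by omega, h.2⟩)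
        · simp [hm, better, h0, h0', hlt]
        · intro i hi; simp [show i ≠ 20 by omega, show i ≠ 21 by omega, show i ≠ 22 by omega]
        · intro i hi; simp [show i ≠ 6 by omega, show i ≠ 7 by omega]
        · intro g hg; simp [hg]
      · refine WP.mono (key _ (by simp) ?_ ?_ ?_ ?_ rfl rfl)
          (fun t σ' h => ⟨by omega, h.2⟩)
        · simp [hm, better, h0, h0', not_lt.2 hlt]
        · intro i hi; simp [show i ≠ 20 by omega, show i ≠ 21 by omega, show i ≠ 22 by omega]
        · intro i hi; simp [show i ≠ 6 by omega, show i ≠ 7 by omega]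
        · intro g hg; simp [hg]
    · simp only [Cnd.holds, Ex.ev, h20] at hc
      obtain rfl : c = 1 := by omega
      refine ⟨by simp, hle, fun i hi hin => hcon i hi hin ?_, rfl, fun _ _ => rfl, fun _ _ => rfl,
        fun _ _ => rfl, fun _ _ => rfl, rfl, rfl⟩
      -- Nothing but `0` lies above `1 / 2 = 0`, so all inner nodes are consistent.
      rintro ⟨k, hk⟩
      simp at hk
      omega

/-- Distances as a function of the names of the vertices. -/
def extend (d : Fin n → ℝ≥0) (i : ℕ) : ℝ≥0 := if h : i < n then d ⟨i, h⟩ else 0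

@[simp] lemma extend_val (d : Fin n → ℝ≥0) (v : Fin n) : extend d v = d v := by simp [extend]

/-- The invariant of the tournament tree. It does not depend on the current distance. -/
structure TreeInv (tr : ℕ → ℕ) (d : Fin n → ℝ≥0) (que : List (Fin n)) (done : Finset (Fin n))
    (_D : ℝ≥0) : Prop where
  leaf : ∀ v : Fin n, tr (n + v) = if v ∈ que ∧ v ∉ done then (v : ℕ) + 1 else 0
  inner : ∀ i, 1 ≤ i → i < n → tr i = better (extend d) (tr (2 * i)) (tr (2 * i + 1))
  outer : ∀ i, i = 0 ∨ 2 * n ≤ i → tr i = 0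
  le : ∀ i, tr i ≤ n

namespace TreeInv
variable {tr : ℕ → ℕ} {d : Fin n → ℝ≥0} {que : List (Fin n)} {done : Finset (Fin n)} {D : ℝ≥0}

/-- An entry is copied from one of the two children, so descending along equal entries ends in the
leaf of the vertex it names. In particular a vertex occurs only above its own leaf. -/
lemma valid (h : TreeInv tr d que done D) (c : ℕ) (hc : tr c ≠ 0) :
    ∃ v : Fin n, v ∈ que ∧ v ∉ done ∧ tr c = v + 1 ∧ Above (n + v) c := by
  suffices H : ∀ m c, 2 * n - c = m → tr c ≠ 0 →
      ∃ v : Fin n, v ∈ que ∧ v ∉ done ∧ tr c = v + 1 ∧ Above (n + v) c from H _ c rfl hc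
  intro m
  induction m using Nat.strong_induction_on with
  | _ m ih =>
    intro c hm hc
    have h0 : ¬ (c = 0 ∨ 2 * n ≤ c) := fun h0 => hc (h.outer c h0)
    rw [not_or] at h0
    by_cases hcn : c < n
    · have hin := h.inner c (by omega) hcn
      rcases better_eq (extend d) (tr (2 * c)) (tr (2 * c + 1)) with h' | h'
      · rw [h'] at hin
        obtain ⟨v, h1, h2, h3, h4⟩ := ih (2 * n - 2 * c) (by omega) (2 * c) rfl (hin ▸ hc)
        refine ⟨v, h1, h2, hin.trans h3, above_iff.2 (.inr ?_)⟩
        have := h4.half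
        rwa [Nat.mul_div_cancel_left _ (by norm_num)] at this
      · rw [h'] at hin
        obtain ⟨v, h1, h2, h3, h4⟩ := ih (2 * n - (2 * c + 1)) (by omega) (2 * c + 1) rfl (hin ▸ hc)
        refine ⟨v, h1, h2, hin.trans h3, above_iff.2 (.inr ?_)⟩
        have := h4.half
        rwa [show (2 * c + 1) / 2 = c by omega] at this
    · obtain ⟨v, rfl⟩ : ∃ v : Fin n, c = n + v := ⟨⟨c - n, by omega⟩, by simp; omega⟩
      have hl := h.leaf v
      split_ifs at hl with h'
      · exact ⟨v, h'.1, h'.2, hl, above_self _⟩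
      · exact absurd hl hc

/-- On the way from the leaf of `v` to the root, the distances of the entries do not increase. -/
lemma root_le (h : TreeInv tr d que done D) {v : Fin n} (hv : v ∈ que) (hvd : v ∉ done) :
    tr 1 ≠ 0 ∧ extend d (tr 1 - 1) ≤ d v := by
  suffices H : ∀ c, 1 ≤ c → c < 2 * n → tr c ≠ 0 → extend d (tr c - 1) ≤ d v →
      tr 1 ≠ 0 ∧ extend d (tr 1 - 1) ≤ d v by
    have hl := h.leaf v
    rw [if_pos ⟨hv, hvd⟩] at hl
    have hv2 := v.2
    exact H (n + v) (by omega) (by omega) (by omega) (by rw [hl]; simp)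
  intro c
  induction c using Nat.strong_induction_on with
  | _ c ih =>
    intro h1 h2 h3 h4
    by_cases hc : c = 1
    · subst hc; exact ⟨h3, h4⟩
    · have hin := h.inner (c / 2) (by omega) (by omega)
      rcases Nat.even_or_odd' c with ⟨b, hb | hb⟩
      · have := better_left (extend d) (tr (2 * (c / 2) + 1)) (a := tr (2 * (c / 2)))
          (by rwa [show 2 * (c / 2) = c by omega])
        rw [← hin, show 2 * (c / 2) = c by omega] at this
        exact ih (c / 2) (by omega) (by omega) (by omega) this.1 (this.2.trans h4)
      · have := better_right (extend d) (tr (2 * (c / 2))) (b := tr (2 * (c / 2) + 1))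
          (by rwa [show 2 * (c / 2) + 1 = c by omega])
        rw [← hin, show 2 * (c / 2) + 1 = c by omega] at this
        exact ih (c / 2) (by omega) (by omega) (by omega) this.1 (this.2.trans h4)

end TreeInv

/-- A heap-ordered numbering: node `i` has the children `2 * i` and `2 * i + 1`, and the leaves are
`n + v`. Every operation changes one leaf and climbs from it. The tree fills the field of `2 * n`
records. -/
theorem tree_isQueue (hR : 2 * n ≤ Λ.R) :
    IsQueue Λ treeUpd treePop (100 * (Nat.log 2 (2 * n) + 2)) TreeInv where
  init := ⟨by simp, by simp [better], by simp, by simp⟩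
  upd_spec := by
    intro σ d que que' done D ld y h hyd hdone hque hld hlm h10
    have hN := Λ.hN
    have hy2 := y.2
    have hmem : ∀ v, v ∈ que' ↔ v = y ∨ v ∈ que := by
      rcases hque with ⟨_, rfl⟩ | ⟨hy, rfl, _⟩
      · intro v; simp [or_comm]
      · intro v
        constructor
        · exact .inr
        · rintro (rfl | hv)
          · exact hy
          · exact hv
    rw [treeUpd]
    simp [h10]
    refine ⟨by omega, ⟨by omega, by omega⟩, (climbCmd_spec hR (n + y) _ (by omega) (by omega)
      (by simp) ?_ ?_).mono ?_⟩
    · intro i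
      simp [Function.update_apply]
      split_ifs
      · omega
      · exact h.le i
    · intro i hi hin hA
      have e0 : i ≠ n + y := by omega
      have e1 : 2 * i ≠ n + y := by
        intro h
        exact hA (by rw [← h, Nat.mul_div_cancel_left _ (by norm_num)]; exact above_self _)
      have e2 : 2 * i + 1 ≠ n + y := by
        intro h
        exact hA (by rw [← h, show (2 * i + 1) / 2 = i by omega]; exact above_self _)
      -- Only the distance of `y` has changed, and `y` can occur only above its own leaf, whereas
      -- `c` does not lie there.
      have hval : ∀ c, c / 2 = i → σ.f 13 c ≠ 0 → extend d (σ.f 13 c - 1) = σ.lm (σ.f 13 c - 1) := by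
        intro c hc h0
        obtain ⟨v, -, -, h3, h4⟩ := h.valid c h0
        have hvy : v ≠ y := by
          rintro rfl
          exact hA (hc ▸ h4.half)
        rw [h3, Nat.add_sub_cancel, extend_val, hlm, Function.update_of_ne hvy]
      simp [Function.update_apply, e0, e1, e2]
      rw [h.inner i hi hin]
      exact better_congr (hval _ (by omega)) (hval _ (by omega))
    · rintro t σ' ⟨j1, j2, j3, j40, j4, j5, j6, j7, j8, j9⟩
      simp at j3 j40 j4 j5 j6 j7 j8 j9
      have hlog : Nat.log 2 (n + y) ≤ Nat.log 2 (2 * n) := Nat.log_mono_right (by omega)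
      refine ⟨by omega, ⟨?_, ?_, ?_, j2⟩, ?_, j6, fun g hg => ?_, j8, j9⟩
      · intro v
        rw [j4 _ (by omega)]
        by_cases hvy : v = y
        · subst hvy; simp [hmem, hyd]
        · have : n + (v : ℕ) ≠ n + y := by
            intro h; exact hvy (Fin.ext (by omega))
          rw [Function.update_of_ne this, h.leaf]
          simp [hmem, hvy]
      · intro i hi hin
        rw [j3 i hi hin]
        have : ∀ a, a ≤ n → a ≠ 0 → σ.lm (a - 1) = extend (Function.update d y ld) (a - 1) := by
          intro a ha h0
          have := hlm ⟨a - 1, by omega⟩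
          simp only [extend, dif_pos (show a - 1 < n by omega)]
          exact this
        exact better_congr (this _ (j2 _)) (this _ (j2 _))
      · intro i hi
        rcases hi with rfl | hi
        · rw [j40, Function.update_of_ne (by omega), h.outer 0 (.inl rfl)]
        · rw [j4 _ (by omega), Function.update_of_ne (by omega), h.outer i (.inr hi)]
      · intro i hi
        rw [j5 i hi]; simp [show i ≠ 20 by omega]
      · rw [j7 g hg]; simp [hg]
  pop_spec := by
    intro σ d que done D h hnd hdone hlt k5 k11 klm
    have hN := Λ.hN
    have hlen : que.length ≤ n := by simpa using hnd.length_le_card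
    -- Some vertex is unexpanded, so the root of the tree names a vertex.
    obtain ⟨v0, hv0, hv0d⟩ : ∃ v ∈ que, v ∉ done := by
      by_contra! hcon
      have : que.toFinset ⊆ done := fun v hv => hcon v (List.mem_toFinset.1 hv)
      have := Finset.card_le_card this
      rw [List.toFinset_card_of_nodup hnd] at this
      omega
    obtain ⟨x, hxq, hxd, hx1, -⟩ := h.valid 1 (h.root_le hv0 hv0d).1
    have hx2 := x.2
    have hmin : ∀ y ∈ que, y ∉ done → d x ≤ d y := by
      intro y hy hyd
      have := (h.root_le hy hyd).2
      rwa [hx1, Nat.add_sub_cancel, extend_val] at this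
    rw [treePop]
    simp [hx1, k5]
    refine ⟨by omega, by omega, by omega, by omega, (climbCmd_spec hR (n + x) _ (by omega)
      (by omega) (by simp) ?_ ?_).mono ?_⟩
    · intro i
      simp [Function.update_apply]
      split_ifs
      · omega
      · exact h.le i
    · intro i hi hin hA
      have e0 : i ≠ n + x := by omega
      have e1 : 2 * i ≠ n + x := by
        intro h
        exact hA (by rw [← h, Nat.mul_div_cancel_left _ (by norm_num)]; exact above_self _)
      have e2 : 2 * i + 1 ≠ n + x := by
        intro h
        exact hA (by rw [← h, show (2 * i + 1) / 2 = i by omega]; exact above_self _)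
      have hval : ∀ c, σ.f 13 c ≠ 0 → extend d (σ.f 13 c - 1) = σ.lm (σ.f 13 c - 1) := by
        intro c h0
        obtain ⟨v, -, -, h3, h4⟩ := h.valid c h0
        rw [h3, Nat.add_sub_cancel, extend_val, klm]
      simp [Function.update_apply, e0, e1, e2]
      rw [h.inner i hi hin]
      exact better_congr (hval _) (hval _)
    · rintro t σ' ⟨j1, j2, j3, j40, j4, j5, j6, j7, j8, j9⟩
      simp at j3 j40 j4 j5 j6 j7 j8 j9
      have hlog : Nat.log 2 (n + x) ≤ Nat.log 2 (2 * n) := Nat.log_mono_right (by omega)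
      have i7 := j5 7 (by norm_num)
      have i5 := j5 5 (by norm_num)
      simp at i7 i5
      refine ⟨by omega, x, hxq, hxd, hmin, i7, i5, ⟨?_, ?_, ?_, j2⟩, ?_, j6,
        fun g hg => ?_, j8, j9⟩
      · intro v
        rw [j4 _ (by omega)]
        by_cases hvx : v = x
        · subst hvx; simp
        · have : n + (v : ℕ) ≠ n + x := by
            intro h; exact hvx (Fin.ext (by omega))
          rw [Function.update_of_ne this, h.leaf]
          simp [hvx]
      · intro i hi hin
        rw [j3 i hi hin]
        have : ∀ a, a ≤ n → a ≠ 0 → σ.lm (a - 1) = extend d (a - 1) := by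
          intro a ha h0
          have := klm ⟨a - 1, by omega⟩
          simp only [extend, dif_pos (show a - 1 < n by omega)]
          exact this
        exact better_congr (this _ (j2 _)) (this _ (j2 _))
      · intro i hi
        rcases hi with rfl | hi
        · rw [j40, Function.update_of_ne (by omega), h.outer 0 (.inl rfl)]
        · rw [j4 _ (by omega), Function.update_of_ne (by omega), h.outer i (.inr hi)]
      · intro i hi i5 i7
        rw [j5 i hi]; simp [show i ≠ 20 by omega, i5, i7]
      · rw [j7 g hg]; simp [hg]
  final := by
    intro t d que done D h hall
    funext c
    by_contra hc
    obtain ⟨v, h1, h2, -⟩ := h.valid c hc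
    exact h2 (hall v h1)

end DistOracle
end

noncomputable section
namespace DistOracle

/-! ## Routing between landmarks -/

section encoding
variable {n : ℕ} (G : SimpleGraph (Fin n)) (f : ℕ → ℕ → ℕ) (X : ℕ → ℕ)

/-- The walk goes through the vertices at the positions from `s` to `e`, upwards or downwards,
of the array in field 6. Field 7 holds, for each position, the index of the next vertex in the
adjacency list of the vertex at this position. -/
inductive Seg : ℕ → ℕ → ∀ {u z : Fin n}, G.Walk u z → Prop
  | nil {s : ℕ} {u : Fin n} (hs : s < n) (hu : f 6 s = u) :
      Seg s s (SimpleGraph.Walk.nil : G.Walk u u)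
  | up {s e : ℕ} {u v z : Fin n} {P : G.Walk v z} (h : G.Adj u v) (hs : s < e) (hu : f 6 s = u)
      (hv : (adjList G u)[f 7 s]? = some v) (hP : Seg (s + 1) e P) :
      Seg s e (SimpleGraph.Walk.cons h P)
  | down {s e : ℕ} {u v z : Fin n} {P : G.Walk v z} (h : G.Adj u v) (hs : e ≤ s)
      (hn : s + 1 < n) (hu : f 6 (s + 1) = u) (hv : (adjList G v)[f 7 s]? = some u)
      (hP : Seg s e P) : Seg (s + 1) e (SimpleGraph.Walk.cons h P)

/-- The read-only area holds from the address `a` on a description of the walk as a sequence of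
runs of consecutive positions. -/
inductive Runs (lo hi : ℕ) : ℕ → ∀ {u z : Fin n}, G.Walk u z → Prop
  | last {a : ℕ} {u z : Fin n} {P : G.Walk u z} (hlo : lo ≤ a) (hhi : a + 4 ≤ hi)
      (hP : Seg G f (X a) (X (a + 1)) P) (hm : X (a + 3) = 0) : Runs lo hi a P
  | step {a : ℕ} {u z v y : Fin n} {P : G.Walk u z} {Q : G.Walk v y} (hlo : lo ≤ a)
      (hhi : a + 4 < hi) (hP : Seg G f (X a) (X (a + 1)) P) (hm : X (a + 3) = 1)
      (h : G.Adj z v) (hv : (adjList G z)[X (a + 2)]? = some v) (hQ : Runs lo hi (a + 4) Q) :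
      Runs lo hi a (P.append (SimpleGraph.Walk.cons h Q))

/-- The walk is what the next-hop table describes as the route to `y`. -/
inductive Route (lo hi : ℕ) (y : Fin n) : ∀ {x : Fin n}, G.Walk x y → Prop
  | nil : Route lo hi y SimpleGraph.Walk.nil
  | step {x x' : Fin n} {P : G.Walk x x'} {Q : G.Walk x' y} (hx : x ≠ y) (hx' : x ≠ x')
      (hlo : lo ≤ f 5 x + f 4 y) (hhi : f 5 x + f 4 y < hi)
      (hP : Runs G f X lo hi (X (f 5 x + f 4 y)) P) (hQ : Route lo hi y Q) :
      Route lo hi y (P.append Q)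

variable {G f X}

lemma Seg.lt {s e : ℕ} {u z : Fin n} {P : G.Walk u z} (h : Seg G f s e P) : s < n ∧ e < n := by
  induction h with
  | nil hs hu => exact ⟨hs, hs⟩
  | up h hs hu hv hP ih => omega
  | down h hs hn hu hv hP ih => omega

end encoding

/-- Field 7 describes the edge as seen from the lower of its two positions, so a downward step
decreases the position before it reads the weight. -/
def segCmd : Cmd :=
  .loop (.ne (.v 17) (.v 18))
    (.seq (.ite (.lt (.v 17) (.v 18))
      (.seq (.lwt 2 (.fld 6 (.v 17)) (.fld 7 (.v 17))) (.asg 17 (.add (.v 17) (.c 1))))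
      (.seq (.asg 17 (.sub (.v 17) (.c 1))) (.lwt 2 (.fld 6 (.v 17)) (.fld 7 (.v 17)))))
    (.seq (.ladd 0 0 2)
    (.seq (.asg 4 (.fld 6 (.v 17)))
      (.emit (.v 4)))))

/-- A run takes four words: first position, last position, index of the edge to the next run, and a
flag telling whether there is a next run. -/
def runsCmd : Cmd :=
  .seq (.asg 16 (.c 1)) (.loop (.eq (.v 16) (.c 1))
    (.seq (.asg 17 (.ab (.v 15)))
    (.seq (.asg 18 (.ab (.add (.v 15) (.c 1))))
    (.seq segCmd
    (.seq (.asg 16 (.ab (.add (.v 15) (.c 3))))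
    (.ite (.eq (.v 16) (.c 1))
      (.seq (.lwt 2 (.v 4) (.ab (.add (.v 15) (.c 2))))
      (.seq (.ladd 0 0 2)
      (.seq (.asg 4 (.nbr (.v 4) (.ab (.add (.v 15) (.c 2)))))
      (.seq (.emit (.v 4))
        (.asg 15 (.add (.v 15) (.c 4)))))))
      .skip))))))

def routeCmd : Cmd :=
  .loop (.ne (.v 4) (.v 13))
    (.seq (.asg 15 (.ab (.add (.fld 5 (.v 4)) (.fld 4 (.v 13))))) runsCmd)

variable {n : ℕ} {Λ : Layout n}

/-- The registers that are used for routing. -/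
def IsRouteReg (i : ℕ) : Prop := i = 4 ∨ i = 15 ∨ i = 16 ∨ i = 17 ∨ i = 18

theorem segCmd_spec {s e : ℕ} {u z : Fin n} {P : Λ.E.graph.Walk u z} {f : ℕ → ℕ → ℕ}
    (h : Seg Λ.E.graph f s e P) : ∀ σ : AS, σ.f = f → σ.r 4 = u → σ.r 17 = s → σ.r 18 = e →
    WP Λ segCmd (fun t σ' => t ≤ 100 * P.length + 10 ∧ σ'.r 4 = z ∧
      (∀ i, i ≠ 4 → i ≠ 17 → σ'.r i = σ.r i) ∧ σ'.lr 0 = σ.lr 0 + walkLen Λ.E.weight P ∧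
      σ'.f = σ.f ∧ σ'.lm = σ.lm ∧ σ'.out = σ.out ++ P.support.tail.map Fin.val) σ := by
  have hR := Λ.hR
  have hN := Λ.hN
  induction h with
  | nil hs hu =>
    intro σ hf h4 h17 h18
    rw [segCmd, WP_loop_unfold]
    simp [h4, h17, h18]
  | @up s e u v z P h hs hu hv hP ih =>
    intro σ hf h4 h17 h18
    have hl := hP.lt
    have hu2 := u.2
    have hv6 : σ.f 6 (s + 1) = v := by
      rw [hf]; cases hP <;> assumption
    rw [segCmd, WP_loop_unfold]
    simp [h4, h17, h18, hs.ne, hs, hf ▸ hu, hf ▸ lt_deg hv, wtN_val _ _ (hf ▸ hv), hv6]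
    refine ⟨by omega, by omega, by omega, WP.mono (ih _ hf (by simp) (by simp) (by simp [h18])) ?_⟩
    rintro t σ' ⟨h1, h2, h3, h5, h6, h7, h8⟩
    simp at h3 h5 h6 h7 h8
    refine ⟨by omega, h2, fun i hi hi' => ?_, ?_, h6, h7, ?_⟩
    · rw [h3 i hi hi', if_neg hi, if_neg hi']
    · rw [h5]; ring
    · rw [h8, ← List.map_tail, ← List.map_cons, SimpleGraph.Walk.cons_tail_support]
  | @down s e u v z P h hs hn hu hv hP ih =>
    intro σ hf h4 h17 h18
    have hl := hP.lt
    have hv2 := v.2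
    have hv6 : σ.f 6 s = v := by
      rw [hf]; cases hP <;> assumption
    rw [segCmd, WP_loop_unfold]
    simp [h4, h17, h18, show s + 1 ≠ e by omega, show ¬ s + 1 < e by omega, hv6,
      hf ▸ lt_deg hv, wtN_val _ _ (hf ▸ hv)]
    refine ⟨by omega, WP.mono (ih _ hf (by simp) (by simp) (by simp [h18])) ?_⟩
    rintro t σ' ⟨h1, h2, h3, h5, h6, h7, h8⟩
    simp at h3 h5 h6 h7 h8
    refine ⟨by omega, h2, fun i hi hi' => ?_, ?_, h6, h7, ?_⟩
    · rw [h3 i hi hi', if_neg hi, if_neg hi']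
    · rw [h5, Sym2.eq_swap]; ring
    · rw [h8, ← List.map_tail, ← List.map_cons, SimpleGraph.Walk.cons_tail_support]

theorem runsCmd_spec {a : ℕ} {u z : Fin n} {P : Λ.E.graph.Walk u z} {f : ℕ → ℕ → ℕ}
    (h : Runs Λ.E.graph f Λ.x (16 * (Λ.R + 1)) Λ.N a P) : ∀ σ : AS, σ.f = f → σ.r 4 = u →
    σ.r 15 = a →
    WP Λ runsCmd (fun t σ' => t ≤ 200 * P.length + 100 ∧ σ'.r 4 = z ∧
      (∀ i, ¬ IsRouteReg i → σ'.r i = σ.r i) ∧ σ'.lr 0 = σ.lr 0 + walkLen Λ.E.weight P ∧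
      σ'.f = σ.f ∧ σ'.lm = σ.lm ∧ σ'.out = σ.out ++ P.support.tail.map Fin.val) σ := by
  have hR := Λ.hR
  have hN := Λ.hN
  suffices key : ∀ σ : AS, σ.f = f → σ.r 4 = u → σ.r 15 = a → σ.r 16 = 1 →
      WP Λ (.loop (.eq (.v 16) (.c 1))
    (.seq (.asg 17 (.ab (.v 15)))
    (.seq (.asg 18 (.ab (.add (.v 15) (.c 1))))
    (.seq segCmd
    (.seq (.asg 16 (.ab (.add (.v 15) (.c 3))))
    (.ite (.eq (.v 16) (.c 1))
      (.seq (.lwt 2 (.v 4) (.ab (.add (.v 15) (.c 2))))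
      (.seq (.ladd 0 0 2)
      (.seq (.asg 4 (.nbr (.v 4) (.ab (.add (.v 15) (.c 2)))))
      (.seq (.emit (.v 4))
        (.asg 15 (.add (.v 15) (.c 4)))))))
      .skip)))))) (fun t σ' => t ≤ 200 * P.length + 90 ∧ σ'.r 4 = z ∧
      (∀ i, ¬ IsRouteReg i → σ'.r i = σ.r i) ∧ σ'.lr 0 = σ.lr 0 + walkLen Λ.E.weight P ∧
      σ'.f = σ.f ∧ σ'.lm = σ.lm ∧ σ'.out = σ.out ++ P.support.tail.map Fin.val) σ by
    intro σ hf h4 h15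
    rw [runsCmd, WP_seq, WP_asg]
    refine ⟨by simp, WP.mono (key _ hf (by simpa using h4) (by simpa using h15) (by simp)) ?_⟩
    rintro t σ' ⟨h1, h2, h3, h5, h6, h7, h8⟩
    refine ⟨by simp; omega, h2, fun i hi => ?_, h5, h6, h7, h8⟩
    rw [h3 i hi]
    simp only [IsRouteReg, not_or] at hi
    simp [hi]
  induction h with
  | @last a u z P hlo hhi hP hm =>
    intro σ hf h4 h15 h16
    rw [WP_loop_unfold]
    simp [h15, h16]
    refine ⟨by omega, by omega, WP.mono (segCmd_spec hP _ hf (by simp [h4]) (by simp)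
      (by simp)) ?_⟩
    rintro t σ' ⟨h1, h2, h3, h5, h6, h7, h8⟩
    have e15 : σ'.r 15 = a := by rw [h3 15 (by norm_num) (by norm_num)]; simp [h15]
    simp at h3 h5 h6 h7 h8
    simp [e15, hm]
    refine ⟨by omega, ?_⟩
    rw [WP_loop_unfold]
    simp
    refine ⟨by omega, h2, fun i hi => ?_, h5, h6, h7, h8⟩
    simp only [IsRouteReg, not_or] at hi
    rw [if_neg hi.2.2.1, h3 i hi.1 hi.2.2.2.1, if_neg hi.2.2.2.2, if_neg hi.2.2.2.1]
  | @step a u z v y P Q hlo hhi hP hm h hv hQ ih =>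
    intro σ hf h4 h15 h16
    have hz2 := z.2
    rw [WP_loop_unfold]
    simp [h15, h16]
    refine ⟨by omega, by omega, WP.mono (segCmd_spec hP _ hf (by simp [h4]) (by simp)
      (by simp)) ?_⟩
    rintro t σ' ⟨h1, h2, h3, h5, h6, h7, h8⟩
    have e15 : σ'.r 15 = a := by rw [h3 15 (by norm_num) (by norm_num)]; simp [h15]
    simp at h3 h5 h6 h7 h8
    simp [e15, hm, h2, lt_deg hv, wtN_val _ _ hv, nbrN_val _ hv]
    refine ⟨by omega, by omega, by omega, WP.mono (ih _ (by simp [h6, hf])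
      (by simp) (by simp) (by simp)) ?_⟩
    rintro t' σ'' ⟨j1, j2, j3, j5, j6, j7, j8⟩
    simp at j3 j5 j6 j7 j8
    refine ⟨by omega, j2, fun i hi => ?_, ?_, j6.trans h6, j7.trans h7, ?_⟩
    · rw [j3 i hi]
      simp only [IsRouteReg, not_or] at hi
      rw [if_neg hi.2.1, if_neg hi.1, if_neg hi.2.2.1, h3 i hi.1 hi.2.2.2.1, if_neg hi.2.2.2.2,
        if_neg hi.2.2.2.1]
    · rw [j5, h5]; ring
    · rw [j8, h8, ← List.map_tail, ← List.map_tail, ← List.map_tail,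
        SimpleGraph.Walk.tail_support_append, SimpleGraph.Walk.support_cons,
        List.tail_cons, List.map_append, List.append_assoc, ← List.map_cons, Q.cons_tail_support]

theorem routeCmd_spec {x y : Fin n} {P : Λ.E.graph.Walk x y} {f : ℕ → ℕ → ℕ}
    (h : Route Λ.E.graph f Λ.x (16 * (Λ.R + 1)) Λ.N y P) : ∀ σ : AS, σ.f = f → σ.r 4 = x →
    σ.r 13 = y →
    WP Λ routeCmd (fun t σ' => t ≤ 400 * P.length + 10 ∧ σ'.r 4 = y ∧
      (∀ i, ¬ IsRouteReg i → σ'.r i = σ.r i) ∧ σ'.lr 0 = σ.lr 0 + walkLen Λ.E.weight P ∧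
      σ'.f = σ.f ∧ σ'.lm = σ.lm ∧ σ'.out = σ.out ++ P.support.tail.map Fin.val) σ := by
  have hR := Λ.hR
  have hN := Λ.hN
  have hy := y.2
  induction h with
  | nil =>
    intro σ hf h4 h13
    rw [routeCmd, WP_loop_unfold]
    simp [h4, h13]
  | @step x x' P Q hx hx' hlo hhi hP hQ ih =>
    intro σ hf h4 h13
    have hx2 := x.2
    have hne : (x : ℕ) ≠ y := fun h => hx (Fin.ext h)
    -- A hop contains at least one edge, so its constant overhead is covered by the term
    -- proportional to the length.
    have hlen : 1 ≤ P.length := by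
      rcases Nat.eq_zero_or_pos P.length with h | h
      · exact absurd (SimpleGraph.Walk.eq_of_length_eq_zero h) hx'
      · exact h
    rw [routeCmd, WP_loop_unfold]
    simp [h4, h13, hne, hf, hlo, hhi]
    refine ⟨by omega, WP.mono (runsCmd_spec hP _ hf (by simp [h4]) (by simp)) ?_⟩
    rintro t σ' ⟨h1, h2, h3, h5, h6, h7, h8⟩
    have e13 : σ'.r 13 = y := by rw [h3 13 (by simp [IsRouteReg])]; simp [h13]
    simp at h3 h5 h6 h7 h8
    refine WP.mono (ih _ (h6.trans hf) h2 e13) ?_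
    rintro t' σ'' ⟨j1, j2, j3, j5, j6, j7, j8⟩
    refine ⟨?_, j2, fun i hi => ?_, ?_, j6.trans (h6.trans hf), j7.trans h7, ?_⟩
    · omega
    · rw [j3 i hi, h3 i hi]
      simp only [IsRouteReg, not_or] at hi
      rw [if_neg hi.2.1]
    · rw [j5, h5]; ring
    · rw [j8, h8, ← List.map_tail, ← List.map_tail, SimpleGraph.Walk.tail_support_append,
        List.map_append, List.append_assoc]

/-! ## The distance to the landmarks -/

/-- The climb stops at the first vertex at distance zero from the landmarks, which need not be a
landmark itself. Thus every vertex from which it steps lies in the ball of the source, and the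
search can pay for the climb even if there are long paths of weight zero. -/
def radiusCmd : Cmd :=
  .seq (.asg 4 (.v 2))
  (.seq (.lzero 1)
  (.seq (.asg 3 (.fld 14 (.v 2)))
  (.loop (.eq (.fld 1 (.v 4)) (.c 0))
    (.seq (.lwt 2 (.fld 2 (.v 4)) (.fld 3 (.v 4)))
    (.seq (.ladd 1 1 2)
      (.asg 4 (.fld 2 (.v 4))))))))

/-- The fields that describe a forest of shortest paths to the landmarks. -/
structure Forest (G : SimpleGraph (Fin n)) (w : Sym2 (Fin n) → ℝ≥0) (L : Finset (Fin n))
    (f : ℕ → ℕ → ℕ) (par : Fin n → Fin n) (rk : Fin n → ℕ) : Prop where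
  status : ∀ v : Fin n, f 1 v = if sdist G w L v = 0 ∨ sdist G w L v = ⊤ then 1 else 0
  inf : ∀ v : Fin n, f 14 v = if sdist G w L v = ⊤ then 1 else 0
  parents : Parents G f 2 3 par (fun v => sdist G w L v ≠ ⊤)
  rank : ∀ v, sdist G w L v ≠ ⊤ → par v ≠ v → rk (par v) < rk v
  root : ∀ v, sdist G w L v ≠ ⊤ → par v = v → v ∈ L
  dist : ∀ v, sdist G w L v ≠ ⊤ → par v ≠ v →
    sdist G w L v = w s(par v, v) + sdist G w L (par v)

lemma Forest.ne_root {G : SimpleGraph (Fin n)} {w : Sym2 (Fin n) → ℝ≥0} {L : Finset (Fin n)}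
    {f : ℕ → ℕ → ℕ} {par : Fin n → Fin n} {rk : Fin n → ℕ} (h : Forest G w L f par rk) {v : Fin n}
    (h0 : sdist G w L v ≠ 0) (ht : sdist G w L v ≠ ⊤) : par v ≠ v := by
  intro hv
  have := sdist_le (G := G) (w := w) (u := v) (h.root v ht hv)
  rw [wdist_self] at this
  exact h0 (le_antisymm this zero_le)

lemma Forest.walkLen {G : SimpleGraph (Fin n)} {w : Sym2 (Fin n) → ℝ≥0} {L : Finset (Fin n)}
    {f : ℕ → ℕ → ℕ} {par : Fin n → Fin n} {rk : Fin n → ℕ} (h : Forest G w L f par rk)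
    {u z : Fin n} {P : G.Walk u z} (hP : Climbs par P) (hu : sdist G w L u ≠ ⊤) :
    z ∈ L ∧ (walkLen w P : ℝ≥0∞) = sdist G w L u := by
  induction P with
  | @nil u' =>
    have hz := h.root _ hu hP
    refine ⟨hz, ?_⟩
    have := sdist_le (G := G) (w := w) (u := u') hz
    rw [wdist_self] at this
    simp [le_antisymm this zero_le]
  | @cons u v z ha P ih =>
    obtain ⟨rfl, hne, hP⟩ := hP
    obtain ⟨h1, h2⟩ := ih hP ((h.parents u hu).2 hne).1
    refine ⟨h1, ?_⟩
    rw [h.dist u hu hne, walkLen_cons, ENNReal.coe_add, h2, Sym2.eq_swap]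

/-- The forest path is a shortest path to the landmarks, so the weights up to a vertex at distance
zero add up to the radius. The time at rank `m` is charged to the vertices of the ball of rank at
most `m`, which become fewer with every step. -/
theorem radiusCmd_spec {L : Finset (Fin n)} {f : ℕ → ℕ → ℕ} {par : Fin n → Fin n}
    {rk : Fin n → ℕ} (h : Forest Λ.E.graph Λ.E.weight L f par rk) (s : Fin n) (σ : AS)
    (hf : σ.f = f) (h2 : σ.r 2 = s) :
    WP Λ radiusCmd (fun t σ' =>
      t ≤ 60 * ((ball Λ.E.graph Λ.E.weight L s).card + 1) ∧ σ'.r 3 < 2 ∧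
      (∀ l : ℝ≥0, (l : ℝ≥0∞) < sdist Λ.E.graph Λ.E.weight L s ↔ σ'.r 3 = 1 ∨ l < σ'.lr 1) ∧
      (∀ i, i ≠ 3 → i ≠ 4 → σ'.r i = σ.r i) ∧ σ'.lr 0 = σ.lr 0 ∧
      σ'.f = σ.f ∧ σ'.lm = σ.lm ∧ σ'.out = σ.out) σ := by
  set G := Λ.E.graph
  set w := Λ.E.weight
  have hR := Λ.hR
  have loop : sdist G w L s ≠ ⊤ → ∀ (m : ℕ) (v : Fin n) (σ : AS), rk v = m → σ.f = f → σ.r 4 = v →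
      sdist G w L v ≠ ⊤ → wdist G w s v + sdist G w L v ≤ sdist G w L s →
      WP Λ (.loop (.eq (.fld 1 (.v 4)) (.c 0))
    (.seq (.lwt 2 (.fld 2 (.v 4)) (.fld 3 (.v 4)))
    (.seq (.ladd 1 1 2)
      (.asg 4 (.fld 2 (.v 4)))))) (fun t σ' =>
      t ≤ 50 * (((ball G w L s).filter fun x => rk x ≤ m).card + 1) ∧
      ((σ'.lr 1 : ℝ≥0∞) = σ.lr 1 + sdist G w L v) ∧
      (∀ i, i ≠ 4 → σ'.r i = σ.r i) ∧ σ'.lr 0 = σ.lr 0 ∧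
      σ'.f = σ.f ∧ σ'.lm = σ.lm ∧ σ'.out = σ.out) σ := by
    intro hts m
    induction m using Nat.strong_induction_on with
    | _ m ih =>
      intro v σ hm hf h4 ht hle
      have hv2 := v.2
      rw [WP_loop_unfold]
      by_cases h0 : sdist G w L v = 0
      · have e1 : σ.f 1 v = 1 := by rw [hf, h.status, if_pos (.inl h0)]
        simp [h4, e1, h0]
        omega
      · have e1 : σ.f 1 v = 0 := by rw [hf, h.status, if_neg (by simp [h0, ht])]
        have hne := h.ne_root h0 ht
        obtain ⟨p1, p2⟩ := h.parents v ht
        obtain ⟨p2, p3⟩ := p2 hne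
        rw [← hf] at p1 p3
        have hd := h.dist v ht hne
        simp [h4, e1, p1]
        refine ⟨by omega, ⟨by omega, lt_deg p3⟩, by omega, WP.mono (ih _ (hm ▸ h.rank v ht hne) (par v) _ rfl
          (by simpa using hf) (by simp) p2 ?_) ?_⟩
        · refine le_trans ?_ hle
          rw [hd, ← add_assoc, Sym2.eq_swap]
          gcongr
          exact wdist_step (adj_of_adjList p3).symm
        · rintro t σ' ⟨j1, j2, j3, j4, j5, j6, j7⟩
          simp at j2 j3 j4 j5 j6 j7
          refine ⟨?_, ?_, fun i hi => by rw [j3 i hi, if_neg hi], j4, j5, j6, j7⟩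
          -- The remaining distance at `v` is positive and is part of the distance of `s`.
          · have hvb : v ∈ ball G w L s := by
              rw [mem_ball]
              have hs : wdist G w s v ≠ ⊤ := by
                intro hs
                rw [hs, top_add, top_le_iff] at hle
                exact hts hle
              exact lt_of_lt_of_le (ENNReal.lt_add_right hs h0) hle
            have : ((ball G w L s).filter fun x => rk x ≤ rk (par v)).card <
                ((ball G w L s).filter fun x => rk x ≤ m).card := by
              apply Finset.card_lt_card
              rw [Finset.ssubset_iff_of_subset]
              · refine ⟨v, by simp [hvb, hm], ?_⟩
                simp [h.rank v ht hne]
              · intro x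
                simp only [Finset.mem_filter]
                rintro ⟨hx, hx'⟩
                have := h.rank v ht hne
                exact ⟨hx, by omega⟩
            omega
          · rw [j2, wtN_val _ _ p3, hd]; ring
  have hs2 := s.2
  rw [radiusCmd]
  simp only [WP_seq, WP_asg, WP_lzero]
  simp [h2]
  refine ⟨by omega, ?_⟩
  by_cases ht : sdist G w L s = ⊤
  · have e1 : σ.f 1 s = 1 := by rw [hf, h.status, if_pos (.inr ht)]
    have e2 : σ.f 14 s = 1 := by rw [hf, h.inf, if_pos ht]
    rw [WP_loop_unfold]
    simp [e1, e2, ht]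
    refine ⟨by omega, by omega, ?_⟩
    intro i h3 h4
    simp [h3, h4]
  · have e2 : σ.f 14 s = 0 := by rw [hf, h.inf, if_neg ht]
    refine WP.mono (loop ht _ s _ rfl hf (by simp) ht (by simp [wdist_self])) ?_
    rintro t σ' ⟨j1, j2, j3, j4, j5, j6, j7⟩
    simp at j2 j3 j4 j5 j6 j7
    have e3 : σ'.r 3 = 0 := by rw [j3 3 (by norm_num)]; simp [e2]
    have : ((ball G w L s).filter fun x => rk x ≤ rk s).card ≤ (ball G w L s).card :=
      Finset.card_filter_le _ _
    refine ⟨by omega, by omega, fun l => ?_, fun i h3 h4 => by rw [j3 i h4]; simp [h3, h4], j4, j5,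
      j6, j7⟩
    rw [← j2]
    simp [e3]

end DistOracle
end

noncomputable section
namespace DistOracle

/-! ## The query program -/

def searchCmd (upd pop : Cmd) : Cmd := .seq radiusCmd (.seq (startCmd upd) (exploreCmd upd pop))

/-- Search from the second vertex of the query for the first one. -/
def forwardCmd (upd pop : Cmd) : Cmd :=
  .seq (.asg 2 (.v 1))
  (.seq (searchCmd upd pop)
  (.seq (.ite (.eq (.fld 8 (.v 0)) (.c 1))
      (.seq (.asg 12 (.c 1)) (.seq (.asg 4 (.v 0)) (.seq (.emit (.v 4)) (fwdCmd 9 10)))) .skip)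
    cleanCmd))

/-- Search from the first vertex of the query for the second one. -/
def backwardCmd (upd pop : Cmd) : Cmd :=
  .seq (.asg 2 (.v 0))
  (.seq (searchCmd upd pop)
  (.seq (.ite (.eq (.fld 8 (.v 1)) (.c 1))
      (.seq (.asg 12 (.c 1)) (.seq (.asg 4 (.v 1)) (.seq (pushCmd 9)
        (.seq (.emit (.v 0)) (popCmd 9 10))))) .skip)
    cleanCmd))

/-- The route through the nearest landmarks. -/
def landmarkCmd : Cmd :=
  .seq (.asg 4 (.v 1))
  (.seq (pushCmd 2)
  (.seq (.asg 13 (.v 4))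
  (.seq (.asg 4 (.v 0))
  (.seq (.emit (.v 4))
  (.seq (fwdCmd 2 3)
  (.seq routeCmd (popCmd 2 3)))))))

def queryCmd (upd pop : Cmd) : Cmd :=
  .ite (.eq (.fld 0 (.v 0)) (.fld 0 (.v 1)))
    (.seq (forwardCmd upd pop)
    (.ite (.eq (.v 12) (.c 0))
      (.seq (backwardCmd upd pop)
      (.ite (.eq (.v 12) (.c 0)) landmarkCmd .skip))
      .skip))
    .skip

variable {n : ℕ} {Λ : Layout n} {upd pop : Cmd} {g : ℕ}
  {inv : (ℕ → ℕ) → (Fin n → ℝ≥0) → List (Fin n) → Finset (Fin n) → ℝ≥0 → Prop}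

/-- The fields of the records hold the data of a distance oracle with landmarks `L` and stretch
`t` between the landmarks, and a clean work space. -/
structure Tables (Λ : Layout n) (L : Finset (Fin n)) (t : ℕ) (f : ℕ → ℕ → ℕ)
    (par : Fin n → Fin n) (rk : Fin n → ℕ) : Prop where
  comp : ∀ u v : Fin n, f 0 u = f 0 v ↔ Λ.E.graph.Reachable u v
  forest : Forest Λ.E.graph Λ.E.weight L f par rk
  zero : ∀ g, 8 ≤ g → g ≤ 13 → f g = fun _ => 0
  route : ∀ x ∈ L, ∀ y ∈ L, Λ.E.graph.Reachable x y → ∃ P : Λ.E.graph.Walk x y,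
    Route Λ.E.graph f Λ.x (16 * (Λ.R + 1)) Λ.N y P ∧
    (walkLen Λ.E.weight P : ℝ≥0∞) ≤ t * wdist Λ.E.graph Λ.E.weight x y

/-- The size of the neighbourhood that is searched from a vertex. -/
def workload (G : SimpleGraph (Fin n)) (w : Sym2 (Fin n) → ℝ≥0) (L : Finset (Fin n)) (s : Fin n) :
    ℕ := ∑ v ∈ ball G w L s, (deg G v + 1)

lemma Seg.congr {G : SimpleGraph (Fin n)} {f f' : ℕ → ℕ → ℕ} {s e : ℕ} {u z : Fin n}
    {P : G.Walk u z} (h : Seg G f s e P) (h6 : f' 6 = f 6) (h7 : f' 7 = f 7) :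
    Seg G f' s e P := by
  induction h with
  | nil hs hu => exact .nil hs (h6 ▸ hu)
  | up h hs hu hv hP ih => exact .up h hs (h6 ▸ hu) (h7 ▸ hv) ih
  | down h hs hn hu hv hP ih => exact .down h hs hn (h6 ▸ hu) (h7 ▸ hv) ih

lemma Runs.congr {G : SimpleGraph (Fin n)} {f f' : ℕ → ℕ → ℕ} {X : ℕ → ℕ} {lo hi a : ℕ}
    {u z : Fin n} {P : G.Walk u z} (h : Runs G f X lo hi a P) (h6 : f' 6 = f 6)
    (h7 : f' 7 = f 7) : Runs G f' X lo hi a P := by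
  induction h with
  | last hlo hhi hP hm => exact .last hlo hhi (hP.congr h6 h7) hm
  | step hlo hhi hP hm h hv hQ ih => exact .step hlo hhi (hP.congr h6 h7) hm h hv ih

lemma Route.congr {G : SimpleGraph (Fin n)} {f f' : ℕ → ℕ → ℕ} {X : ℕ → ℕ} {lo hi : ℕ}
    {x y : Fin n} {P : G.Walk x y} (h : Route G f X lo hi y P)
    (hf : ∀ g, 4 ≤ g → g ≤ 7 → f' g = f g) : Route G f' X lo hi y P := by
  have h4 := hf 4 (by norm_num) (by norm_num)
  have h5 := hf 5 (by norm_num) (by norm_num)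
  induction h with
  | nil => exact .nil
  | step hx hx' hlo hhi hP hQ ih =>
    refine .step hx hx' ?_ ?_ ?_ ih
    · rwa [h4, h5]
    · rwa [h4, h5]
    · rw [h4, h5]
      exact hP.congr (hf 6 (by norm_num) (by norm_num)) (hf 7 (by norm_num) (by norm_num))

lemma card_ball_le (G : SimpleGraph (Fin n)) (w : Sym2 (Fin n) → ℝ≥0) (L : Finset (Fin n))
    (s : Fin n) : (ball G w L s).card ≤ workload G w L s := by
  rw [workload, Finset.card_eq_sum_ones]
  exact Finset.sum_le_sum fun _ _ => by omega

/-- Depths decrease along the pointers, so the climb ends in the only root `s`; the equations for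
`d` telescope to the length of the climb. -/
lemma Found.exists_climb {s : Fin n} {ρ : ℝ≥0∞} {que : List (Fin n)} {d : Fin n → ℝ≥0}
    {par : Fin n → Fin n} {idx dep : Fin n → ℕ} (h : Found Λ s ρ que d par idx dep) {σ₀ σ : AS}
    (hl : Linked σ₀ σ que d par idx) :
    Parents Λ.E.graph σ.f 9 10 par (· ∈ que) ∧ ∀ v ∈ que, ∃ P : Λ.E.graph.Walk v s,
      Climbs par P ∧ P.length < n ∧
      (walkLen Λ.E.weight P : ℝ≥0∞) = wdist Λ.E.graph Λ.E.weight s v := by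
  have hT : Parents Λ.E.graph σ.f 9 10 par (· ∈ que) := by
    intro v hv
    refine ⟨hl.f9 v hv, fun hne => ?_⟩
    have hvs : v ≠ s := by
      rintro rfl
      exact hne h.root.1
    obtain ⟨h1, h2, -⟩ := h.tree v hv hvs
    exact ⟨h1, by rw [hl.f10 v hv]; exact h2⟩
  refine ⟨hT, fun v hv => ?_⟩
  obtain ⟨z, P, hP, hlen, hz⟩ := hT.exists_climb (rk := dep) (fun v hv hne => by
    have hvs : v ≠ s := by
      rintro rfl
      exact hne h.root.1
    exact (h.tree v hv hvs).2.2.2) v hv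
  have hzs : z = s := by
    by_contra hzs
    have := (h.tree z hz hzs).2.2.2
    rw [hP.root] at this
    exact lt_irrefl _ this
  subst hzs
  refine ⟨P, hP, hlen, ?_⟩
  rw [← h.dist v hv]
  congr 1
  clear hlen hz hl
  induction P with
  | nil => simp [h.root.2]
  | @cons u v z ha P ih =>
    obtain ⟨rfl, hne, hP⟩ := hP
    have hvs : u ≠ z := by
      rintro rfl
      exact hne h.root.1
    obtain ⟨h1, h2, h3, -⟩ := h.tree u hv hvs
    rw [walkLen_cons, ih h1 hP h, h3, Sym2.eq_swap, add_comm]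

/-- The summand beside `t` on the left reserves time for the clean-up that follows. -/
theorem searchCmd_spec (hQ : IsQueue Λ upd pop g inv) {L : Finset (Fin n)} {k : ℕ}
    {f : ℕ → ℕ → ℕ} {par : Fin n → Fin n} {rk : Fin n → ℕ} (hT : Tables Λ L k f par rk)
    (s : Fin n) (σ : AS) (hf : σ.f = f) (hlm : σ.lm = fun _ => 0) (h2 : σ.r 2 = s) :
    WP Λ (searchCmd upd pop) (fun t σ' =>
      t + 200 * ((ball Λ.E.graph Λ.E.weight L s).card + 2) ≤
        (2 * g + 1000) * (workload Λ.E.graph Λ.E.weight L s + 1) ∧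
      (σ'.f 13 = fun _ => 0) ∧ σ'.out = σ.out ∧ σ'.lr 0 = σ.lr 0 ∧
      (∀ i, (i < 3 ∨ i = 12) → σ'.r i = σ.r i) ∧
      ∃ σ₁ que d par idx dep, σ₁.f = f ∧ (σ₁.lm = fun _ => 0) ∧ Linked σ₁ σ' que d par idx ∧
      Found Λ s (sdist Λ.E.graph Λ.E.weight L s) que d par idx dep) σ := by
  have hz := fun g h1 h2 => hT.zero g h1 h2
  rw [searchCmd, WP_seq]
  refine WP.mono (radiusCmd_spec hT.forest s σ hf h2) ?_
  rintro t σ₁ ⟨h1, h3, hρ, hr, hl, hf', hlm', ho⟩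
  have hf1 : σ₁.f = f := hf'.trans hf
  refine WP.mono (startCmd_exploreCmd_spec hQ hρ h3 (by rw [hr 2 (by norm_num) (by norm_num), h2])
    (by rw [hf1, hz 8 (by norm_num) (by norm_num)]) (by rw [hf1, hz 9 (by norm_num) (by norm_num)])
    (by rw [hf1, hz 10 (by norm_num) (by norm_num)])
    (by rw [hf1, hz 11 (by norm_num) (by norm_num)])
    (by rw [hf1, hz 13 (by norm_num) (by norm_num)]) (hlm'.trans hlm)) ?_
  rintro t' σ' ⟨j1, j2, que, d, par', idx, dep, hL, hF⟩
  refine ⟨?_, j2, hL.out.trans ho, (hL.lreg 0 (by norm_num)).trans hl, fun i hi => ?_, σ₁, que, d,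
    par', idx, dep, hf1, hlm'.trans hlm, hL, hF⟩
  · have hc := card_ball_le Λ.E.graph Λ.E.weight L s
    have e : ∑ v with wdist Λ.E.graph Λ.E.weight s v < sdist Λ.E.graph Λ.E.weight L s,
        (deg Λ.E.graph v + 1) = workload Λ.E.graph Λ.E.weight L s := by
      rw [workload, ball]
    rw [e] at j1
    have : (2 * g + 1000) * (workload Λ.E.graph Λ.E.weight L s + 1) =
      workload Λ.E.graph Λ.E.weight L s * (2 * g + 300) +
        700 * workload Λ.E.graph Λ.E.weight L s + 2 * g + 1000 := by ring
    omega
  · rw [hL.reg i (by omega), hr i (by omega) (by omega)]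

/-- Clean up after a search and after the output of a path. -/
theorem cleanCmd_spec' {L : Finset (Fin n)} {k : ℕ}
    {f : ℕ → ℕ → ℕ} {par : Fin n → Fin n} {rk : Fin n → ℕ} (hT : Tables Λ L k f par rk)
    {s : Fin n} {σ₀ σ σ' : AS} {que : List (Fin n)} {d : Fin n → ℝ≥0} {par' : Fin n → Fin n}
    {idx dep : Fin n → ℕ} (hf : σ₀.f = f) (hlm : σ₀.lm = fun _ => 0)
    (hl : Linked σ₀ σ que d par' idx)
    (hF : Found Λ s (sdist Λ.E.graph Λ.E.weight L s) que d par' idx dep)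
    (h13 : σ.f 13 = fun _ => 0) (hf' : σ'.f = σ.f) (hlm' : σ'.lm = σ.lm) (h6 : σ'.r 6 = σ.r 6) :
    WP Λ cleanCmd (fun t σ'' => t ≤ 100 * ((ball Λ.E.graph Λ.E.weight L s).card + 1) ∧
      σ''.f = f ∧ (σ''.lm = fun _ => 0) ∧ σ''.out = σ'.out ∧
      (∀ i, (i < 4 ∨ i = 12) → σ''.r i = σ'.r i) ∧ σ''.lr 0 = σ'.lr 0) σ' := by
  have hz := fun g h1 h2 => hT.zero g h1 h2
  have hL : Linked { σ' with f := f, lm := fun _ => 0 } σ' que d par' idx :=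
    { nodup := hl.nodup
      r6 := h6.trans hl.r6
      f11 := by rw [hf']; exact hl.f11
      f8 := by rw [hf']; exact hl.f8
      f9 := by rw [hf']; exact hl.f9
      f10 := by rw [hf']; exact hl.f10
      lm := by rw [hlm']; exact hl.lm
      out_que := by rw [hf', hlm']; exact hl.out_que
      rest := fun g h1 h2 h3 h4 h5 => by rw [hf', hl.rest g h1 h2 h3 h4 h5, hf]
      out := rfl
      reg := fun _ _ => rfl
      lreg := fun _ _ => rfl }
  refine WP.mono (cleanCmd_spec hL (by rw [hf', h13]; exact (hz 13 (by norm_num) (by norm_num)).symm)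
    (hz 8 (by norm_num) (by norm_num)) (hz 9 (by norm_num) (by norm_num))
    (hz 10 (by norm_num) (by norm_num)) (hz 11 (by norm_num) (by norm_num)) rfl) ?_
  rintro t σ'' ⟨h1, h2, h3, h4, h5, h6⟩
  refine ⟨?_, h2, h3, h4, h5, h6⟩
  have : que.length = (ball Λ.E.graph Λ.E.weight L s).card := by
    rw [← List.toFinset_card_of_nodup hl.nodup]
    congr 1
    ext v
    rw [List.mem_toFinset, hF.mem, mem_ball]
  rwa [this] at h1

/-- The state between the phases of a query. -/
structure Ready (f : ℕ → ℕ → ℕ) (u v : Fin n) (σ : AS) : Prop where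
  f : σ.f = f
  lm : σ.lm = fun _ => 0
  r0 : σ.r 0 = u
  r1 : σ.r 1 = v

/-- Nothing has been found yet. -/
structure Fresh (σ : AS) : Prop where
  r12 : σ.r 12 = 0
  lr : σ.lr 0 = 0
  out : σ.out = []

section phases
variable {L : Finset (Fin n)} {k : ℕ} {f : ℕ → ℕ → ℕ} {par : Fin n → Fin n} {rk : Fin n → ℕ}
  {u v : Fin n} {σ : AS}

/-- The pointers of a search from `v` lead from `u` to `v`, so the path is written in the right
order as it is followed. -/
theorem forwardCmd_spec (hQ : IsQueue Λ upd pop g inv) (hT : Tables Λ L k f par rk)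
    (hσ : Ready f u v σ) (hσ' : Fresh σ) :
    WP Λ (forwardCmd upd pop) (fun t σ' => Ready f u v σ' ∧
      ((u ∉ ball Λ.E.graph Λ.E.weight L v ∧ Fresh σ' ∧
        t ≤ (2 * g + 1000) * (workload Λ.E.graph Λ.E.weight L v + 1)) ∨
      (σ'.r 12 = 1 ∧ ∃ p : Λ.E.graph.Walk u v, σ'.out = p.support.map Fin.val ∧
        σ'.lr 0 = walkLen Λ.E.weight p ∧
        (walkLen Λ.E.weight p : ℝ≥0∞) = wdist Λ.E.graph Λ.E.weight u v ∧
        t ≤ (2 * g + 1000) * (workload Λ.E.graph Λ.E.weight L v + 1) + 60 * p.length))) σ := by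
  have hR := Λ.hR
  have hu2 := u.2
  rw [forwardCmd, WP_seq, WP_asg]
  refine ⟨by simp, ?_⟩
  rw [WP_seq]
  refine WP.mono (searchCmd_spec hQ hT v _ hσ.f hσ.lm (by simp [hσ.r1])) ?_
  rintro t σ₁ ⟨h1, h13, ho, hl0, hr, σ₀, que, d, par', idx, dep, hf0, hlm0, hL, hF⟩
  have r0 : σ₁.r 0 = u := by rw [hr 0 (by norm_num)]; simp [hσ.r0]
  have r1 : σ₁.r 1 = v := by rw [hr 1 (by norm_num)]; simp [hσ.r1]
  have r12 : σ₁.r 12 = 0 := by rw [hr 12 (by norm_num)]; simp [hσ'.r12]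
  have lr0 : σ₁.lr 0 = 0 := by rw [hl0]; exact hσ'.lr
  have out0 : σ₁.out = [] := by rw [ho]; exact hσ'.out
  have h8 : σ₁.f 8 u = if u ∈ que then 1 else 0 := by
    rw [hL.f8]; simp [Fin.val_inj]
  rw [WP_seq, WP_ite]
  refine ⟨by simp [r0]; omega, fun hc => ?_, fun hc => ?_⟩
  · simp only [Cnd.holds, Ex.ev, r0, h8] at hc
    have hu : u ∈ que := by
      by_contra h; simp [h] at hc
    obtain ⟨hP, hcl⟩ := hF.exists_climb hL
    obtain ⟨P, c1, c2, c3⟩ := hcl u hu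
    simp [r0]
    refine WP.mono (fwdCmd_spec (by norm_num) (by norm_num) P c1 _ hP hu (by simp)) ?_
    rintro t' σ₂ ⟨k1, -, k3, k4, k5, k6, k7⟩
    simp [r0, lr0, out0] at k3 k4 k5 k6 k7
    refine WP.mono (cleanCmd_spec' hT hf0 hlm0 hL hF h13 k5 k6
      (by rw [k3 6 (by norm_num)]; simp)) ?_
    rintro t'' σ₃ ⟨m1, m2, m3, m4, m5, m6⟩
    refine ⟨⟨m2, m3, ?_, ?_⟩, .inr ⟨?_, P, ?_, ?_, ?_, ?_⟩⟩
    · rw [m5 0 (by norm_num), k3 0 (by norm_num)]; simp [r0]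
    · rw [m5 1 (by norm_num), k3 1 (by norm_num)]; simp [r1]
    · rw [m5 12 (by norm_num), k3 12 (by norm_num)]; simp
    · rw [m4, k7, ← List.map_tail, ← List.map_cons, P.cons_tail_support]
    · rw [m6, k4]
    · rw [c3, wdist_comm]
    · omega
  · simp only [Cnd.holds, Ex.ev, r0, h8] at hc
    have hu : u ∉ que := by
      intro h; simp [h] at hc
    rw [WP_skip]
    refine WP.mono (cleanCmd_spec' hT hf0 hlm0 hL hF h13 rfl rfl rfl) ?_
    rintro t'' σ₃ ⟨m1, m2, m3, m4, m5, m6⟩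
    refine ⟨⟨m2, m3, by rw [m5 0 (by norm_num), r0], by rw [m5 1 (by norm_num), r1]⟩,
      .inl ⟨?_, ⟨by rw [m5 12 (by norm_num), r12], by rw [m6, lr0], by rw [m4, out0]⟩, ?_⟩⟩
    · rwa [mem_ball, ← hF.mem]
    · simp; omega

/-- Here the pointers lead from `v` back to `u`, so the path is reversed by means of the stack,
which is empty again afterwards. -/
theorem backwardCmd_spec (hQ : IsQueue Λ upd pop g inv) (hT : Tables Λ L k f par rk)
    (hσ : Ready f u v σ) (hσ' : Fresh σ) :
    WP Λ (backwardCmd upd pop) (fun t σ' => Ready f u v σ' ∧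
      ((v ∉ ball Λ.E.graph Λ.E.weight L u ∧ Fresh σ' ∧
        t ≤ (2 * g + 1000) * (workload Λ.E.graph Λ.E.weight L u + 1)) ∨
      (σ'.r 12 = 1 ∧ ∃ p : Λ.E.graph.Walk u v, σ'.out = p.support.map Fin.val ∧
        σ'.lr 0 = walkLen Λ.E.weight p ∧
        (walkLen Λ.E.weight p : ℝ≥0∞) = wdist Λ.E.graph Λ.E.weight u v ∧
        t ≤ (2 * g + 1000) * (workload Λ.E.graph Λ.E.weight L u + 1) + 120 * p.length))) σ := by
  have hR := Λ.hR
  have hv2 := v.2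
  rw [backwardCmd, WP_seq, WP_asg]
  refine ⟨by simp, ?_⟩
  rw [WP_seq]
  refine WP.mono (searchCmd_spec hQ hT u _ hσ.f hσ.lm (by simp [hσ.r0])) ?_
  rintro t σ₁ ⟨h1, h13, ho, hl0, hr, σ₀, que, d, par', idx, dep, hf0, hlm0, hL, hF⟩
  have r0 : σ₁.r 0 = u := by rw [hr 0 (by norm_num)]; simp [hσ.r0]
  have r1 : σ₁.r 1 = v := by rw [hr 1 (by norm_num)]; simp [hσ.r1]
  have r12 : σ₁.r 12 = 0 := by rw [hr 12 (by norm_num)]; simp [hσ'.r12]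
  have lr0 : σ₁.lr 0 = 0 := by rw [hl0]; exact hσ'.lr
  have out0 : σ₁.out = [] := by rw [ho]; exact hσ'.out
  have f12 : σ₁.f 12 = fun _ => 0 := by
    rw [hL.rest 12 (by norm_num) (by norm_num) (by norm_num) (by norm_num) (by norm_num), hf0,
      hT.zero 12 (by norm_num) (by norm_num)]
  have h8 : σ₁.f 8 v = if v ∈ que then 1 else 0 := by
    rw [hL.f8]; simp [Fin.val_inj]
  rw [WP_seq, WP_ite]
  refine ⟨by simp [r1]; omega, fun hc => ?_, fun hc => ?_⟩
  · simp only [Cnd.holds, Ex.ev, r1, h8] at hc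
    have hv : v ∈ que := by
      by_contra h; simp [h] at hc
    obtain ⟨hP, hcl⟩ := hF.exists_climb hL
    obtain ⟨P, c1, c2, c3⟩ := hcl v hv
    simp [r1]
    refine WP.mono (pushCmd_spec (q := 10) (by norm_num) (by norm_num) (by norm_num) P c1 _ hP hv
      (by simp) c2.le) ?_
    rintro t1 σ₂ ⟨i1, -, i3, i4, i5, i6, i7, i8, i9, i10⟩
    simp [r1, out0] at i4 i5 i6 i7 i8 i9 i10
    have e0 : σ₂.r 0 = u := by rw [i4 0 (by norm_num) (by norm_num)]; simp [r0]
    refine WP.mono (popCmd_spec (by norm_num) (by norm_num) (by norm_num) (by norm_num) P c1 _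
      (S := (· ∈ que)) ?_ hv (by simp [i3]) c2.le i7 (fun i hi => ?_)) ?_
    · intro y hy
      have := hP y hy
      simp [i6 9 (by norm_num), i6 10 (by norm_num)]
      exact this
    · simp [i8 i hi, f12]
    rintro t' σ₃ ⟨k1, k3, k4, k5, k5', k6, k7⟩
    simp [e0, i5, i10, lr0, i9] at k3 k4 k5 k6 k7
    have ef : σ₃.f = σ₁.f := by
      funext g
      by_cases hg : g = 12
      · subst hg; rw [f12]; funext i; exact k5' i
      · rw [k5 g hg, i6 g hg]
    refine WP.mono (cleanCmd_spec' hT hf0 hlm0 hL hF h13 ef k6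
      (by rw [k3 6 (by norm_num) (by norm_num), i4 6 (by norm_num) (by norm_num)]; simp)) ?_
    rintro t'' σ₄ ⟨m1, m2, m3, m4, m5, m6⟩
    refine ⟨⟨m2, m3, ?_, ?_⟩, .inr ⟨?_, P.reverse, ?_, ?_, ?_, ?_⟩⟩
    · rw [m5 0 (by norm_num), k3 0 (by norm_num) (by norm_num), e0]
    · rw [m5 1 (by norm_num), k3 1 (by norm_num) (by norm_num),
        i4 1 (by norm_num) (by norm_num)]; simp [r1]
    · rw [m5 12 (by norm_num), k3 12 (by norm_num) (by norm_num),
        i4 12 (by norm_num) (by norm_num)]; simp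
    · rw [m4, k7, ← P.reverse.cons_tail_support]; simp
    · rw [m6, k4, walkLen_reverse]
    · rw [walkLen_reverse, c3]
    · rw [SimpleGraph.Walk.length_reverse]; omega
  · simp only [Cnd.holds, Ex.ev, r1, h8] at hc
    have hu : v ∉ que := by
      intro h; simp [h] at hc
    rw [WP_skip]
    refine WP.mono (cleanCmd_spec' hT hf0 hlm0 hL hF h13 rfl rfl rfl) ?_
    rintro t'' σ₃ ⟨m1, m2, m3, m4, m5, m6⟩
    refine ⟨⟨m2, m3, by rw [m5 0 (by norm_num), r0], by rw [m5 1 (by norm_num), r1]⟩,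
      .inl ⟨?_, ⟨by rw [m5 12 (by norm_num), r12], by rw [m6, lr0], by rw [m4, out0]⟩, ?_⟩⟩
    · rwa [mem_ball, ← hF.mem]
    · simp; omega

/-- The climb from `v` comes first: it finds the landmark `y` and saves the last leg on the stack.
Then the climb from `u` to `x` and the route from `x` to `y` are written directly, and the stack is
emptied at the end. -/
theorem landmarkCmd_spec (hT : Tables Λ L k f par rk) (hσ : Ready f u v σ) (hσ' : Fresh σ)
    (huv : Λ.E.graph.Reachable u v) (hu : sdist Λ.E.graph Λ.E.weight L u ≠ ⊤)
    (hv : sdist Λ.E.graph Λ.E.weight L v ≠ ⊤) :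
    WP Λ landmarkCmd (fun t σ' => Ready f u v σ' ∧
      ∃ p : Λ.E.graph.Walk u v, σ'.out = p.support.map Fin.val ∧
        σ'.lr 0 = walkLen Λ.E.weight p ∧ t ≤ 400 * (p.length + 1) ∧
        ∃ x ∈ p.support, ∃ y ∈ p.support, IsNearest Λ.E.graph Λ.E.weight L u x ∧
          IsNearest Λ.E.graph Λ.E.weight L v y ∧
          (walkLen Λ.E.weight p : ℝ≥0∞) ≤ sdist Λ.E.graph Λ.E.weight L u +
            k * wdist Λ.E.graph Λ.E.weight x y + sdist Λ.E.graph Λ.E.weight L v) σ := by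
  have hF := hT.forest
  obtain ⟨x, P, hP, hPn, hx⟩ := hF.parents.exists_climb hF.rank u hu
  obtain ⟨y, Q, hQ, hQn, hy⟩ := hF.parents.exists_climb hF.rank v hv
  obtain ⟨hxL, hPl⟩ := hF.walkLen hP hu
  obtain ⟨hyL, hQl⟩ := hF.walkLen hQ hv
  have hxy : Λ.E.graph.Reachable x y := (P.reverse.reachable.trans huv).trans Q.reachable
  obtain ⟨W, hW, hWl⟩ := hT.route x hxL y hyL hxy
  have f12 : σ.f 12 = fun _ => 0 := by rw [hσ.f, hT.zero 12 (by norm_num) (by norm_num)]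
  have hpar := hF.parents
  rw [← hσ.f] at hpar hW
  rw [landmarkCmd, WP_seq, WP_asg]
  refine ⟨by simp, ?_⟩
  rw [WP_seq]
  refine WP.mono (pushCmd_spec (q := 3) (by norm_num) (by norm_num) (by norm_num) Q hQ _ hpar hv
      (by simp [hσ.r1]) hQn.le) ?_
  rintro t1 σ₂ ⟨i1, i2, i3, i4, i5, i6, i7, i8, i9, i10⟩
  simp at i4 i5 i6 i7 i8 i9 i10
  have e0 : σ₂.r 0 = u := by rw [i4 0 (by norm_num) (by norm_num)]; simp [hσ.r0]
  simp [e0, i2]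
  refine WP.mono (fwdCmd_spec (S := fun v => sdist Λ.E.graph Λ.E.weight L v ≠ ⊤) (by norm_num)
    (by norm_num) P hP _ ?_ hu (by simp)) ?_
  · intro y hy
    have := hpar y hy
    simp [i6 2 (by norm_num), i6 3 (by norm_num)]
    exact this
  rintro t2 σ₃ ⟨j1, j2, j3, j4, j5, j6, j7⟩
  simp [i10] at j3 j4 j5 j6 j7
  have hW' : Route Λ.E.graph σ₃.f Λ.x (16 * (Λ.R + 1)) Λ.N y W :=
    hW.congr fun g _ h7 => by rw [j5, i6 g (by omega)]
  refine WP.mono (routeCmd_spec hW' _ rfl j2 (by rw [j3 13 (by norm_num)]; simp)) ?_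
  rintro t3 σ₄ ⟨k1, k2, k3, k4, k5, k6, k7⟩
  refine WP.mono (popCmd_spec (S := fun v => sdist Λ.E.graph Λ.E.weight L v ≠ ⊤) (by norm_num)
    (by norm_num) (by norm_num) (by norm_num) Q hQ _ ?_ hv ?_ hQn.le ?_ ?_) ?_
  · intro y hy
    have := hpar y hy
    simp [k5, j5, i6 2 (by norm_num), i6 3 (by norm_num)]
    exact this
  · rw [k3 14 (by simp [IsRouteReg]), j3 14 (by norm_num)]; simp [i3]
  · rw [k5, j5]; exact i7
  · intro i hi
    rw [k5, j5, i8 i hi, f12]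
  rintro t4 σ₅ ⟨m1, m2, m3, m4, m5, m6, m7⟩
  refine ⟨⟨?_, ?_, ?_, ?_⟩, (P.append W).append Q.reverse, ?_, ?_, ?_, x, ?_, y, ?_, ?_, ?_, ?_⟩
  · rw [← hσ.f]
    funext g
    by_cases hg : g = 12
    · subst hg; rw [f12]; funext i; exact m5 i
    · rw [m4 g hg, k5, j5, i6 g hg]
  · rw [m6, k6, j6, i9, hσ.lm]
  · rw [m2 0 (by norm_num) (by norm_num), k3 0 (by simp [IsRouteReg]), j3 0 (by norm_num)]
    simp [e0]
  · rw [m2 1 (by norm_num) (by norm_num), k3 1 (by simp [IsRouteReg]), j3 1 (by norm_num)]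
    simp [i4 1 (by norm_num) (by norm_num), hσ.r1]
  · rw [m7, k7, j7, hσ'.out]
    rw [SimpleGraph.Walk.support_append, SimpleGraph.Walk.support_append, List.map_append, List.map_append]
    have e : (u : ℕ) :: (P.support.map Fin.val).tail = P.support.map Fin.val := by
      rw [← List.map_tail, ← List.map_cons, P.cons_tail_support]
    simp
    rw [← List.cons_append, e]
  · rw [m3, k4, j4, i5, hσ'.lr]; simp
  · simp; omega
  · simp
  · simp
  · exact ⟨hxL, fun z hz => (wdist_le P).trans (hPl.trans_le (sdist_le hz))⟩
  · exact ⟨hyL, fun z hz => (wdist_le Q).trans (hQl.trans_le (sdist_le hz))⟩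
  · simp only [walkLen_append, walkLen_reverse, ENNReal.coe_add, hPl, hQl]
    gcongr

/-- When both searches fail, each end is at least as far from the other end as from its nearest
landmark, and the stretch is `1 + (2 * k - 1) * 3 + 1 = 6 * k - 1`. The finite distance also shows
that both ends do reach a landmark. -/
theorem queryCmd_spec (hQ : IsQueue Λ upd pop g inv) {k : ℕ} (hk : 1 ≤ k)
    (hT : Tables Λ L (2 * k - 1) f par rk)
    (hσ : Ready f u v σ) (hσ' : Fresh σ) :
    WP Λ (queryCmd upd pop) (fun t σ' => σ'.f = f ∧ (σ'.lm = fun _ => 0) ∧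
      ∃ o : List (Fin n), σ'.out = o.map Fin.val ∧
        Correct Λ.E.graph Λ.E.weight k L u v o (σ'.lr 0) ∧
        t ≤ (2 * g + 1000) * (workload Λ.E.graph Λ.E.weight L u +
          workload Λ.E.graph Λ.E.weight L v + 3) + 400 * hops o) σ := by
  have hR := Λ.hR
  have hu2 := u.2
  have hv2 := v.2
  have exact_correct : ∀ (p : Λ.E.graph.Walk u v) (δ : ℝ≥0), δ = walkLen Λ.E.weight p →
      (walkLen Λ.E.weight p : ℝ≥0∞) = wdist Λ.E.graph Λ.E.weight u v →
      Correct Λ.E.graph Λ.E.weight k L u v p.support δ := by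
    rintro p δ rfl h2
    refine ⟨fun _ => ⟨p, rfl, rfl, ?_, .inl h2⟩, fun h => absurd p.reachable h⟩
    rw [h2]
    refine le_mul_of_one_le_left zero_le ?_
    exact_mod_cast (by omega : 1 ≤ 6 * k - 1)
  have hhops : ∀ p : Λ.E.graph.Walk u v, hops p.support = p.length := by
    intro p; simp [hops]
  have e3 : (2 * g + 1000) * (workload Λ.E.graph Λ.E.weight L u +
      workload Λ.E.graph Λ.E.weight L v + 3) =
    (2 * g + 1000) * (workload Λ.E.graph Λ.E.weight L u + 1) +
      (2 * g + 1000) * (workload Λ.E.graph Λ.E.weight L v + 1) + 2 * g + 1000 := by ring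
  rw [queryCmd, WP_ite]
  refine ⟨by simp [hσ.r0, hσ.r1]; omega, fun hc => ?_, fun hc => ?_⟩
  · simp only [Cnd.holds, Ex.ev, hσ.r0, hσ.r1, hσ.f] at hc
    have huv := (hT.comp u v).1 hc
    rw [WP_seq]
    refine WP.mono (forwardCmd_spec hQ hT hσ hσ') ?_
    rintro t1 σ₁ ⟨hσ1, ⟨h1, hσ1', ht1⟩ | ⟨h1, p, h2, h3, h4, h5⟩⟩
    · rw [WP_ite]
      refine ⟨by simp, fun _ => ?_, fun hc => absurd hσ1'.r12 hc⟩
      rw [WP_seq]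
      refine WP.mono (backwardCmd_spec hQ hT hσ1 hσ1') ?_
      rintro t2 σ₂ ⟨hσ2, ⟨h2, hσ2', ht2⟩ | ⟨h2, p, h3, h4, h5, h6⟩⟩
      · rw [mem_ball, not_lt] at h1 h2
        have hd : wdist Λ.E.graph Λ.E.weight u v ≠ ⊤ := wdist_ne_top.2 huv
        rw [wdist_comm] at h1
        rw [WP_ite]
        refine ⟨by simp, fun _ => ?_, fun hc => absurd hσ2'.r12 hc⟩
        refine WP.mono (landmarkCmd_spec hT hσ2 hσ2' huv (ne_top_of_le_ne_top hd h2)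
          (ne_top_of_le_ne_top hd h1)) ?_
        rintro t3 σ₃ ⟨hσ3, p, k1, k2, k3, x, hx, y, hy, hxn, hyn, k4⟩
        refine ⟨hσ3.f, hσ3.lm, p.support, k1, ⟨fun _ => ⟨p, rfl, k2, ?_, .inr ⟨x, hx, y, hy,
          hxn, hyn⟩⟩, fun h => absurd huv h⟩, ?_⟩
        · have ex : wdist Λ.E.graph Λ.E.weight u x ≤ wdist Λ.E.graph Λ.E.weight u v :=
            le_trans (le_iInf₂ hxn.2) h2
          have ey : wdist Λ.E.graph Λ.E.weight v y ≤ wdist Λ.E.graph Λ.E.weight u v :=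
            le_trans (le_iInf₂ hyn.2) h1
          have exy : wdist Λ.E.graph Λ.E.weight x y ≤ 3 * wdist Λ.E.graph Λ.E.weight u v := by
            calc wdist Λ.E.graph Λ.E.weight x y
                ≤ wdist Λ.E.graph Λ.E.weight x u + wdist Λ.E.graph Λ.E.weight u y :=
                  wdist_triangle _ _ _
              _ ≤ wdist Λ.E.graph Λ.E.weight x u + (wdist Λ.E.graph Λ.E.weight u v +
                  wdist Λ.E.graph Λ.E.weight v y) := by gcongr; exact wdist_triangle _ _ _
              _ ≤ wdist Λ.E.graph Λ.E.weight u v + (wdist Λ.E.graph Λ.E.weight u v +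
                  wdist Λ.E.graph Λ.E.weight u v) := by rw [wdist_comm x u]; gcongr
              _ = 3 * wdist Λ.E.graph Λ.E.weight u v := by ring
          rw [k2]
          refine k4.trans ?_
          calc sdist Λ.E.graph Λ.E.weight L u + ((2 * k - 1 : ℕ) : ℝ≥0∞) *
                wdist Λ.E.graph Λ.E.weight x y + sdist Λ.E.graph Λ.E.weight L v
              ≤ wdist Λ.E.graph Λ.E.weight u v + ((2 * k - 1 : ℕ) : ℝ≥0∞) *
                (3 * wdist Λ.E.graph Λ.E.weight u v) + wdist Λ.E.graph Λ.E.weight u v := by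
                gcongr
            _ = ((1 + (2 * k - 1) * 3 + 1 : ℕ) : ℝ≥0∞) * wdist Λ.E.graph Λ.E.weight u v := by
                push_cast; ring
            _ = _ := by congr 2; omega
        · rw [hhops]
          simp
          omega
      · rw [WP_ite]
        refine ⟨by simp, fun hc => absurd (hc.symm.trans h2) (by simp), fun _ => ?_⟩
        rw [WP_skip]
        refine ⟨hσ2.f, hσ2.lm, p.support, h3, exact_correct p _ h4 h5, ?_⟩
        rw [hhops]
        simp
        omega
    · rw [WP_ite]
      refine ⟨by simp, fun hc => absurd (hc.symm.trans h1) (by simp), fun _ => ?_⟩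
      rw [WP_skip]
      refine ⟨hσ1.f, hσ1.lm, p.support, h2, exact_correct p _ h3 h4, ?_⟩
      rw [hhops]
      simp
      omega
  · simp only [Cnd.holds, Ex.ev, hσ.r0, hσ.r1, hσ.f] at hc
    have huv := fun h => hc ((hT.comp u v).2 h)
    rw [WP_skip]
    refine ⟨hσ.f, hσ.lm, [], by simp [hσ'.out], ⟨fun h => absurd h huv, fun _ => rfl⟩, ?_⟩
    simp
    omega

end phases

end DistOracle
end

noncomputable section
namespace DistOracle

/-! ## Spanners -/

section spanner
variable {n : ℕ}

/-- The graph has no cycle of length at most `2 * k`. -/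
def HighGirth (F : SimpleGraph (Fin n)) (k : ℕ) : Prop :=
  ∀ v x, F.Adj v x → ∀ p : F.Walk v x, p.length ≤ 2 * k - 1 → s(v, x) ∈ p.edges

lemma HighGirth.anti {F H : SimpleGraph (Fin n)} {k : ℕ} (hF : HighGirth F k) (h : H ≤ F) :
    HighGirth H k := by
  intro v x hvx p hp
  simpa using hF v x (h hvx) (p.mapLe h) (by simpa using hp)

lemma exists_split_edge {F : SimpleGraph (Fin n)} {x y : Fin n} {v z : Fin n}
    (p : (F ⊔ SimpleGraph.fromEdgeSet {s(x, y)}).Walk v z) (hp : p.edges.Nodup)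
    (h : s(x, y) ∈ p.edges) :
    ∃ a b, ∃ (p₁ : F.Walk v a) (p₂ : F.Walk b z), s(a, b) = s(x, y) ∧
      p₁.length + 1 + p₂.length = p.length := by
  induction p with
  | nil => simp at h
  | @cons v v' z ha q ih =>
    rw [SimpleGraph.Walk.edges_cons, List.nodup_cons] at hp
    by_cases he : s(v, v') = s(x, y)
    · refine ⟨v, v', .nil, q.transfer F fun e heq => ?_, he, by simp; ring⟩
      have h1 := q.edges_subset_edgeSet heq
      rw [SimpleGraph.edgeSet_sup] at h1
      rcases h1 with h1 | h1
      · exact h1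
      · rw [SimpleGraph.edgeSet_fromEdgeSet] at h1
        have : e = s(x, y) := h1.1
        exact absurd ((he.trans this.symm) ▸ heq) hp.1
    · rw [SimpleGraph.Walk.edges_cons, List.mem_cons] at h
      obtain ⟨a, b, p₁, p₂, h1, h2⟩ := ih hp.2 (h.resolve_left fun h => he h.symm)
      have hF : F.Adj v v' := by
        rw [SimpleGraph.sup_adj, SimpleGraph.fromEdgeSet_adj] at ha
        exact ha.resolve_right fun h => he h.1
      exact ⟨a, b, .cons hF p₁, p₂, h1, by simp; omega⟩

/-- A short cycle through the new edge would leave, after deleting this edge, a walk between its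
ends of length at most `2 * k - 1` in the old graph; a short cycle avoiding it is excluded already.
-/
lemma HighGirth.add_edge {F : SimpleGraph (Fin n)} {k : ℕ} (hF : HighGirth F k) {x y : Fin n}
    (hxy : ∀ p : F.Walk x y, 2 * k - 1 < p.length) :
    HighGirth (F ⊔ SimpleGraph.fromEdgeSet {s(x, y)}) k := by
  classical
  have key : ∀ a b, s(a, b) = s(x, y) → ∀ p : F.Walk a b, 2 * k - 1 < p.length := by
    intro a b hab p
    rw [Sym2.eq_iff] at hab
    rcases hab with ⟨rfl, rfl⟩ | ⟨rfl, rfl⟩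
    · exact hxy p
    · simpa using hxy p.reverse
  intro v z hvz p hp
  by_contra hnot
  have hb : s(v, z) ∉ p.bypass.edges := fun h => hnot (p.edges_bypass_subset_edges h)
  have hlen : p.bypass.length ≤ 2 * k - 1 := p.length_bypass_le_length.trans hp
  by_cases hmem : s(x, y) ∈ p.bypass.edges
  · obtain ⟨a, b, p₁, p₂, h1, h2⟩ := exists_split_edge _ p.bypass_isPath.isTrail.edges_nodup hmem
    have hF' : F.Adj v z := by
      rw [SimpleGraph.sup_adj, SimpleGraph.fromEdgeSet_adj] at hvz
      refine hvz.resolve_right fun h => hb ?_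
      rw [show s(v, z) = s(x, y) from h.1]
      exact hmem
    -- Go around the cycle the other way: the edge from `v` to `z` replaces the new edge, so the
    -- length is that of the bypass.
    have := key a b h1 (p₁.reverse.append (.cons hF' p₂.reverse))
    simp at this
    omega
  · have hq : ∀ e ∈ p.bypass.edges, e ∈ F.edgeSet := by
      intro e he
      have h1 := p.bypass.edges_subset_edgeSet he
      rw [SimpleGraph.edgeSet_sup] at h1
      rcases h1 with h1 | h1
      · exact h1
      · rw [SimpleGraph.edgeSet_fromEdgeSet] at h1
        rw [show e = s(x, y) from h1.1] at he
        exact absurd he hmem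
    rw [SimpleGraph.sup_adj, SimpleGraph.fromEdgeSet_adj] at hvz
    rcases hvz with hvz | hvz
    · have := hF v z hvz (p.bypass.transfer F hq) (by simpa using hlen)
      rw [SimpleGraph.Walk.edges_transfer] at this
      exact hb this
    · have := key v z hvz.1 (p.bypass.transfer F hq)
      simp at this
      omega

/-- The greedy spanner. -/
theorem exists_spanner (G : SimpleGraph (Fin n)) (w : Sym2 (Fin n) → ℝ≥0) (L : Finset (Fin n))
    (k : ℕ) (hk : 1 ≤ k) : ∃ F : SimpleGraph (Fin n), HighGirth F k ∧
      (∀ x y, F.Adj x y → x ∈ L ∧ y ∈ L ∧ G.Reachable x y) ∧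
      ∀ x ∈ L, ∀ y ∈ L, G.Reachable x y → ∃ p : F.Walk x y, p.length ≤ 2 * k - 1 ∧
        ∀ a b, s(a, b) ∈ p.edges → wdist G w a b ≤ wdist G w x y := by
  classical
  have main : ∀ s : Finset (Fin n × Fin n),
      (∀ e ∈ s, e.1 ∈ L ∧ e.2 ∈ L ∧ G.Reachable e.1 e.2) →
      ∃ F : SimpleGraph (Fin n), HighGirth F k ∧
      (∀ x y, F.Adj x y → (x, y) ∈ s ∨ (y, x) ∈ s) ∧
      ∀ e ∈ s, ∃ p : F.Walk e.1 e.2, p.length ≤ 2 * k - 1 ∧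
        ∀ a b, s(a, b) ∈ p.edges → wdist G w a b ≤ wdist G w e.1 e.2 := by
    intro s
    -- The greedy order: the pair inserted last is the longest. Hence all edges of the spanner at
    -- that time are no longer than the pair itself, and any path of few edges will do.
    induction s using Finset.induction_on_max_value (fun e : Fin n × Fin n => wdist G w e.1 e.2) with
    | empty =>
      refine fun _ => ⟨⊥, ?_, by simp, by simp⟩
      intro v x h
      simp at h
    | insert e s he hmax ih =>
      intro hs
      obtain ⟨F, h1, h2, h3⟩ := ih fun e' he' => hs e' (Finset.mem_insert_of_mem he')
      have hle : ∀ a b, F.Adj a b → wdist G w a b ≤ wdist G w e.1 e.2 := by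
        intro a b hab
        rcases h2 a b hab with h | h
        · exact hmax _ h
        · rw [wdist_comm]; exact hmax _ h
      by_cases hp : ∃ p : F.Walk e.1 e.2, p.length ≤ 2 * k - 1
      · obtain ⟨p, hp⟩ := hp
        refine ⟨F, h1, fun x y hxy => ?_, fun e' he' => ?_⟩
        · rcases h2 x y hxy with h | h
          · exact .inl (Finset.mem_insert_of_mem h)
          · exact .inr (Finset.mem_insert_of_mem h)
        · rcases Finset.mem_insert.1 he' with rfl | he'
          · exact ⟨p, hp, fun a b hab => hle a b (p.adj_of_mem_edges hab)⟩
          · exact h3 e' he'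
      · push Not at hp
        have hne : e.1 ≠ e.2 := by
          intro h
          have := hp (SimpleGraph.Walk.nil.copy rfl h)
          simp at this
        have hadj : (F ⊔ SimpleGraph.fromEdgeSet {s(e.1, e.2)}).Adj e.1 e.2 := by
          rw [SimpleGraph.sup_adj, SimpleGraph.fromEdgeSet_adj]
          exact .inr ⟨rfl, hne⟩
        refine ⟨_, h1.add_edge hp, fun x y hxy => ?_, fun e' he' => ?_⟩
        · rw [SimpleGraph.sup_adj, SimpleGraph.fromEdgeSet_adj] at hxy
          rcases hxy with hxy | ⟨hxy, -⟩
          · rcases h2 x y hxy with h | h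
            · exact .inl (Finset.mem_insert_of_mem h)
            · exact .inr (Finset.mem_insert_of_mem h)
          · rw [Set.mem_singleton_iff, Sym2.eq_iff] at hxy
            rcases hxy with ⟨rfl, rfl⟩ | ⟨rfl, rfl⟩
            · exact .inl (Finset.mem_insert_self _ _)
            · exact .inr (Finset.mem_insert_self _ _)
        · rcases Finset.mem_insert.1 he' with rfl | he'
          · refine ⟨.cons hadj .nil, by simp; omega, fun a b hab => ?_⟩
            simp only [SimpleGraph.Walk.edges_cons, SimpleGraph.Walk.edges_nil,
              List.mem_singleton, Sym2.eq_iff] at hab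
            rcases hab with ⟨rfl, rfl⟩ | ⟨rfl, rfl⟩
            · exact le_rfl
            · rw [wdist_comm]
          · obtain ⟨p, hp1, hp2⟩ := h3 e' he'
            exact ⟨p.mapLe le_sup_left, by simpa using hp1, fun a b hab => hp2 a b (by simpa using hab)⟩
  obtain ⟨F, h1, h2, h3⟩ := main ((L ×ˢ L).filter fun e => G.Reachable e.1 e.2) (by simp; tauto)
  refine ⟨F, h1, fun x y hxy => ?_, fun x hx y hy hxy => ?_⟩
  · rcases h2 x y hxy with h | h
    · simp at h; tauto
    · simp at h; exact ⟨h.1.2, h.1.1, h.2.symm⟩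
  · exact h3 (x, y) (by simp [hx, hy, hxy])

end spanner

/-! ## The number of edges of a graph of high girth -/

section moore
variable {n : ℕ} {H : SimpleGraph (Fin n)} {k : ℕ}

/-- Shortest paths from `r` to `a` and to `b` avoid `v`; together with the edge from `v` to `b` they
give a short walk from `v` to `a` that does not use the edge between these two. -/
lemma HighGirth.unique_back (hH : HighGirth H k) {r v a b : Fin n} {j : ℕ} (hb : H.Reachable r b)
    (hv : H.dist r v = j + 1) (hva : H.Adj v a) (hvb : H.Adj v b) (hab : a ≠ b)
    (hdb : H.dist r b = j) (hda : H.dist r a ≤ j + 1) (hlen : 1 + j + H.dist r a ≤ 2 * k - 1) :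
    False := by
  have ha : H.Reachable r a := hb.trans (hvb.symm.reachable.trans hva.reachable)
  obtain ⟨P, hP⟩ := hb.exists_walk_length_eq_dist
  obtain ⟨Q, hQ⟩ := ha.exists_walk_length_eq_dist
  have hvP : v ∉ P.support := by
    intro h
    have h1 := SimpleGraph.dist_le (P.takeUntil v h)
    have h2 := P.length_takeUntil_le_length h
    omega
  have hvQ : v ∉ Q.support := by
    intro h
    have h1 := SimpleGraph.dist_le (Q.takeUntil v h)
    have h2 := Q.length_takeUntil_lt_length h hva.ne
    omega
  have := hH v a hva (.cons hvb (P.reverse.append Q)) (by simp; omega)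
  simp only [SimpleGraph.Walk.edges_cons, SimpleGraph.Walk.edges_append,
    SimpleGraph.Walk.edges_reverse, List.mem_cons, List.mem_append, List.mem_reverse] at this
  rcases this with h | h | h
  · rw [Sym2.eq_iff] at h
    rcases h with ⟨-, h⟩ | ⟨h, -⟩
    · exact hab h
    · exact hvb.ne h
  · exact hvP (P.fst_mem_support_of_mem_edges h)
  · exact hvQ (Q.fst_mem_support_of_mem_edges h)

open Classical in
/-- The vertices at distance `i` from `r`. -/
def sphere (H : SimpleGraph (Fin n)) (r : Fin n) (i : ℕ) : Finset (Fin n) :=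
  Finset.univ.filter fun v => H.Reachable r v ∧ H.dist r v = i

-- Double counting of the edges between two consecutive spheres. By `HighGirth.unique_back`, a
-- vertex has at most one neighbour that is not farther from `r` than itself, hence at least `d`
-- neighbours in the next sphere, and each vertex there has at most one neighbour in the present
-- sphere.
open Classical in
lemma HighGirth.sphere_growth (hH : HighGirth H k) {r : Fin n} {d : ℕ}
    (hd : ∀ v, H.Reachable r v → d + 1 ≤ (Finset.univ.filter (H.Adj v)).card) {i : ℕ}
    (hi : i + 1 ≤ k) : (sphere H r i).card * d ≤ (sphere H r (i + 1)).card := by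
  rw [← mul_one (sphere H r (i + 1)).card]
  refine Finset.card_mul_le_card_mul H.Adj ?_ ?_
  · intro v hv
    simp only [sphere, Finset.mem_filter, Finset.mem_univ, true_and] at hv
    have h1 := hd v hv.1
    set N := Finset.univ.filter (H.Adj v)
    have hback : (N.filter fun a => H.dist r a ≤ i).card ≤ 1 := by
      rw [Finset.card_le_one]
      intro a ha b hb
      simp only [N, Finset.mem_filter, Finset.mem_univ, true_and] at ha hb
      by_contra hab
      cases i with
      | zero =>
        have hra : H.Reachable r a := hv.1.trans ha.1.reachable
        have h0 : r = a := hra.dist_eq_zero_iff.1 (by omega)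
        have h1 : r = v := hv.1.dist_eq_zero_iff.1 hv.2
        exact ha.1.ne (h1.symm.trans h0)
      | succ j =>
        obtain ⟨P, hP⟩ := hv.1.symm.exists_walk_length_eq_dist
        have hrv : H.dist v r = j + 1 := by rw [SimpleGraph.dist_comm]; exact hv.2
        cases P with
        | nil => rw [SimpleGraph.dist_self] at hrv; omega
        | @cons _ c _ hc P' =>
          simp only [SimpleGraph.Walk.length_cons] at hP
          have hrc : H.Reachable r c := P'.reverse.reachable
          have hcd : H.dist r c = j := by
            have h1 := SimpleGraph.dist_le P'.reverse
            obtain ⟨Q, hQ⟩ := hrc.exists_walk_length_eq_dist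
            have h2 := SimpleGraph.dist_le (Q.append (SimpleGraph.Walk.cons hc.symm .nil))
            simp at h1 h2
            omega
          -- `c` is the neighbour of `v` on a shortest path to `r`. One of `a` and `b` differs from
          -- it and yields the contradiction.
          by_cases hac : a = c
          · subst hac
            exact hH.unique_back hrc hv.2 hb.1 hc (Ne.symm hab) hcd hb.2 (by omega)
          · exact hH.unique_back hrc hv.2 ha.1 hc hac hcd ha.2 (by omega)
    have hsub : N ⊆ (N.filter fun a => H.dist r a ≤ i) ∪
        (sphere H r (i + 1)).bipartiteAbove H.Adj v := by
      intro a ha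
      simp only [N, Finset.mem_filter, Finset.mem_univ, true_and] at ha
      obtain ⟨P, hP⟩ := hv.1.exists_walk_length_eq_dist
      have h2 := SimpleGraph.dist_le (P.append (SimpleGraph.Walk.cons ha .nil))
      simp at h2
      simp only [N, Finset.mem_union, Finset.mem_filter, Finset.mem_univ, true_and,
        Finset.mem_bipartiteAbove, sphere]
      by_cases h : H.dist r a ≤ i
      · exact .inl ⟨ha, h⟩
      · exact .inr ⟨⟨hv.1.trans ha.reachable, by omega⟩, ha⟩
    have := (Finset.card_le_card hsub).trans (Finset.card_union_le _ _)
    omega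
  · intro v hv
    simp only [sphere, Finset.mem_filter, Finset.mem_univ, true_and] at hv
    rw [Finset.card_le_one]
    intro a ha b hb
    simp only [Finset.mem_bipartiteBelow, sphere, Finset.mem_filter, Finset.mem_univ,
      true_and] at ha hb
    by_contra hab
    exact hH.unique_back hb.1.1 hv.2 ha.2.symm hb.2.symm hab hb.1.2 (by omega) (by omega)

-- The Moore bound: in the graph induced on `S`, the spheres around a vertex grow by a factor `d` up
-- to radius `k`.
open Classical in
lemma HighGirth.pow_le_card {F : SimpleGraph (Fin n)} (hF : HighGirth F k) {S : Finset (Fin n)}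
    (hS : S.Nonempty) {d : ℕ} (hd : ∀ v ∈ S, d + 1 ≤ (S.filter (F.Adj v)).card) :
    d ^ k ≤ S.card := by
  obtain ⟨r, hr⟩ := hS
  let H : SimpleGraph (Fin n) :=
    { Adj := fun a b => F.Adj a b ∧ a ∈ S ∧ b ∈ S
      symm := ⟨fun a b h => ⟨h.1.symm, h.2.2, h.2.1⟩⟩
      loopless := ⟨fun a h => F.loopless.irrefl a h.1⟩ }
  have hHF : H ≤ F := fun a b h => h.1
  have hreach : ∀ v, H.Reachable r v → v ∈ S := by
    rintro v ⟨p⟩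
    induction p with
    | nil => exact hr
    | cons h p ih => exact ih h.2.2
  have hdeg : ∀ v, H.Reachable r v → d + 1 ≤ (Finset.univ.filter (H.Adj v)).card := by
    intro v hv
    refine (hd v (hreach v hv)).trans (Finset.card_le_card ?_)
    intro x
    simp only [Finset.mem_filter, Finset.mem_univ, true_and]
    exact fun h => ⟨h.2, hreach v hv, h.1⟩
  have hsph : ∀ i ≤ k, d ^ i ≤ (sphere H r i).card := by
    intro i
    induction i with
    | zero =>
      intro _
      rw [pow_zero, Nat.one_le_iff_ne_zero, ← Nat.pos_iff_ne_zero, Finset.card_pos]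
      exact ⟨r, by simp [sphere]⟩
    | succ i ih =>
      intro hi
      rw [pow_succ]
      exact (Nat.mul_le_mul_right _ (ih (by omega))).trans
        ((hF.anti hHF).sphere_growth (fun v hv => by convert hdeg v hv) hi)
  refine (hsph k le_rfl).trans (Finset.card_le_card ?_)
  intro v hv
  simp only [sphere, Finset.mem_filter, Finset.mem_univ, true_and] at hv
  exact hreach v hv.1

-- Fewer than `d ^ k` vertices always include one of degree at most `d`, by the Moore bound.
-- Removing such vertices one by one deletes at most `2 * d` ordered pairs each time.
open Classical in
theorem HighGirth.card_adj_le {F : SimpleGraph (Fin n)} (hF : HighGirth F k) {d : ℕ}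
    (S : Finset (Fin n)) (hd : S.card < d ^ k) :
    ((S ×ˢ S).filter fun e => F.Adj e.1 e.2).card ≤ 2 * d * S.card := by
  induction S using Finset.strongInduction with
  | H S ih =>
    rcases S.eq_empty_or_nonempty with rfl | hS
    · simp
    · obtain ⟨v, hv, hvd⟩ : ∃ v ∈ S, (S.filter (F.Adj v)).card ≤ d := by
        by_contra! hcon
        exact absurd (hF.pow_le_card hS hcon) (not_le.2 hd)
      have h1 := ih (S.erase v) (Finset.erase_ssubset hv)
        (lt_of_le_of_lt (Finset.card_le_card (Finset.erase_subset _ _)) hd)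
      have hsub : ((S ×ˢ S).filter fun e => F.Adj e.1 e.2) ⊆
          (((S.erase v) ×ˢ (S.erase v)).filter fun e => F.Adj e.1 e.2) ∪
          ((S.filter (F.Adj v)).image (fun x => (v, x)) ∪
            (S.filter (F.Adj v)).image fun x => (x, v)) := by
        rintro ⟨x, y⟩ h
        simp only [Finset.mem_filter, Finset.mem_product] at h
        simp only [Finset.mem_union, Finset.mem_filter, Finset.mem_product, Finset.mem_erase,
          Finset.mem_image, Prod.mk.injEq]
        by_cases hx : x = v
        · subst hx
          exact .inr (.inl ⟨y, ⟨h.1.2, h.2⟩, rfl, rfl⟩)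
        · by_cases hy : y = v
          · subst hy
            exact .inr (.inr ⟨x, ⟨h.1.1, h.2.symm⟩, rfl, rfl⟩)
          · exact .inl ⟨⟨⟨hx, h.1.1⟩, hy, h.1.2⟩, h.2⟩
      have h2 := (Finset.card_le_card hsub).trans (Finset.card_union_le _ _)
      have h3 := Finset.card_union_le ((S.filter (F.Adj v)).image (fun x => (v, x)))
        ((S.filter (F.Adj v)).image fun x => (x, v))
      have h4 := Finset.card_image_le (s := S.filter (F.Adj v)) (f := fun x => (v, x))
      have h5 := Finset.card_image_le (s := S.filter (F.Adj v)) (f := fun x => (x, v))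
      have h6 := Finset.card_erase_add_one hv
      have h7 : 2 * d * S.card = 2 * d * (S.erase v).card + 2 * d := by rw [← h6]; ring
      omega

end moore

end DistOracle
end

noncomputable section
namespace DistOracle

/-! ## Shortest path forests -/

section forest
variable {n : ℕ}

/-- The rank is the least number of edges of a shortest path to `S`, and the parent is the next
vertex on such a path. Distances could not serve as ranks: edges of weight zero do not decrease
them. -/
theorem exists_forest (G : SimpleGraph (Fin n)) (w : Sym2 (Fin n) → ℝ≥0) (S : Finset (Fin n)) :
    ∃ (par : Fin n → Fin n) (rk : Fin n → ℕ), ∀ v, sdist G w S v ≠ ⊤ →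
      (v ∈ S → par v = v) ∧ (v ∉ S → G.Adj v (par v) ∧ sdist G w S (par v) ≠ ⊤ ∧
        sdist G w S v = w s(par v, v) + sdist G w S (par v) ∧ rk (par v) < rk v) := by
  classical
  let Q : Fin n → ℕ → Prop := fun v m => ∃ x ∈ S, ∃ p : G.Walk v x, p.length = m ∧
    (walkLen w p : ℝ≥0∞) = sdist G w S v
  have hQ : ∀ v, sdist G w S v ≠ ⊤ → ∃ m, Q v m := by
    intro v hv
    obtain ⟨x, hx, e⟩ := exists_sdist hv
    obtain ⟨p, hp⟩ := exists_walk_eq_wdist (w := w) (wdist_ne_top.1 (e ▸ hv))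
    exact ⟨_, x, hx, p, rfl, hp.trans e.symm⟩
  let rk : Fin n → ℕ := fun v => if h : ∃ m, Q v m then Nat.find h else 0
  have hrk : ∀ v, sdist G w S v ≠ ⊤ → Q v (rk v) ∧ ∀ m, Q v m → rk v ≤ m := by
    intro v hv
    simp only [rk, dif_pos (hQ v hv)]
    exact ⟨Nat.find_spec (hQ v hv), fun m hm => Nat.find_min' _ hm⟩
  have step : ∀ v, ∃ y, sdist G w S v ≠ ⊤ → (v ∈ S → y = v) ∧ (v ∉ S → G.Adj v y ∧
      sdist G w S y ≠ ⊤ ∧ sdist G w S v = w s(y, v) + sdist G w S y ∧ rk y < rk v) := by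
    intro v
    by_cases hv : sdist G w S v ≠ ⊤
    · by_cases hvS : v ∈ S
      · exact ⟨v, fun _ => ⟨fun _ => rfl, fun h => absurd hvS h⟩⟩
      · obtain ⟨⟨x, hx, p, hl, hp⟩, -⟩ := hrk v hv
        cases p with
        | nil => exact absurd hx hvS
        | @cons _ y _ h q =>
          have h1 : sdist G w S y ≤ walkLen w q := (sdist_le hx).trans (wdist_le q)
          have hy : sdist G w S y ≠ ⊤ := ne_top_of_le_ne_top ENNReal.coe_ne_top h1
          have h2 : sdist G w S v ≤ w s(v, y) + sdist G w S y :=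
            (sdist_triangle v y).trans (by gcongr; exact wdist_le_edge h)
          rw [walkLen_cons, ENNReal.coe_add] at hp
          have h3 : (walkLen w q : ℝ≥0∞) = sdist G w S y := by
            refine le_antisymm ?_ h1
            rw [← hp] at h2
            exact (ENNReal.add_le_add_iff_left ENNReal.coe_ne_top).1 h2
          refine ⟨y, fun _ => ⟨fun h => absurd h hvS, fun _ => ⟨h, hy, ?_, ?_⟩⟩⟩
          · rw [← hp, h3, Sym2.eq_swap]
          · have := (hrk y hy).2 q.length ⟨x, hx, q, rfl, h3⟩
            simp only [SimpleGraph.Walk.length_cons] at hl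
            omega
    · exact ⟨v, fun h => absurd h hv⟩
  choose par hpar using step
  exact ⟨par, rk, hpar⟩

end forest

/-! ## Unique shortest paths -/

section geodesic
variable {n : ℕ} {G : SimpleGraph (Fin n)}

/-- The weights, with ties broken by powers of two. -/
def lexCost (w : Sym2 (Fin n) → ℝ≥0) (e : Sym2 (Fin n)) : ℝ≥0 ×ₗ ℕ :=
  toLex (w e, 2 ^ (Fintype.equivFin (Sym2 (Fin n)) e : ℕ))

/-- The cost of a walk. -/
def cost (w : Sym2 (Fin n) → ℝ≥0) {u v : Fin n} (p : G.Walk u v) : ℝ≥0 ×ₗ ℕ :=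
  (p.edges.map (lexCost w)).sum

/-- The walk is a cheapest one between its ends. -/
def Geodesic (w : Sym2 (Fin n) → ℝ≥0) {u v : Fin n} (p : G.Walk u v) : Prop :=
  ∀ q : G.Walk u v, cost w p ≤ cost w q

variable {w : Sym2 (Fin n) → ℝ≥0}

lemma lexCost_pos (e : Sym2 (Fin n)) : 0 < lexCost w e := by
  rw [Prod.Lex.lt_iff]
  rcases eq_or_lt_of_le (zero_le : 0 ≤ w e) with h | h
  · right
    exact ⟨h, by simp [lexCost]⟩
  · exact .inl h

@[simp] lemma cost_append {u v z : Fin n} (p : G.Walk u v) (q : G.Walk v z) :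
    cost w (p.append q) = cost w p + cost w q := by
  simp [cost]

@[simp] lemma cost_reverse {u v : Fin n} (p : G.Walk u v) : cost w p.reverse = cost w p := by
  simp [cost, List.sum_reverse]

lemma cost_fst {u v : Fin n} (p : G.Walk u v) : (ofLex (cost w p)).1 = walkLen w p := by
  unfold cost walkLen
  induction p.edges with
  | nil => rfl
  | cons e l ih =>
    rw [List.map_cons, List.map_cons, List.sum_cons, List.sum_cons, ← ih]
    rfl

lemma cost_snd {u v : Fin n} (p : G.Walk u v) : (ofLex (cost w p)).2 =
    (p.edges.map fun e => 2 ^ (Fintype.equivFin (Sym2 (Fin n)) e : ℕ)).sum := by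
  unfold cost
  induction p.edges with
  | nil => rfl
  | cons e l ih =>
    rw [List.map_cons, List.map_cons, List.sum_cons, List.sum_cons, ← ih]
    rfl

lemma exists_geodesic {u v : Fin n} (h : G.Reachable u v) : ∃ p : G.Walk u v, Geodesic w p := by
  obtain ⟨p, -, hp⟩ := exists_path_min (lexCost w) (fun e => (lexCost_pos e).le) h
  exact ⟨p, hp⟩

lemma Geodesic.walkLen {u v : Fin n} {p : G.Walk u v} (h : Geodesic w p) :
    (walkLen w p : ℝ≥0∞) = wdist G w u v := by
  refine le_antisymm (le_iInf fun q => ?_) (wdist_le p)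
  have := h q
  rw [Prod.Lex.le_iff] at this
  rw [← cost_fst, ← cost_fst]
  rcases this with h | h
  · exact_mod_cast h.le
  · exact_mod_cast h.1.le

/-- Even edges of weight zero have positive cost, so cutting out a loop would be a strict saving. -/
lemma Geodesic.isPath {u v : Fin n} {p : G.Walk u v} (h : Geodesic w p) : p.IsPath := by
  classical
  have h1 := h p.bypass
  have hs := p.edges_bypass_sublist_edges
  have heq : p.bypass.edges = p.edges := by
    by_contra hne
    have hperm : p.edges.Perm (p.bypass.edges ++ p.edges.diff p.bypass.edges) :=
      (List.subperm_append_diff_self_of_count_le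
        (fun x _ => hs.count_le x)).symm
    have h2 : cost w p = cost w p.bypass + ((p.edges.diff p.bypass.edges).map (lexCost w)).sum := by
      unfold cost
      rw [(hperm.map (lexCost w)).sum_eq, List.map_append, List.sum_append]
    have h3 : p.edges.diff p.bypass.edges ≠ [] := by
      intro h0
      rw [h0, List.append_nil] at hperm
      exact hne (hs.eq_of_length hperm.length_eq.symm)
    obtain ⟨e, l, hl⟩ := List.exists_cons_of_ne_nil h3
    have h4 : 0 < ((p.edges.diff p.bypass.edges).map (lexCost w)).sum := by
      rw [hl, List.map_cons, List.sum_cons]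
      refine add_pos_of_pos_of_nonneg (lexCost_pos e) (List.sum_nonneg ?_)
      simp only [List.mem_map]
      rintro _ ⟨a, -, rfl⟩
      exact (lexCost_pos a).le
    rw [h2] at h1
    exact absurd h1 (not_le.2 (lt_add_of_pos_right _ h4))
  have : p.support = p.bypass.support := by
    have hl : p.bypass.length = p.length := by
      rw [← SimpleGraph.Walk.length_edges, ← SimpleGraph.Walk.length_edges, heq]
    exact ((p.support_bypass_sublist_support).eq_of_length (by simp [hl])).symm
  rw [SimpleGraph.Walk.isPath_def, this]
  exact p.bypass_isPath.support_nodup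

/-- Cheapest walks are unique. -/
lemma Geodesic.edges_eq {u v : Fin n} {p q : G.Walk u v} (hp : Geodesic w p)
    (hq : Geodesic w q) : p.edges.toFinset = q.edges.toFinset := by
  have h := le_antisymm (hp q) (hq p)
  have h2 := congrArg (fun c => (ofLex c).2) h
  simp only [cost_snd] at h2
  rw [← List.sum_toFinset _ hp.isPath.isTrail.edges_nodup,
    ← List.sum_toFinset _ hq.isPath.isTrail.edges_nodup] at h2
  set φ : Sym2 (Fin n) ↪ ℕ := (Fintype.equivFin (Sym2 (Fin n))).toEmbedding.trans Fin.valEmbedding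
  have h3 : ∑ i ∈ p.edges.toFinset.map φ, 2 ^ i = ∑ i ∈ q.edges.toFinset.map φ, 2 ^ i := by
    rw [Finset.sum_map, Finset.sum_map]
    exact h2
  -- The second components of the costs are sums of distinct powers of two, which determine the sets
  -- of edges by uniqueness of binary expansions.
  have h4 := Finset.geomSum_injective (n := 2) le_rfl h3
  exact Finset.map_injective φ h4

lemma mem_support_of_edges {u v : Fin n} {p q : G.Walk u v}
    (h : p.edges.toFinset = q.edges.toFinset) {x : Fin n} (hx : x ∈ p.support) :
    x ∈ q.support := by
  cases p with
  | nil =>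
    rw [SimpleGraph.Walk.support_nil, List.mem_singleton] at hx
    subst hx
    exact q.start_mem_support
  | cons ha p =>
    obtain ⟨e, he, hxe⟩ : ∃ e ∈ (SimpleGraph.Walk.cons ha p).edges, x ∈ e :=
      (SimpleGraph.Walk.mem_support_iff_exists_mem_edges_of_not_nil (by simp)).1 hx
    rw [← List.mem_toFinset, h, List.mem_toFinset] at he
    exact SimpleGraph.Walk.mem_support_of_mem_edges he hxe

lemma Geodesic.of_append {u v z : Fin n} {p : G.Walk u v} {q : G.Walk v z}
    (h : Geodesic w (p.append q)) : Geodesic w p ∧ Geodesic w q := by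
  constructor
  · intro r
    have := h (r.append q)
    simpa using this
  · intro r
    have := h (p.append r)
    simpa using this

lemma Geodesic.reverse {u v : Fin n} {p : G.Walk u v} (h : Geodesic w p) :
    Geodesic w p.reverse := by
  intro q
  have := h q.reverse
  simpa using this

/-- The part of a walk between two of its positions. -/
lemma exists_subwalk {u v : Fin n} (p : G.Walk u v) {a b : ℕ} (hab : a ≤ b) (hb : b ≤ p.length) :
    ∃ r : G.Walk (p.getVert a) (p.getVert b), r.support ⊆ p.support ∧ r.edges ⊆ p.edges ∧
      (∀ t, a ≤ t → t ≤ b → p.getVert t ∈ r.support) ∧ (Geodesic w p → Geodesic w r) ∧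
      r.length = b - a := by
  have e : ∀ i, (p.drop a).getVert i = p.getVert (a + i) := fun i => p.drop_getVert a i
  have hb' : (p.drop a).getVert (b - a) = p.getVert b := by rw [e]; congr 1; omega
  have h1 := p.append_take_drop_eq a
  have h2 := (p.drop a).append_take_drop_eq (b - a)
  rw [← hb']
  refine ⟨(p.drop a).take (b - a), ?_, ?_, ?_, ?_, ?_⟩
  · intro x hx
    rw [← h1, SimpleGraph.Walk.mem_support_append_iff]
    refine .inr ?_
    rw [← h2, SimpleGraph.Walk.mem_support_append_iff]
    exact .inl hx
  · intro x hx
    rw [← h1, SimpleGraph.Walk.edges_append, List.mem_append]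
    refine .inr ?_
    rw [← h2, SimpleGraph.Walk.edges_append, List.mem_append]
    exact .inl hx
  · intro t h3 h4
    have : ((p.drop a).take (b - a)).getVert (t - a) = p.getVert t := by
      rw [SimpleGraph.Walk.take_getVert, min_eq_right (by omega), e]
      congr 1; omega
    rw [← this]
    exact SimpleGraph.Walk.getVert_mem_support _ _
  · intro h
    rw [← h1] at h
    have := h.of_append.2
    rw [← h2] at this
    exact this.of_append.1
  · rw [SimpleGraph.Walk.take_length, SimpleGraph.Walk.drop_length]
    omega

/-- Two geodesics meet in a common part of both of them. -/
theorem Geodesic.contiguous {u v u' v' : Fin n} {p : G.Walk u v} {q : G.Walk u' v'}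
    (hp : Geodesic w p) (hq : Geodesic w q) {a b : ℕ} (hab : a ≤ b) (hb : b ≤ p.length)
    (ha' : p.getVert a ∈ q.support) (hb' : p.getVert b ∈ q.support) :
    (∀ t, a ≤ t → t ≤ b → p.getVert t ∈ q.support) ∧
    (b = a + 1 → s(p.getVert a, p.getVert b) ∈ q.edges) := by
  obtain ⟨r, r1, r2, r3, r4, r5⟩ := exists_subwalk (w := w) p hab hb
  obtain ⟨s, s1, s2, s3⟩ : ∃ s : G.Walk (p.getVert a) (p.getVert b), s.support ⊆ q.support ∧
      s.edges ⊆ q.edges ∧ Geodesic w s := by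
    rw [SimpleGraph.Walk.mem_support_iff_exists_getVert] at ha' hb'
    obtain ⟨i, hi, hi'⟩ := ha'
    obtain ⟨j, hj, hj'⟩ := hb'
    rw [← hi, ← hj]
    rcases le_total i j with h | h
    · obtain ⟨s, s1, s2, -, s4, -⟩ := exists_subwalk (w := w) q h hj'
      exact ⟨s, s1, s2, s4 hq⟩
    · obtain ⟨s, s1, s2, -, s4, -⟩ := exists_subwalk (w := w) q h hi'
      exact ⟨s.reverse, by simpa using s1, by simpa using s2, (s4 hq).reverse⟩
  -- Parts of geodesics are geodesics; between the two common vertices both parts therefore have the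
  -- same edges.
  have he := (r4 hp).edges_eq s3
  refine ⟨fun t h1 h2 => s1 (mem_support_of_edges he (r3 t h1 h2)), ?_⟩
  rintro rfl
  refine s2 ?_
  rw [← List.mem_toFinset, ← he, List.mem_toFinset]
  generalize p.getVert a = x at *
  generalize p.getVert (a + 1) = y at *
  cases r with
  | nil => simp at r5
  | cons h r =>
    cases r with
    | nil => simp
    | cons h r => simp at r5

end geodesic

end DistOracle
end

noncomputable section
namespace DistOracle

/-! ## Walks as sequences of runs -/

section runs
variable {n : ℕ} {G : SimpleGraph (Fin n)}

open Classical in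
/-- The number of steps of the walk with the property `B`. -/
def countSteps (B : Fin n → Fin n → Prop) : ∀ {u v : Fin n}, G.Walk u v → ℕ
  | _, _, .nil => 0
  | u, _, .cons (v := v) _ p => (if B u v then 1 else 0) + countSteps B p

open Classical in
lemma countSteps_le_sum {ι : Type*} (s : Finset ι) (B : Fin n → Fin n → Prop)
    (C : ι → Fin n → Fin n → Prop) {u v : Fin n} (p : G.Walk u v)
    (h : ∀ a < p.length, B (p.getVert a) (p.getVert (a + 1)) →
      ∃ i ∈ s, C i (p.getVert a) (p.getVert (a + 1))) :
    countSteps B p ≤ ∑ i ∈ s, countSteps (C i) p := by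
  induction p with
  | nil => simp [countSteps]
  | @cons u v z ha p ih =>
    simp only [countSteps]
    rw [Finset.sum_add_distrib]
    refine add_le_add ?_ (ih fun a ha h' => ?_)
    · split_ifs with hB
      · obtain ⟨i, hi, hC⟩ := h 0 (by simp) (by simpa using hB)
        have := Finset.single_le_sum (f := fun i => if C i u v then 1 else 0)
          (fun _ _ => Nat.zero_le _) hi
        refine le_trans ?_ this
        simp at hC
        simp [hC]
      · exact Nat.zero_le _
    · have := h (a + 1) (by simpa using ha)
      simp only [SimpleGraph.Walk.getVert_cons_succ] at this
      exact this h'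

/-- The positions with property `A` form an interval, so the property changes at most at the two
ends of it. The induction also tracks the sharper bounds when the walk starts inside the interval or
never meets it. -/
lemma countSteps_le_two (A : Fin n → Prop) {u v : Fin n} (p : G.Walk u v)
    (h : ∀ a t b, a ≤ t → t ≤ b → b ≤ p.length → A (p.getVert a) → A (p.getVert b) →
      A (p.getVert t)) :
    countSteps (fun x y => ¬ (A x ↔ A y)) p ≤ 2 := by
  suffices key : countSteps (fun x y => ¬ (A x ↔ A y)) p ≤ 2 ∧
      (A u → countSteps (fun x y => ¬ (A x ↔ A y)) p ≤ 1) ∧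
      ((∀ t ≤ p.length, ¬ A (p.getVert t)) → countSteps (fun x y => ¬ (A x ↔ A y)) p = 0) from key.1
  induction p with
  | nil => simp [countSteps]
  | @cons u v z ha p ih =>
    obtain ⟨i1, i2, i3⟩ := ih fun a t b h1 h2 h3 h4 h5 => by
      have := h (a + 1) (t + 1) (b + 1) (by omega) (by omega) (by simpa using h3)
      simp only [SimpleGraph.Walk.getVert_cons_succ] at this
      exact this h4 h5
    simp only [countSteps]
    by_cases hu : A u
    · by_cases hv : A v
      · have := i2 hv
        simp [hu, hv]
        exact ⟨by omega, this, fun h => absurd hu (by simpa using h 0 (Nat.zero_le _))⟩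
      · have h0 := i3 fun t ht hA => hv (by
          have := h 0 1 (t + 1) (by omega) (by omega) (by simpa using ht)
          simp only [SimpleGraph.Walk.getVert_cons_succ, SimpleGraph.Walk.getVert_zero] at this
          exact this hu hA)
        simp [hu, hv, h0]
        exact ⟨0, Nat.zero_le _, by simpa using hu⟩
    · by_cases hv : A v
      · have := i2 hv
        simp [hu, hv]
        exact ⟨by omega, 1, by omega, by simpa using hv⟩
      · simp [hu, hv, i1]
        intro hA
        refine i3 fun t ht => ?_
        have := hA (t + 1) (by omega)
        simpa using this

/-- The positions of the vertices are not adjacent. -/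
def IsBreak (pos : Fin n → ℕ) (x y : Fin n) : Prop := pos x + 1 ≠ pos y ∧ pos y + 1 ≠ pos x

lemma exists_getVert_of_mem_edges {u v : Fin n} (p : G.Walk u v) {x y : Fin n}
    (h : s(x, y) ∈ p.edges) : ∃ t < p.length, (p.getVert t = x ∧ p.getVert (t + 1) = y) ∨
      (p.getVert t = y ∧ p.getVert (t + 1) = x) := by
  induction p with
  | nil => simp at h
  | @cons u v z ha p ih =>
    rw [SimpleGraph.Walk.edges_cons, List.mem_cons] at h
    rcases h with h | h
    · refine ⟨0, by simp, ?_⟩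
      rw [Sym2.eq_iff] at h
      simp only [SimpleGraph.Walk.getVert_cons_succ, SimpleGraph.Walk.getVert_zero]
      rcases h with ⟨rfl, rfl⟩ | ⟨rfl, rfl⟩
      · exact .inl ⟨rfl, rfl⟩
      · exact .inr ⟨rfl, rfl⟩
    · obtain ⟨t, ht, h⟩ := ih h
      exact ⟨t + 1, by simpa using ht, by simpa using h⟩

/-- The vertices of `D` cheapest paths can be arranged in an array such that each of the paths
leaves the order of the array at most `2 * D` times. -/
theorem exists_positions {w : Sym2 (Fin n) → ℝ≥0} {D : ℕ} {src dst : Fin D → Fin n}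
    (P : ∀ i, G.Walk (src i) (dst i)) (hP : ∀ i, Geodesic w (P i)) :
    ∃ (pos : Fin n → ℕ) (own : ℕ → ℕ), (∀ s, own s ≤ n) ∧
      (∀ x, (∃ i, x ∈ (P i).support) → pos x < n ∧ own (pos x) = x) ∧
      ∀ i, countSteps (IsBreak pos) (P i) ≤ 2 * D := by
  classical
  let O : Finset (Fin n) := Finset.univ.filter fun x => ∃ i, x ∈ (P i).support
  have hO : ∀ x, x ∈ O ↔ ∃ i, x ∈ (P i).support := by simp [O]
  have hlab : ∀ x : Fin n, ∃ i : ℕ, x ∈ O → ∃ hi : i < D, x ∈ (P ⟨i, hi⟩).support ∧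
      ∀ j (hj : j < D), x ∈ (P ⟨j, hj⟩).support → i ≤ j := by
    intro x
    by_cases hx : ∃ i : ℕ, ∃ hi : i < D, x ∈ (P ⟨i, hi⟩).support
    · refine ⟨Nat.find hx, fun _ => ?_⟩
      obtain ⟨h1, h2⟩ := Nat.find_spec hx
      exact ⟨h1, h2, fun j hj h => Nat.find_min' hx ⟨hj, h⟩⟩
    · exact ⟨0, fun h => absurd (by obtain ⟨i, hi⟩ := (hO x).1 h; exact ⟨i, i.2, hi⟩) hx⟩
  choose lab hlab using hlab
  have hidx : ∀ x : Fin n, ∃ t : ℕ, ∀ hi : lab x < D, x ∈ (P ⟨lab x, hi⟩).support →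
      t ≤ (P ⟨lab x, hi⟩).length ∧ (P ⟨lab x, hi⟩).getVert t = x := by
    intro x
    by_cases hi : lab x < D
    · by_cases hx : x ∈ (P ⟨lab x, hi⟩).support
      · obtain ⟨t, h1, h2⟩ := SimpleGraph.Walk.mem_support_iff_exists_getVert.1 hx
        exact ⟨t, fun _ _ => ⟨h2, h1⟩⟩
      · exact ⟨0, fun _ h => absurd h hx⟩
    · exact ⟨0, fun h => absurd h hi⟩
  choose idx hidx using hidx
  -- Sort the vertices by the first path that contains them, and then by their place on this path.
  -- Paths have fewer than `n` edges, so the two numbers can be recovered from the key.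
  let key : Fin n → ℕ := fun x => lab x * n + idx x
  have hlt : ∀ x ∈ O, idx x < n := by
    intro x hx
    obtain ⟨hi, h1, -⟩ := hlab x hx
    have := (hidx x hi h1).1
    have := (hP ⟨lab x, hi⟩).isPath.length_lt
    simp at this
    omega
  have hkey : ∀ x ∈ O, ∀ y ∈ O, key x = key y → x = y := by
    intro x hx y hy hxy
    have h1 := hlt x hx
    have h2 := hlt y hy
    have hn : 0 < n := by omega
    have e1 : lab x = lab y := by
      have := congrArg (· / n) hxy
      simp only [key, mul_comm _ n, Nat.mul_add_div hn, Nat.div_eq_of_lt h1,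
        Nat.div_eq_of_lt h2] at this
      omega
    have e2 : idx x = idx y := by
      simp only [key, e1] at hxy
      omega
    obtain ⟨hi, h3, -⟩ := hlab x hx
    obtain ⟨hi', h4, -⟩ := hlab y hy
    have h5 := (hidx x hi h3).2
    have h6 := (hidx y hi' h4).2
    rw [← h5, ← h6, e2]
    congr!
  -- Positions are ranks of keys, so consecutive keys get consecutive positions.
  let pos : Fin n → ℕ := fun x => (O.filter fun y => key y < key x).card
  have hpos_lt : ∀ x ∈ O, ∀ y ∈ O, key x < key y → pos x < pos y := by
    intro x hx y hy h
    apply Finset.card_lt_card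
    rw [Finset.ssubset_iff_of_subset]
    · exact ⟨x, by simp [hx, h], by simp⟩
    · intro z
      simp only [Finset.mem_filter]
      exact fun hz => ⟨hz.1, hz.2.trans h⟩
  have hpos_inj : ∀ x ∈ O, ∀ y ∈ O, pos x = pos y → x = y := by
    intro x hx y hy h
    refine hkey x hx y hy ?_
    rcases lt_trichotomy (key x) (key y) with h1 | h1 | h1
    · have := hpos_lt x hx y hy h1; omega
    · exact h1
    · have := hpos_lt y hy x hx h1; omega
  have hpos_succ : ∀ x ∈ O, ∀ y, key y = key x + 1 → pos y = pos x + 1 := by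
    intro x hx y h
    have : (O.filter fun z => key z < key y) = insert x (O.filter fun z => key z < key x) := by
      ext z
      simp only [Finset.mem_filter, Finset.mem_insert]
      constructor
      · rintro ⟨h1, h2⟩
        by_cases hz : key z = key x
        · exact .inl (hkey z h1 x hx hz)
        · exact .inr ⟨h1, by omega⟩
      · rintro (rfl | ⟨h1, h2⟩)
        · exact ⟨hx, by omega⟩
        · exact ⟨h1, by omega⟩
    simp only [pos, this]
    rw [Finset.card_insert_of_notMem (by simp)]
  let own : ℕ → ℕ := fun s => if h : ∃ x ∈ O, pos x = s then (h.choose : ℕ) else 0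
  refine ⟨pos, own, fun s => ?_, fun x hx => ?_, fun j => ?_⟩
  · simp only [own]
    split_ifs with h
    · exact h.choose.2.le
    · exact Nat.zero_le _
  · rw [← hO] at hx
    refine ⟨?_, ?_⟩
    · have : (O.filter fun y => key y < key x).card < O.card :=
        Finset.card_lt_card (Finset.filter_ssubset.2 ⟨x, hx, by simp⟩)
      have h2 := Finset.card_le_univ O
      simp only [Fintype.card_fin] at h2
      exact lt_of_lt_of_le this h2
    · have h : ∃ y ∈ O, pos y = pos x := ⟨x, hx, rfl⟩
      simp only [own, dif_pos h]
      rw [hpos_inj _ h.choose_spec.1 x hx h.choose_spec.2]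
  -- Every break is a step at which some path is entered or left, and path `j` enters or leaves path
  -- `i` at most twice.
  · refine (countSteps_le_sum Finset.univ _ (fun i x y => ¬ (x ∈ (P i).support ↔ y ∈ (P i).support))
      (P j) ?_).trans ?_
    · intro a ha hB
      -- If `x` and `y` lie on the same paths, then they have the same first path. Two geodesics
      -- that share `x` and `y` share the edge between them, so the indices on this path, and hence
      -- the positions, are adjacent.
      by_contra! hcon
      set x := (P j).getVert a with hxdef
      set y := (P j).getVert (a + 1) with hydef
      have hx : x ∈ O := (hO x).2 ⟨j, SimpleGraph.Walk.getVert_mem_support _ _⟩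
      have hy : y ∈ O := (hO y).2 ⟨j, SimpleGraph.Walk.getVert_mem_support _ _⟩
      obtain ⟨hi, h1, h2⟩ := hlab x hx
      obtain ⟨hi', h3, h4⟩ := hlab y hy
      have hl : lab x = lab y := le_antisymm (h2 _ hi' (((hcon ⟨_, hi'⟩ (Finset.mem_univ _))).2 h3))
        (h4 _ hi (((hcon ⟨_, hi⟩ (Finset.mem_univ _))).1 h1))
      have h5 := hidx x hi h1
      have h6 := hidx y hi' h3
      have h3' : y ∈ (P ⟨lab x, hi⟩).support := (hcon ⟨_, hi⟩ (Finset.mem_univ _)).1 h1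
      have h6' : idx y ≤ (P ⟨lab x, hi⟩).length ∧ (P ⟨lab x, hi⟩).getVert (idx y) = y := by
        have e : (⟨lab x, hi⟩ : Fin D) = ⟨lab y, hi'⟩ := Fin.ext hl
        rw [e]; exact h6
      have he := ((hP j).contiguous (hP ⟨lab x, hi⟩) (Nat.le_succ a) ha h1 h3').2 rfl
      obtain ⟨t, ht, h7⟩ := exists_getVert_of_mem_edges _ he
      have hinj := (hP ⟨lab x, hi⟩).isPath.getVert_injOn
      rcases h7 with ⟨h7, h8⟩ | ⟨h7, h8⟩
      · have e1 : t = idx x := hinj (by simp; omega) (by simp; omega) (h7.trans h5.2.symm)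
        have e2 : t + 1 = idx y := hinj (by simp; omega) (by simp; omega) (h8.trans h6'.2.symm)
        exact hB.1 (hpos_succ x hx y (by simp only [key, ← hl]; omega)).symm
      · have e1 : t = idx y := hinj (by simp; omega) (by simp; omega) (h7.trans h6'.2.symm)
        have e2 : t + 1 = idx x := hinj (by simp; omega) (by simp; omega) (h8.trans h5.2.symm)
        exact hB.2 (hpos_succ y hy x (by simp only [key, ← hl]; omega)).symm
    · calc ∑ i, countSteps (fun x y => ¬ (x ∈ (P i).support ↔ y ∈ (P i).support)) (P j)
          ≤ ∑ _i : Fin D, 2 := Finset.sum_le_sum fun i _ => countSteps_le_two (· ∈ (P i).support) _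
            fun a t b h1 h2 h3 h4 h5 =>
              ((hP j).contiguous (hP i) (h1.trans h2) h3 h4 h5).1 t h1 h2
        _ = 2 * D := by simp [mul_comm]

variable (G)

/-- The walk consists of runs of consecutive positions, each of them given by the first and the
last position and the index of the edge to the next run. -/
inductive RunList (f : ℕ → ℕ → ℕ) : List (ℕ × ℕ × ℕ) → ∀ {u z : Fin n}, G.Walk u z → Prop
  | last {s e : ℕ} {u z : Fin n} {P : G.Walk u z} (hP : Seg G f s e P) : RunList f [(s, e, 0)] P
  | step {s e j : ℕ} {rs : List (ℕ × ℕ × ℕ)} {u z v y : Fin n} {P : G.Walk u z} {Q : G.Walk v y}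
      (hP : Seg G f s e P) (h : G.Adj z v) (hv : (adjList G z)[j]? = some v)
      (hQ : RunList f rs Q) : RunList f ((s, e, j) :: rs) (P.append (SimpleGraph.Walk.cons h Q))

variable {G}

lemma Seg.start_eq {f : ℕ → ℕ → ℕ} {s e : ℕ} {u z : Fin n} {P : G.Walk u z}
    (h : Seg G f s e P) : f 6 s = u := by
  cases h <;> assumption

/-- A run has one direction. A step against the direction of the run `P` would mean that `P` passes
through position `s'` again, that is, through `u`, which a path does not revisit. -/
lemma Seg.extend {f : ℕ → ℕ → ℕ} {s s' e : ℕ} {u v z : Fin n} {P : G.Walk v z}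
    (h : Seg G f s e P) (ha : G.Adj u v) (hu : u ∉ P.support) (hs' : s' < n) (hf : f 6 s' = u)
    (hss : s' + 1 = s ∨ s + 1 = s')
    (h7 : ∀ i (x y : Fin n), f 6 i = x → f 6 (i + 1) = y → G.Adj x y →
      (adjList G x)[f 7 i]? = some y) : Seg G f s' e (.cons ha P) := by
  have hv := h.start_eq
  rcases hss with rfl | rfl
  · refine .up ha ?_ hf (h7 _ _ _ hf hv ha) h
    by_contra hle
    have key : ∀ {s₁ : ℕ}, s₁ = s' + 1 → Seg G f s₁ e P → False := by
      intro s₁ hs₁ h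
      cases h with
      | nil hs hu => omega
      | up h hs hu hv hP => omega
      | @down s₂ e u v z P' h hs hn hu' hv hP =>
        obtain rfl : s₂ = s' := by omega
        have := hP.start_eq
        rw [hf] at this
        obtain rfl := Fin.ext this
        exact hu (by simp)
    exact key rfl h
  · refine .down ha ?_ hs' hf (h7 _ _ _ hv hf ha.symm) h
    by_contra hle
    cases h with
    | nil hs hu => omega
    | up h hs hu' hv hP =>
      have := hP.start_eq
      rw [hf] at this
      obtain rfl := Fin.ext this
      exact hu (by simp)
    | down h hs hn hu hv hP => omega

/-- Built from the end of the path: a step between adjacent positions extends the first run, and a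
break starts a new one. -/
theorem exists_runList {f : ℕ → ℕ → ℕ} {pos : Fin n → ℕ}
    (h7 : ∀ i (x y : Fin n), f 6 i = x → f 6 (i + 1) = y → G.Adj x y →
      (adjList G x)[f 7 i]? = some y) {u z : Fin n} (p : G.Walk u z) (hp : p.IsPath)
    (hpos : ∀ x ∈ p.support, pos x < n ∧ f 6 (pos x) = x) :
    ∃ rs, RunList G f rs p ∧ rs.length ≤ countSteps (IsBreak pos) p + 1 := by
  suffices h : ∃ e j rs, RunList G f ((pos u, e, j) :: rs) p ∧
      rs.length ≤ countSteps (IsBreak pos) p by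
    obtain ⟨e, j, rs, h1, h2⟩ := h
    exact ⟨_, h1, by simpa using h2⟩
  induction p with
  | @nil u =>
    obtain ⟨h1, h2⟩ := hpos u (by simp)
    exact ⟨pos u, 0, [], .last (.nil h1 h2), by simp⟩
  | @cons u v z ha p ih =>
    rw [SimpleGraph.Walk.cons_isPath_iff] at hp
    obtain ⟨e, j, rs, h1, h2⟩ := ih hp.1 fun x hx => hpos x (by simp [hx])
    obtain ⟨hu1, hu2⟩ := hpos u (by simp)
    by_cases hB : IsBreak pos u v
    · obtain ⟨i, hi⟩ := exists_index ha
      exact ⟨pos u, i, _, RunList.step (.nil hu1 hu2) ha hi h1, by simp [countSteps, hB]; omega⟩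
    · simp only [countSteps, if_neg hB, zero_add]
      have hB' : pos u + 1 = pos v ∨ pos v + 1 = pos u := by
        unfold IsBreak at hB; tauto
      generalize hl : (pos v, e, j) :: rs = l at h1
      cases h1 with
      | last hP =>
        simp only [List.cons.injEq, Prod.mk.injEq] at hl
        obtain ⟨⟨rfl, rfl, rfl⟩, rfl⟩ := hl
        exact ⟨e, 0, [], .last (hP.extend ha hp.2 hu1 hu2 hB' h7), h2⟩
      | @step s' e' j' rs' _ z' v' y' P' Q' hP h hv hQ =>
        simp only [List.cons.injEq, Prod.mk.injEq] at hl
        obtain ⟨⟨rfl, rfl, rfl⟩, rfl⟩ := hl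
        refine ⟨e, j, rs, ?_, h2⟩
        rw [← SimpleGraph.Walk.cons_append]
        refine .step (hP.extend ha (fun h => hp.2 ?_) hu1 hu2 hB' h7) h hv hQ
        rw [SimpleGraph.Walk.mem_support_append_iff]
        exact .inl h

/-- The words by which a list of runs is stored. -/
def encode : List (ℕ × ℕ × ℕ) → List ℕ
  | [] => []
  | r :: rs => r.1 :: r.2.1 :: r.2.2 :: (if rs = [] then 0 else 1) :: encode rs

lemma RunList.encode_le {f : ℕ → ℕ → ℕ} {rs : List (ℕ × ℕ × ℕ)} {u z : Fin n} {P : G.Walk u z}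
    (h : RunList G f rs P) : ∀ x ∈ encode rs, x ≤ n := by
  induction h with
  | last hP =>
    have := hP.lt
    simp [encode]
    omega
  | step hP h hv hQ ih =>
    have h1 := hP.lt
    have h2 := (lt_deg hv).trans (deg_lt _ _)
    intro x hx
    simp only [encode, List.mem_cons] at hx
    rcases hx with rfl | rfl | rfl | rfl | hx
    · omega
    · omega
    · omega
    · split_ifs <;> omega
    · exact ih x hx

lemma RunList.runs {f : ℕ → ℕ → ℕ} {rs : List (ℕ × ℕ × ℕ)} {u z : Fin n} {P : G.Walk u z}
    (h : RunList G f rs P) {X : ℕ → ℕ} {lo hi : ℕ} : ∀ a, lo ≤ a → a + 4 * rs.length ≤ hi →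
    (∀ q < 4 * rs.length, X (a + q) = (encode rs).getD q 0) → Runs G f X lo hi a P := by
  induction h with
  | last hP =>
    intro a hlo hhi hX
    have h0 := hX 0 (by simp)
    have h1 := hX 1 (by simp)
    have h3 := hX 3 (by simp)
    simp [encode] at h0 h1 h3 hhi
    exact .last hlo hhi (by rw [h0, h1]; exact hP) h3
  | @step s e j rs u z v y P Q hP h hv hQ ih =>
    intro a hlo hhi hX
    simp only [List.length_cons] at hhi hX
    have h0 := hX 0 (by omega)
    have h1 := hX 1 (by omega)
    have h2 := hX 2 (by omega)
    have h3 := hX 3 (by omega)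
    have hrs : rs ≠ [] := by cases hQ <;> simp
    have hl : 0 < rs.length := List.length_pos_iff.2 hrs
    simp [encode, hrs] at h0 h1 h2 h3
    refine .step hlo (by omega) (by rw [h0, h1]; exact hP) h3 h (by rw [h2]; exact hv)
      (ih (a + 4) (by omega) (by omega) fun q hq => ?_)
    have := hX (q + 4) (by omega)
    rw [show a + 4 + q = a + (q + 4) by ring, this]
    simp [encode]

end runs

end DistOracle
end

/-! ### Next hops in the spanner and the layout of the tables -/

noncomputable section
namespace DistOracle

section nexthop
variable {n : ℕ} {G : SimpleGraph (Fin n)} {w : Sym2 (Fin n) → ℝ≥0}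

/-- The distances in `G` as weights of pairs. -/
def pairDist (G : SimpleGraph (Fin n)) (w : Sym2 (Fin n) → ℝ≥0) : Sym2 (Fin n) → ℝ≥0 :=
  Sym2.lift ⟨fun x y => (wdist G w x y).toNNReal, fun x y =>
    congrArg ENNReal.toNNReal (wdist_comm x y)⟩

lemma coe_pairDist {x y : Fin n} (h : G.Reachable x y) :
    (pairDist G w s(x, y) : ℝ≥0∞) = wdist G w x y := by
  simp only [pairDist, Sym2.lift_mk]
  exact ENNReal.coe_toNNReal (wdist_ne_top.2 h)

lemma walkLen_le_mul {F : SimpleGraph (Fin n)} {c : Sym2 (Fin n) → ℝ≥0} {b : ℝ≥0} {x y : Fin n}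
    (p : F.Walk x y) (h : ∀ e ∈ p.edges, c e ≤ b) : walkLen c p ≤ p.length * b := by
  unfold walkLen
  refine (List.sum_le_card_nsmul _ b ?_).trans ?_
  · simpa using h
  · simp

/-- Next hops on shortest paths in a spanner of the complete distance graph on `L`. -/
theorem exists_nextHop (G : SimpleGraph (Fin n)) (w : Sym2 (Fin n) → ℝ≥0) (L : Finset (Fin n))
    (k : ℕ) (hk : 1 ≤ k) : ∃ F : SimpleGraph (Fin n), HighGirth F k ∧
      (∀ x y, F.Adj x y → x ∈ L ∧ y ∈ L ∧ G.Reachable x y) ∧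
      ∃ (nh : Fin n → Fin n → Fin n) (rk : Fin n → Fin n → ℕ),
        ∀ x ∈ L, ∀ y ∈ L, G.Reachable x y →
          wdist F (pairDist G w) x y ≤ (2 * k - 1 : ℕ) * wdist G w x y ∧
          (x ≠ y → F.Adj x (nh x y) ∧ rk (nh x y) y < rk x y ∧ wdist F (pairDist G w) x y =
            wdist G w x (nh x y) + wdist F (pairDist G w) (nh x y) y) := by
  obtain ⟨F, hF, hFL, hsp⟩ := exists_spanner G w L k hk
  -- The next hop towards `y` is the parent in a shortest path tree of the spanner rooted at `y`;
  -- the ranks are needed since distinct landmarks may have distance zero.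
  choose par rk hpar using fun y => exists_forest F (pairDist G w) {y}
  have hs : ∀ x y : Fin n, sdist F (pairDist G w) {y} x = wdist F (pairDist G w) x y := by
    intro x y
    simp [sdist]
  refine ⟨F, hF, hFL, fun x y => par y x, fun x y => rk y x, fun x hx y hy hxy => ?_⟩
  obtain ⟨p, hp, hpe⟩ := hsp x hx y hy hxy
  refine ⟨?_, fun hne => ?_⟩
  · refine (wdist_le p).trans ?_
    rw [← coe_pairDist hxy]
    -- The spanner path has at most `2 * k - 1` edges, none of them longer than the pair itself.
    have h1 : walkLen (pairDist G w) p ≤ p.length * pairDist G w s(x, y) := by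
      refine walkLen_le_mul p ?_
      intro e
      induction e with
      | h a b =>
        intro he
        have h2 := hpe a b he
        rw [← coe_pairDist hxy, ← coe_pairDist (hFL a b (p.adj_of_mem_edges he)).2.2] at h2
        exact_mod_cast h2
    have h2 : (p.length : ℝ≥0) ≤ (2 * k - 1 : ℕ) := by exact_mod_cast hp
    exact_mod_cast h1.trans (mul_le_mul_left h2 _)
  · have htop : sdist F (pairDist G w) {y} x ≠ ⊤ := by
      rw [hs, wdist_ne_top]; exact ⟨p⟩
    obtain ⟨h1, -, h3, h4⟩ := (hpar y x htop).2 (by simpa using hne)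
    refine ⟨h1, h4, ?_⟩
    rw [← hs, h3, Sym2.eq_swap, coe_pairDist (hFL _ _ h1).2.2, hs]

/-- The routes along the next hops, if the table leads to descriptions of shortest paths. -/
theorem exists_route {f : ℕ → ℕ → ℕ} {X : ℕ → ℕ} {lo hi : ℕ} {L : Finset (Fin n)}
    {F : SimpleGraph (Fin n)} {c : Fin n → Fin n → ℝ≥0∞}
    (hFL : ∀ x y, F.Adj x y → x ∈ L ∧ y ∈ L ∧ G.Reachable x y)
    {nh : Fin n → Fin n → Fin n} {rk : Fin n → Fin n → ℕ}
    (hnh : ∀ x ∈ L, ∀ y ∈ L, G.Reachable x y → x ≠ y → F.Adj x (nh x y) ∧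
      rk (nh x y) y < rk x y ∧ c x y = wdist G w x (nh x y) + c (nh x y) y)
    (hX : ∀ x ∈ L, ∀ y ∈ L, F.Adj x (nh x y) → lo ≤ f 5 x + f 4 y ∧ f 5 x + f 4 y < hi ∧
      ∃ P : G.Walk x (nh x y), (walkLen w P : ℝ≥0∞) = wdist G w x (nh x y) ∧
        Runs G f X lo hi (X (f 5 x + f 4 y)) P) :
    ∀ x ∈ L, ∀ y ∈ L, G.Reachable x y → ∃ P : G.Walk x y, Route G f X lo hi y P ∧
      (walkLen w P : ℝ≥0∞) ≤ c x y := by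
  intro x hx y hy hxy
  obtain ⟨r, hr⟩ : ∃ r, rk x y = r := ⟨_, rfl⟩
  induction r using Nat.strong_induction_on generalizing x with
  | _ r ih =>
    by_cases hne : x = y
    · subst hne
      exact ⟨.nil, .nil, by simp⟩
    · obtain ⟨h1, h2, h3⟩ := hnh x hx y hy hxy hne
      obtain ⟨h4, h5, P, h6, h7⟩ := hX x hx y hy h1
      obtain ⟨-, hz, hxz⟩ := hFL _ _ h1
      obtain ⟨Q, hQ, hQl⟩ := ih _ (hr ▸ h2) (nh x y) hz (hxz.symm.trans hxy) rfl
      refine ⟨P.append Q, .step hne h1.ne h4 h5 h7 hQ, ?_⟩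
      rw [walkLen_append, ENNReal.coe_add, h3, h6]
      gcongr

end nexthop

/-- An array that holds a square table followed by blocks of equal length. -/
lemma exists_array (b l B D W : ℕ) (T : Fin l → Fin l → ℕ) (enc : Fin D → List ℕ)
    (hT : ∀ i j, T i j < W) (henc : ∀ i, ∀ x ∈ enc i, x < W) (hW : 0 < W) :
    ∃ X : ℕ → ℕ, (∀ A, X A < W) ∧ (∀ i j : Fin l, X (b + l * i + j) = T i j) ∧
      ∀ i : Fin D, ∀ q < B, X (b + l ^ 2 + B * i + q) = (enc i).getD q 0 := by
  refine ⟨fun A => if h : A < b + l ^ 2 then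
      if h : (A - b) / l < l ∧ (A - b) % l < l then T ⟨_, h.1⟩ ⟨_, h.2⟩ else 0
    else if h : (A - (b + l ^ 2)) / B < D then
      (enc ⟨_, h⟩).getD ((A - (b + l ^ 2)) % B) 0 else 0, fun A => ?_, fun i j => ?_,
      fun i q hq => ?_⟩
  · dsimp only
    split_ifs
    · exact hT _ _
    · exact hW
    · rw [List.getD_eq_getElem?_getD]
      rcases h : (enc _)[(A - (b + l ^ 2)) % B]? with _ | x
      · simpa using hW
      · exact henc _ _ (List.mem_of_getElem? h)
    · exact hW
  · have hl : 0 < l := i.pos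
    have h1 : b + l * i + j < b + l ^ 2 := by
      have := Nat.mul_le_mul_left l (Nat.succ_le_of_lt i.isLt)
      have := j.isLt
      rw [Nat.succ_eq_add_one, mul_add] at *
      rw [sq]; omega
    have h2 : (b + l * i + j - b) / l = i := by
      rw [add_assoc, Nat.add_sub_cancel_left, Nat.mul_add_div hl, Nat.div_eq_of_lt j.isLt, add_zero]
    have h3 : (b + l * i + j - b) % l = j := by
      rw [add_assoc, Nat.add_sub_cancel_left, Nat.mul_add_mod, Nat.mod_eq_of_lt j.isLt]
    simp only [h1, dif_pos, h2, h3, i.isLt, j.isLt, and_self, Fin.eta]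
  · have hB : 0 < B := Nat.zero_lt_of_lt hq
    have h1 : ¬ b + l ^ 2 + B * i + q < b + l ^ 2 := by omega
    have h2 : (b + l ^ 2 + B * i + q - (b + l ^ 2)) / B = i := by
      rw [add_assoc, Nat.add_sub_cancel_left, Nat.mul_add_div hB, Nat.div_eq_of_lt hq, add_zero]
    have h3 : (b + l ^ 2 + B * i + q - (b + l ^ 2)) % B = q := by
      rw [add_assoc, Nat.add_sub_cancel_left, Nat.mul_add_mod, Nat.mod_eq_of_lt hq]
    simp only [h1, dif_neg, not_false_iff, h2, h3, i.isLt, dif_pos, Fin.eta]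

/-- A function of the vertices as an array. -/
def arr {n : ℕ} (φ : Fin n → ℕ) (i : ℕ) : ℕ := if h : i < n then φ ⟨i, h⟩ else 0

@[simp] lemma arr_val {n : ℕ} (φ : Fin n → ℕ) (v : Fin n) : arr φ v = φ v := by simp [arr]

lemma arr_lt {n : ℕ} {φ : Fin n → ℕ} {W : ℕ} (hW : 0 < W) (h : ∀ v, φ v < W) (i : ℕ) :
    arr φ i < W := by
  unfold arr; split_ifs
  · exact h _
  · exact hW

open Classical in
/-- The position of a neighbour in an adjacency list. -/
def nbrIdx {n : ℕ} (G : SimpleGraph (Fin n)) (x y : Fin n) : ℕ :=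
  if h : G.Adj x y then (exists_index h).choose else 0

lemma nbrIdx_spec {n : ℕ} {G : SimpleGraph (Fin n)} {x y : Fin n} (h : G.Adj x y) :
    (adjList G x)[nbrIdx G x y]? = some y := by
  rw [nbrIdx, dif_pos h]; exact (exists_index h).choose_spec

lemma nbrIdx_lt {n : ℕ} (G : SimpleGraph (Fin n)) (x y : Fin n) : nbrIdx G x y < n := by
  by_cases h : G.Adj x y
  · exact (lt_deg (nbrIdx_spec h)).trans (deg_lt _ _)
  · rw [nbrIdx, dif_neg h]; exact x.pos

/-- Holds for every set of landmarks, however large: all addresses fit into a word. The length is a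
small multiple of `n ^ 4`, and `n ^ 8 ≥ 256` absorbs the factor. -/
lemma layout_size {n l D : ℕ} (hn : 2 ≤ n) (hl : l ≤ n) (hD : D ≤ l ^ 2) :
    16 * (2 * n + 1) + l ^ 2 + 4 * (2 * D + 1) * D + 1 ≤ n ^ 12 := by
  have h1 : l ^ 2 ≤ n ^ 2 := Nat.pow_le_pow_left hl 2
  have h2 : D ^ 2 ≤ (n ^ 2) ^ 2 := Nat.pow_le_pow_left (hD.trans h1) 2
  have h3 : (n ^ 2) ^ 2 = n ^ 4 := by ring
  have h4 : 2 * n ≤ n ^ 2 := by nlinarith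
  have h5 : 4 ≤ n ^ 2 := by nlinarith
  have h6 : 4 * n ^ 2 ≤ n ^ 4 := by nlinarith
  have h7 : 2 ^ 8 ≤ n ^ 8 := Nat.pow_le_pow_left hn 8
  have h8 : n ^ 12 = n ^ 8 * n ^ 4 := by ring
  have h9 : 2 ^ 8 * n ^ 4 ≤ n ^ 12 := by rw [h8]; exact Nat.mul_le_mul_right _ h7
  nlinarith

/-- The fields of the records. -/
def fields {n : ℕ} (comp status par pidx lidx row : Fin n → ℕ) (own fidx : ℕ → ℕ)
    (inf : Fin n → ℕ) : ℕ → ℕ → ℕ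
  | 0 => arr comp
  | 1 => arr status
  | 2 => arr par
  | 3 => arr pidx
  | 4 => arr lidx
  | 5 => arr row
  | 6 => own
  | 7 => fidx
  | 14 => arr inf
  | _ => fun _ => 0

open Classical in
/-- The tables of a distance oracle with the landmarks `L`. -/
theorem exists_tables {n : ℕ} (hn : 2 ≤ n) (G : SimpleGraph (Fin n)) (w : Sym2 (Fin n) → ℝ≥0)
    (L : Finset (Fin n)) (k : ℕ) (hk : 1 ≤ k) : ∃ (Λ : Layout n) (f : ℕ → ℕ → ℕ)
      (par : Fin n → Fin n) (rk : Fin n → ℕ), Λ.E = ⟨G, w, n ^ 12⟩ ∧ Λ.R = 2 * n ∧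
      Tables Λ L (2 * k - 1) f par rk ∧ (∀ g i, f g i < n ^ 12) ∧
      ∀ d, L.card < d ^ k → Λ.N ≤ 50 * n + L.card ^ 2 + 12 * (2 * d * L.card) ^ 2 := by
  obtain ⟨F, hF, hFL, nh, rkF, hnh⟩ := exists_nextHop G w L k hk
  obtain ⟨par, rk, hpar⟩ := exists_forest G w L
  -- Ordered pairs: each spanner edge is stored once in each direction.
  set I := (L ×ˢ L).filter fun e => F.Adj e.1 e.2 with hI
  obtain ⟨D, hD⟩ : ∃ D, D = I.card := ⟨_, rfl⟩
  let e : I ≃ Fin D := I.equivFin.trans (finCongr hD.symm)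
  have hIF : ∀ i : Fin D, F.Adj (e.symm i).1.1 (e.symm i).1.2 := fun i =>
    (Finset.mem_filter.1 (e.symm i).2).2
  choose P hP using fun i : Fin D => exists_geodesic (w := w) (hFL _ _ (hIF i)).2.2
  obtain ⟨pos, own, hown, hpos, hbr⟩ := exists_positions P hP
  set fidx : ℕ → ℕ := fun s => if h : own s < n ∧ own (s + 1) < n then
    nbrIdx G ⟨_, h.1⟩ ⟨_, h.2⟩ else 0 with hfidx
  have hl : L.card ≤ n := by simpa using L.card_le_univ
  obtain ⟨l, hlc⟩ : ∃ l, l = L.card := ⟨_, rfl⟩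
  let eL : L ≃ Fin l := L.equivFin.trans (finCongr hlc.symm)
  have hDl : D ≤ l ^ 2 := by
    rw [hD, hlc, sq, ← Finset.card_product]
    exact Finset.card_filter_le _ _
  -- The read-only area starts at `b`, after the header and `2 * n` records. It holds the next-hop
  -- table, followed by one block of `B` words for each directed spanner edge, enough for `2 * D +
  -- 1` runs of four words.
  set b := 16 * (2 * n + 1) with hb
  set B := 4 * (2 * D + 1) with hB
  have hsize := layout_size hn (hlc.le.trans hl) hDl
  set N := b + l ^ 2 + B * D + 1 with hN
  have hnW : n < n ^ 12 := by omega
  set lidx : Fin n → ℕ := fun v => if h : v ∈ L then (eL ⟨v, h⟩ : ℕ) else 0 with hlidx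
  set f : ℕ → ℕ → ℕ := fields (fun v => ((Quot.out (G.connectedComponentMk v) : Fin n) : ℕ))
    (fun v => if sdist G w L v = 0 ∨ sdist G w L v = ⊤ then 1 else 0)
    (fun v => (par v : ℕ)) (fun v => nbrIdx G (par v) v) lidx (fun v => b + l * lidx v) own fidx
    (fun v => if sdist G w L v = ⊤ then 1 else 0) with hf
  have hlidx_lt : ∀ v, l * lidx v ≤ l ^ 2 := by
    intro v
    rw [sq]
    refine Nat.mul_le_mul_left _ ?_
    simp only [hlidx]
    split_ifs
    · exact (eL _).isLt.le
    · exact Nat.zero_le _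
  have hlidx_le : ∀ v, lidx v ≤ l := by
    intro v
    simp only [hlidx]
    split_ifs
    · exact (eL _).isLt.le
    · exact Nat.zero_le _
  have h7 : ∀ i (x y : Fin n), f 6 i = x → f 6 (i + 1) = y → G.Adj x y →
      (adjList G x)[f 7 i]? = some y := by
    intro i x y hx hy hxy
    change own i = x at hx
    change own (i + 1) = y at hy
    change (adjList G x)[fidx i]? = some y
    have h : own i < n ∧ own (i + 1) < n := by rw [hx, hy]; exact ⟨x.isLt, y.isLt⟩
    have e1 : (⟨own i, h.1⟩ : Fin n) = x := Fin.ext hx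
    have e2 : (⟨own (i + 1), h.2⟩ : Fin n) = y := Fin.ext hy
    simp only [hfidx, dif_pos h, e1, e2]
    exact nbrIdx_spec hxy
  choose rs hrs hrsl using fun i => exists_runList h7 (P i) (hP i).isPath
    fun x hx => hpos x ⟨i, hx⟩
  -- The table entry for two landmarks is the address of the block that describes the hop from the
  -- first one towards the second one. Entries that do not correspond to a spanner edge are `0` and
  -- never read on a route.
  obtain ⟨X, hXW, hXT, hXB⟩ := exists_array b l B D (n ^ 12)
    (fun i j => if h : ((eL.symm i).1, nh (eL.symm i).1 (eL.symm j).1) ∈ I then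
      b + l ^ 2 + B * e ⟨_, h⟩ else 0) (fun i => encode (rs i)) (fun i j => by
        split_ifs with h
        · have := Nat.mul_le_mul_left B (e ⟨_, h⟩).isLt.le
          omega
        · omega) (fun i x hx => ((hrs i).encode_le x hx).trans_lt hnW) (by omega)
  have hfW : ∀ g i, f g i < n ^ 12 := by
    intro g i
    have h0 : 0 < n ^ 12 := by omega
    have h2 : 2 < n ^ 12 := by omega
    have hBD : 0 ≤ B * D := Nat.zero_le _
    rw [hf]
    unfold fields
    split
    · exact arr_lt h0 (fun v => (Fin.is_lt _).trans hnW) i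
    · exact arr_lt h0 (fun v => by split_ifs <;> omega) i
    · exact arr_lt h0 (fun v => (Fin.is_lt _).trans hnW) i
    · exact arr_lt h0 (fun v => (nbrIdx_lt _ _ _).trans hnW) i
    · exact arr_lt h0 (fun v => by have := hlidx_le v; have := hlc.le.trans hl; omega) i
    · exact arr_lt h0 (fun v => by have := hlidx_lt v; omega) i
    · exact (hown i).trans_lt hnW
    · simp only [hfidx]; split_ifs
      · exact (nbrIdx_lt _ _ _).trans hnW
      · exact h0
    · exact arr_lt h0 (fun v => by split_ifs <;> omega) i
    · exact h0
  let Λ : Layout n := { E := ⟨G, w, n ^ 12⟩, R := 2 * n, N := N, x := X, hx := hXW, hn := by omega,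
                        hR := by omega, hN := by omega, hW := hsize }
  refine ⟨Λ, f, par, rk, rfl, rfl, ⟨?_, ⟨?_, ?_, ?_, ?_, ?_, ?_⟩, ?_, ?_⟩, hfW, ?_⟩
  · intro u v
    have h0 : f 0 = arr fun v => ((Quot.out (G.connectedComponentMk v) : Fin n) : ℕ) := rfl
    rw [h0, arr_val, arr_val]
    change _ ↔ G.Reachable u v
    rw [← SimpleGraph.ConnectedComponent.eq]
    constructor
    · intro h
      exact (Quot.out_eq _).symm.trans
        ((congrArg G.connectedComponentMk (Fin.ext h)).trans (Quot.out_eq _))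
    · intro h
      rw [h]
  · exact fun v => arr_val (fun v => if sdist G w L v = 0 ∨ sdist G w L v = ⊤ then 1 else 0) v
  · exact fun v => arr_val (fun v => if sdist G w L v = ⊤ then 1 else 0) v
  · intro v hv
    refine ⟨arr_val (fun v => (par v : ℕ)) v, fun hne => ?_⟩
    have hvL : v ∉ L := fun h => hne ((hpar v hv).1 h)
    obtain ⟨h1, h2, -⟩ := (hpar v hv).2 hvL
    refine ⟨h2, ?_⟩
    change (adjList G (par v))[arr (fun v => nbrIdx G (par v) v) v]? = some v
    rw [arr_val]
    exact nbrIdx_spec h1.symm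
  · intro v hv hne
    exact ((hpar v hv).2 fun h => hne ((hpar v hv).1 h)).2.2.2
  · intro v hv he
    by_contra hvL
    have := ((hpar v hv).2 hvL).1
    rw [he] at this
    exact this.ne rfl
  · intro v hv hne
    exact ((hpar v hv).2 fun h => hne ((hpar v hv).1 h)).2.2.1
  · intro g h8 h13
    rw [hf]
    interval_cases g <;> rfl
  · have key := exists_route (w := w) (f := f) (X := X) (lo := b) (hi := N) (L := L)
      (c := fun x y => wdist F (pairDist G w) x y) hFL (fun x hx y hy hxy hne =>
        (hnh x hx y hy hxy).2 hne) ?_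
    · intro x hx y hy hxy
      obtain ⟨Q, hQ, hQl⟩ := key x hx y hy hxy
      exact ⟨Q, hQ, hQl.trans (hnh x hx y hy hxy).1⟩
    · intro x hx y hy hadj
      have hmem : (x, nh x y) ∈ I := by
        rw [hI, Finset.mem_filter, Finset.mem_product]
        exact ⟨⟨hx, (hFL _ _ hadj).2.1⟩, hadj⟩
      have e5 : f 5 x = b + l * eL ⟨x, hx⟩ := by
        change arr (fun v => b + l * lidx v) x = _
        rw [arr_val]; simp [hlidx, hx]
      have e4 : f 4 y = eL ⟨y, hy⟩ := by
        change arr lidx y = _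
        rw [arr_val]; simp [hlidx, hy]
      have e0 := hXT (eL ⟨x, hx⟩) (eL ⟨y, hy⟩)
      simp only [Equiv.symm_apply_apply, dif_pos hmem] at e0
      rw [e5, e4, e0]
      have h1 := Nat.mul_le_mul_left l (Nat.succ_le_of_lt (eL ⟨x, hx⟩).isLt)
      have h2 := (eL ⟨y, hy⟩).isLt
      refine ⟨by omega, ?_, ?_⟩
      · rw [Nat.succ_eq_add_one, mul_add, ← sq] at h1
        omega
      · obtain ⟨i, hi⟩ : ∃ i, i = e ⟨_, hmem⟩ := ⟨_, rfl⟩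
        rw [← hi]
        have hes : (e.symm i).1 = (x, nh x y) := by rw [hi, Equiv.symm_apply_apply]
        have main : ∀ a c : Fin n, (e.symm i).1.1 = a → (e.symm i).1.2 = c →
            ∃ Q : G.Walk a c, (walkLen w Q : ℝ≥0∞) = wdist G w a c ∧
              Runs G f X b N (b + l ^ 2 + B * i) Q := by
          rintro a c rfl rfl
          refine ⟨P i, (hP i).walkLen, (hrs i).runs _ (by omega) ?_ fun q hq => ?_⟩
          · have h3 := Nat.mul_le_mul_left B (Nat.succ_le_of_lt i.isLt)
            have h4 := hrsl i
            have h5 := hbr i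
            rw [Nat.succ_eq_add_one, mul_add] at h3
            omega
          · refine hXB i q ?_
            have h4 := hrsl i
            have h5 := hbr i
            omega
        exact main x (nh x y) (by rw [hes]) (by rw [hes])
  -- There are at most `2 * d * L.card` directed spanner edges. The bound follows from `32 * n + 17
  -- ≤ 50 * n` and `8 * D ^ 2 + 4 * D ≤ 12 * D ^ 2`.
  · intro d hd
    have h1 := hF.card_adj_le L hd
    have h2 : D ≤ 2 * d * L.card := hD.le.trans (by convert h1)
    have h3 : D ^ 2 ≤ (2 * d * L.card) ^ 2 := Nat.pow_le_pow_left h2 2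
    have h4 : D ≤ D ^ 2 := Nat.le_self_pow (by norm_num) D
    change N ≤ _
    rw [hN, hB, hb, hlc]
    nlinarith

end DistOracle
end

/-! ### The machine oracle for a fixed set of landmarks -/

noncomputable section
namespace DistOracle

/-- The distance oracle for a fixed set of landmarks. -/
theorem exists_oracle {n : ℕ} (hn : 2 ≤ n) (G : SimpleGraph (Fin n)) (w : Sym2 (Fin n) → ℝ≥0)
    (L : Finset (Fin n)) (k : ℕ) (hk : 1 ≤ k) {upd pop : Cmd} {g : ℕ}
    {inv : (ℕ → ℕ) → (Fin n → ℝ≥0) → List (Fin n) → Finset (Fin n) → ℝ≥0 → Prop}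
    (hQ : ∀ Λ : Layout n, Λ.E = ⟨G, w, n ^ 12⟩ → Λ.R = 2 * n → IsQueue Λ upd pop g inv) :
    ∃ M : Memory, (∀ x ∈ M.words, x < n ^ 12) ∧
      (∀ d, L.card < d ^ k → M.size ≤ 51 * n + L.card ^ 2 + 12 * (2 * d * L.card) ^ 2) ∧
      ∀ u v, ∃ t o δ, Answers ⟨G, w, n ^ 12⟩ (queryCmd upd pop).comp M u v t o δ ∧
        Correct G w k L u v o δ ∧
        t ≤ (2 * g + 1000) * (workload G w L u + workload G w L v + 3) + 400 * hops o := by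
  obtain ⟨Λ, f, par, rk, hE, hR, hT, hf, hN⟩ := exists_tables hn G w L k hk
  have hQ := hQ Λ hE hR
  have hG : Λ.E.graph = G := by rw [hE]
  have hw : Λ.E.weight = w := by rw [hE]
  have hB : Λ.E.wordBound = n ^ 12 := by rw [hE]
  have hnB : n < n ^ 12 := lt_self_pow₀ (by omega) (by norm_num)
  let σ₀ : Fin n → Fin n → AS := fun u v =>
    ⟨fun i => if i = 0 then u else if i = 1 then v else 0, fun _ => 0, f, fun _ => 0, []⟩
  have hmem : ∀ σ σ' : AS, σ.f = σ'.f → memFun Λ σ = memFun Λ σ' := by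
    intro σ σ' h
    funext A
    simp only [memFun, h]
  have hz : 0 < n := by omega
  -- The contents of the memory depend on the fields only, so any query may be used to write them
  -- down. The `n` length cells account for the step from `50 * n` to `51 * n`.
  refine ⟨⟨(List.range Λ.N).map (memFun Λ (σ₀ ⟨0, hz⟩ ⟨0, hz⟩)), n⟩, ?_, ?_, ?_⟩
  · intro x hx
    obtain ⟨A, -, rfl⟩ := List.mem_map.1 hx
    simp only [memFun]
    split_ifs
    · exact hnB
    · exact hf _ _
    · exact hB ▸ Λ.hx _
  · intro d hd
    have := hN d hd
    simp only [Memory.size, List.length_map, List.length_range]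
    omega
  · intro u v
    obtain ⟨t, σ, hex, h1, h2, o, h3, h4, h5⟩ := queryCmd_spec (σ := σ₀ u v) (u := u) (v := v)
      hQ hk hT ⟨rfl, rfl, rfl, rfl⟩ ⟨rfl, rfl, rfl⟩
    have hgood : Good Λ (σ₀ u v) := by
      refine ⟨fun i => ?_, fun g i => hB ▸ hf g i⟩
      rw [hB]
      simp only [σ₀]
      split_ifs
      · exact u.isLt.trans hnB
      · exact v.isLt.trans hnB
      · omega
    obtain ⟨-, s, hs, hrep⟩ := hex.sound hgood
      (initState ⟨(List.range Λ.N).map (memFun Λ (σ₀ ⟨0, hz⟩ ⟨0, hz⟩)), n⟩ u v)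
      ⟨fun i _ => rfl, rfl, congrArg (List.map · (List.range Λ.N)) (hmem _ _ rfl),
        by simp [initState, σ₀, List.map_const'], rfl⟩
    rw [hG, hw] at h4 h5
    refine ⟨t, o, σ.lr 0, ⟨s, hE ▸ hs, ?_, ?_, hrep.out.trans h3, by rw [hrep.lreg]⟩, h4, h5⟩
    · rw [hrep.mem, hmem σ (σ₀ ⟨0, hz⟩ ⟨0, hz⟩) h1]
    · rw [hrep.lmem, h2]
      simp [List.map_const']

end DistOracle
end

/-! ### Random landmarks: basic probability and the number of virtual copies -/

noncomputable section
namespace DistOracle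

section probability
variable {n k : ℕ} {G : SimpleGraph (Fin n)}

lemma rho_pos (hn : 1 ≤ n) (hk : 1 ≤ k) : 0 < rho n k := by
  unfold rho
  have : (0 : ℝ) < n := by exact_mod_cast hn
  have : (0 : ℝ) < k := by exact_mod_cast hk
  positivity

lemma rho_le_sqrt (hn : 1 ≤ n) (hk : 1 ≤ k) : rho n k ≤ (n : ℝ) ^ ((1 : ℝ) / 2) := by
  have hn' : (1 : ℝ) ≤ n := by exact_mod_cast hn
  have hk' : (1 : ℝ) ≤ k := by exact_mod_cast hk
  unfold rho
  refine (div_le_self (by positivity) hk').trans (Real.rpow_le_rpow_of_exponent_le hn' ?_)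
  rw [div_le_div_iff₀ (by positivity) (by norm_num)]
  linarith

lemma rate_pos (hn : 1 ≤ n) (hk : 1 ≤ k) : 0 < rho n k / n := by
  have := rho_pos hn hk
  have : (0 : ℝ) < n := by exact_mod_cast hn
  positivity

lemma rate_le_one (hn : 1 ≤ n) (hk : 1 ≤ k) : rho n k / n ≤ 1 := by
  have hn' : (1 : ℝ) ≤ n := by exact_mod_cast hn
  rw [div_le_one (by positivity)]
  refine (rho_le_sqrt hn hk).trans ?_
  calc (n : ℝ) ^ ((1 : ℝ) / 2) ≤ (n : ℝ) ^ (1 : ℝ) :=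
        Real.rpow_le_rpow_of_exponent_le hn' (by norm_num)
    _ = n := Real.rpow_one _

/-- The exponents `1/2 + 1/(2k+2)` and `k/(2k+2)` add up to one, so the bound is the density times
the expected waiting time `n / ρ` for a selected copy. -/
lemma queryBound_eq (hn : 1 ≤ n) (hk : 1 ≤ k) :
    queryBound G k = density G / (rho n k / n) := by
  have hn' : (0 : ℝ) < n := by exact_mod_cast hn
  have hk' : (0 : ℝ) < k := by exact_mod_cast hk
  have h : (n : ℝ) ^ ((1 : ℝ) / 2 + 1 / (2 * k + 2)) * (n : ℝ) ^ ((k : ℝ) / (2 * k + 2)) = n := by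
    rw [← Real.rpow_add hn']
    conv_rhs => rw [← Real.rpow_one (n : ℝ)]
    congr 1
    field_simp
    ring
  rw [eq_div_iff (rate_pos hn hk).ne', queryBound, rho]
  calc _ = ((n : ℝ) ^ ((1 : ℝ) / 2 + 1 / (2 * k + 2)) * (n : ℝ) ^ ((k : ℝ) / (2 * k + 2))) *
        (k / k) / n * density G := by ring
    _ = density G := by rw [h, div_self hk'.ne', mul_one, div_self hn'.ne', one_mul]

lemma sampleWeight_nonneg (hn : 1 ≤ n) (hk : 1 ≤ k) (S : Finset (VirtualNode G)) :
    0 ≤ sampleWeight G k S := by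
  have h0 := rate_pos hn hk
  have h1 : 0 ≤ 1 - rho n k / n := sub_nonneg.2 (rate_le_one hn hk)
  unfold sampleWeight
  positivity

/-- The generating function of the number of selected copies. For `a = 1` it shows that the weights
sum to one, and for `a = 2` it gives the tail bound on the number of landmarks. -/
lemma sum_sampleWeight_mul_pow (a : ℝ) : ∑ S : Finset (VirtualNode G), sampleWeight G k S * a ^ S.card =
    (a * (rho n k / n) + (1 - rho n k / n)) ^ Fintype.card (VirtualNode G) := by
  rw [← Fintype.sum_pow_mul_eq_add_pow]
  refine Finset.sum_congr rfl fun S _ => ?_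
  rw [sampleWeight, Finset.card_compl, mul_pow]
  ring

lemma sum_sampleWeight : ∑ S : Finset (VirtualNode G), sampleWeight G k S = 1 := by
  simpa using sum_sampleWeight_mul_pow (G := G) (k := k) 1

lemma expect_mono (hn : 1 ≤ n) (hk : 1 ≤ k) {X Y : Finset (Fin n) → ℝ} (h : ∀ L, X L ≤ Y L) :
    expect G k X ≤ expect G k Y :=
  Finset.sum_le_sum fun S _ => mul_le_mul_of_nonneg_left (h _) (sampleWeight_nonneg hn hk S)

lemma expect_add (X Y : Finset (Fin n) → ℝ) :
    expect G k (fun L => X L + Y L) = expect G k X + expect G k Y := by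
  simp [expect, mul_add, Finset.sum_add_distrib]

lemma expect_mul (a : ℝ) (X : Finset (Fin n) → ℝ) :
    expect G k (fun L => a * X L) = a * expect G k X := by
  simp only [expect, Finset.mul_sum]
  exact Finset.sum_congr rfl fun _ _ => by ring

lemma expect_const (a : ℝ) : expect G k (fun _ => a) = a := by
  simp [expect, ← Finset.sum_mul, sum_sampleWeight]

lemma expect_sum {ι : Type*} (s : Finset ι) (X : ι → Finset (Fin n) → ℝ) :
    expect G k (fun L => ∑ i ∈ s, X i L) = ∑ i ∈ s, expect G k (X i) := by
  simp only [expect, Finset.mul_sum]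
  exact Finset.sum_comm

lemma prob_mono (hn : 1 ≤ n) (hk : 1 ≤ k) {A B : Finset (Fin n) → Prop} (h : ∀ L, A L → B L) :
    prob G k A ≤ prob G k B :=
  expect_mono hn hk fun L => by
    have := h L
    split_ifs <;> first | tauto | norm_num

lemma prob_add_not (A : Finset (Fin n) → Prop) :
    prob G k A + prob G k (fun L => ¬ A L) = 1 := by
  rw [prob, prob, ← expect_add]
  refine Eq.trans ?_ (expect_const (G := G) (k := k) 1)
  congr 1
  funext L
  by_cases h : A L <;> simp [h]

lemma prob_exists_le (hn : 1 ≤ n) (hk : 1 ≤ k) {ι : Type*} (s : Finset ι)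
    (A : ι → Finset (Fin n) → Prop) :
    prob G k (fun L => ∃ i ∈ s, A i L) ≤ ∑ i ∈ s, prob G k (A i) := by
  classical
  simp only [prob]
  rw [← expect_sum]
  refine expect_mono hn hk fun L => ?_
  split_ifs with h
  · obtain ⟨i, hi, hA⟩ := h
    refine le_trans ?_ (Finset.single_le_sum (f := fun i => if A i L then (1 : ℝ) else 0)
      (fun i _ => by split_ifs <;> norm_num) hi)
    simp [hA]
  · exact Finset.sum_nonneg fun i _ => by split_ifs <;> norm_num

/-- The landmarks avoid `A` if and only if all selected copies belong to vertices outside `A`;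
summing over the sets of such copies leaves one factor for each copy of a vertex in `A`. -/
lemma prob_disjoint (A : Finset (Fin n)) : prob G k (fun L => Disjoint A L) =
    (1 - rho n k / n) ^ ∑ z ∈ A, numCopies G z := by
  classical
  set q : ℝ := 1 - rho n k / n with hq
  let V : Finset (VirtualNode G) := Finset.univ.filter fun x => x.1 ∉ A
  have hV : Vᶜ.card = ∑ z ∈ A, numCopies G z := by
    have : Vᶜ = A.sigma fun z => (Finset.univ : Finset (Fin (numCopies G z))) := by
      ext x; simp [V]
    rw [this, Finset.card_sigma]
    simp
  have h : ∀ S : Finset (VirtualNode G), Disjoint A (landmarks S) ↔ S ∈ V.powerset := by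
    intro S
    rw [Finset.disjoint_right, Finset.mem_powerset]
    simp only [landmarks, Finset.mem_image, forall_exists_index, and_imp, Finset.subset_iff, V,
      Finset.mem_filter, Finset.mem_univ, true_and]
    exact ⟨fun h x hx => h x hx rfl, fun h _ x hx e => e ▸ h hx⟩
  have h1 := Finset.sum_pow_mul_eq_add_pow (rho n k / n) q V
  rw [show rho n k / n + q = 1 by rw [hq]; ring, one_pow] at h1
  calc prob G k (fun L => Disjoint A L)
      = ∑ S ∈ V.powerset, sampleWeight G k S := by
        simp only [prob, expect, h, mul_ite, mul_one, mul_zero]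
        rw [← Finset.sum_filter]
        congr 1
        ext S; simp
    _ = ∑ S ∈ V.powerset, q ^ Vᶜ.card * ((rho n k / n) ^ S.card * q ^ (V.card - S.card)) := by
        refine Finset.sum_congr rfl fun S hS => ?_
        have h2 := Finset.card_le_card (Finset.mem_powerset.1 hS)
        have h3 := V.card_le_univ
        rw [sampleWeight, Finset.card_compl, Finset.card_compl,
          show Fintype.card (VirtualNode G) - S.card =
            (Fintype.card (VirtualNode G) - V.card) + (V.card - S.card) by omega, pow_add]
        ring
    _ = _ := by rw [← Finset.mul_sum, h1, mul_one, hV]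

/-! ### The numbers of virtual copies -/

lemma sum_deg (G : SimpleGraph (Fin n)) : ∑ v, deg G v = 2 * numEdges G := by
  classical
  have := G.sum_degrees_eq_twice_card_edges
  rw [numEdges, ← SimpleGraph.coe_edgeFinset, Set.ncard_coe_finset, ← this]
  exact Finset.sum_congr rfl fun v _ => by unfold deg; congr

lemma density_ge (hn : 1 ≤ n) (hm : n ≤ 2 * numEdges G) : 1 / 2 ≤ density G := by
  have hn' : (0 : ℝ) < n := by exact_mod_cast hn
  have hm' : (n : ℝ) ≤ 2 * numEdges G := by exact_mod_cast hm
  rw [density, div_le_div_iff₀ (by norm_num) hn']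
  linarith

lemma deg_le_copies (hn : 1 ≤ n) (hm : n ≤ 2 * numEdges G) (v : Fin n) :
    (deg G v : ℝ) ≤ density G * numCopies G v := by
  have h := density_ge hn hm
  have := Nat.le_ceil ((deg G v : ℝ) / density G)
  rwa [div_le_iff₀' (by linarith)] at this

/-- The quotients sum to `2m / λ = 2n`, and rounding up adds at most one per vertex. -/
lemma sum_copies_le (hn : 1 ≤ n) (hm : n ≤ 2 * numEdges G) :
    (Fintype.card (VirtualNode G) : ℝ) ≤ 3 * n := by
  have h := density_ge hn hm
  have hn' : (0 : ℝ) < n := by exact_mod_cast hn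
  have h1 : ∀ v, (numCopies G v : ℝ) ≤ deg G v / density G + 1 := fun v =>
    (Nat.ceil_lt_add_one (by positivity)).le
  have h2 : (∑ v, (deg G v : ℝ)) = 2 * numEdges G := by exact_mod_cast sum_deg G
  rw [Fintype.card_sigma]
  push_cast
  simp only [Fintype.card_fin]
  refine (Finset.sum_le_sum fun v _ => h1 v).trans ?_
  rw [Finset.sum_add_distrib, ← Finset.sum_div, h2]
  have : (numEdges G : ℝ) = density G * n := by rw [density]; field_simp
  rw [this, mul_div_assoc, mul_div_cancel_left₀ _ (by linarith : density G ≠ 0)]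
  simp
  linarith

end probability

end DistOracle
end

/-! ### Tail bounds for the landmarks and bounds for the balls -/

noncomputable section
namespace DistOracle

section bounds
variable {n k : ℕ} {G : SimpleGraph (Fin n)} {w : Sym2 (Fin n) → ℝ≥0}

lemma one_sub_pow_le {p x : ℝ} (hp : p ≤ 1) {N : ℕ} (h : x ≤ p * N) :
    (1 - p) ^ N ≤ Real.exp (-x) := by
  have h1 : 1 - p ≤ Real.exp (-p) := by
    have := Real.add_one_le_exp (-p); linarith
  calc (1 - p) ^ N ≤ Real.exp (-p) ^ N := pow_le_pow_left₀ (by linarith) h1 N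
    _ = Real.exp (-(p * N)) := by rw [← Real.exp_nat_mul]; ring_nf
    _ ≤ _ := Real.exp_le_exp.2 (by linarith)

lemma exp_neg_mul_log (hn : 1 ≤ n) (c : ℕ) : Real.exp (-(c * Real.log n)) = ((n : ℝ) ^ c)⁻¹ := by
  have hn' : (0 : ℝ) < n := by exact_mod_cast hn
  rw [Real.exp_neg, Real.exp_nat_mul, Real.exp_log hn']

/-- With high probability there are few landmarks. -/
theorem card_landmarks_whp (hn : 1 ≤ n) (hk : 1 ≤ k) (hm : n ≤ 2 * numEdges G) (c : ℕ) :
    1 - ((n : ℝ) ^ c)⁻¹ ≤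
      prob G k fun L => (L.card : ℝ) ≤ 5 * rho n k + 2 * c * Real.log n := by
  classical
  have hn' : (0 : ℝ) < n := by exact_mod_cast hn
  have hlog : 0 ≤ Real.log n := Real.log_natCast_nonneg n
  have hρ := rho_pos hn hk
  set t : ℝ := 5 * rho n k + 2 * c * Real.log n with ht
  have h2 : 0 < Real.log 2 := Real.log_pos one_lt_two
  have key : prob G k (fun L => ¬ (L.card : ℝ) ≤ t) ≤ ((n : ℝ) ^ c)⁻¹ := by
    -- Markov's inequality for `2 ^ S.card`, where the number of landmarks is at most the number of
    -- selected copies.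
    have h1 : prob G k (fun L => ¬ (L.card : ℝ) ≤ t) ≤
        ∑ S : Finset (VirtualNode G), Real.exp (-(t * Real.log 2)) *
          (sampleWeight G k S * 2 ^ S.card) := by
      refine Finset.sum_le_sum fun S _ => ?_
      rw [mul_left_comm]
      refine mul_le_mul_of_nonneg_left ?_ (sampleWeight_nonneg hn hk S)
      dsimp only
      split_ifs with h
      · positivity
      · have h3 : t ≤ S.card := (not_le.1 h).le.trans (Nat.cast_le.2 Finset.card_image_le)
        rw [← Real.exp_log (by positivity : (0 : ℝ) < 2 ^ S.card), ← Real.exp_add, Real.log_pow]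
        refine Real.one_le_exp ?_
        nlinarith
    refine h1.trans ?_
    rw [← Finset.mul_sum, sum_sampleWeight_mul_pow, ← exp_neg_mul_log hn]
    have h4 : (2 * (rho n k / n) + (1 - rho n k / n)) ^ Fintype.card (VirtualNode G) ≤
        Real.exp (3 * rho n k) := by
      have h5 : 2 * (rho n k / n) + (1 - rho n k / n) ≤ Real.exp (rho n k / n) := by
        have := Real.add_one_le_exp (rho n k / n); linarith
      refine (pow_le_pow_left₀ (by have := rate_pos hn hk; linarith) h5 _).trans ?_
      rw [← Real.exp_nat_mul]
      refine Real.exp_le_exp.2 ?_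
      calc (Fintype.card (VirtualNode G) : ℝ) * (rho n k / n)
          ≤ 3 * n * (rho n k / n) :=
            mul_le_mul_of_nonneg_right (sum_copies_le hn hm) (rate_pos hn hk).le
        _ = 3 * rho n k := by field_simp
    refine (mul_le_mul_of_nonneg_left h4 (Real.exp_pos _).le).trans ?_
    rw [← Real.exp_add]
    refine Real.exp_le_exp.2 ?_
    have h6 := Real.log_two_gt_d9
    have h7 : 0 ≤ c * Real.log n := by positivity
    -- The constants in `t` are chosen such that `5 * log 2 ≥ 3` and `2 * log 2 ≥ 1`.
    rw [ht]
    nlinarith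
  have := prob_add_not (G := G) (k := k) (fun L => (L.card : ℝ) ≤ t)
  linarith

/-- Turns membership in a ball into the avoidance of a set that does not depend on `L`. Reachability
must be required: an unreachable vertex is in no ball, even if there are no landmarks. -/
lemma mem_ball_iff_disjoint {L : Finset (Fin n)} {u v : Fin n} [DecidableEq (Fin n)] :
    v ∈ ball G w L u ↔ G.Reachable u v ∧ Disjoint
      (Finset.univ.filter fun z => wdist G w u z ≤ wdist G w u v) L := by
  classical
  rw [mem_ball]
  constructor
  · intro h
    refine ⟨(wdist_ne_top (w := w)).1 h.ne_top, Finset.disjoint_left.2 fun z hz hzL => ?_⟩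
    exact absurd ((sdist_le hzL).trans (Finset.mem_filter.1 hz).2) (not_le.2 h)
  · rintro ⟨h1, h2⟩
    by_contra h
    rw [not_lt] at h
    obtain ⟨x, hx, e⟩ := exists_sdist (ne_top_of_le_ne_top (wdist_ne_top.2 h1) h)
    exact Finset.disjoint_left.1 h2 (Finset.mem_filter.2 ⟨Finset.mem_univ _, e ▸ h⟩) hx

/-- The right side is `p` times a geometric sum of `c` terms, each of which is at least `(1 - p) ^
c`. -/
lemma mul_mul_pow_le {p : ℝ} (hp : 0 ≤ p) (hp1 : p ≤ 1) (c : ℕ) :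
    p * (c * (1 - p) ^ c) ≤ 1 - (1 - p) ^ c := by
  induction c with
  | zero => simp
  | succ c ih =>
    have h0 : 0 ≤ (1 - p) ^ c := pow_nonneg (by linarith) c
    rw [pow_succ]
    push_cast
    nlinarith [mul_nonneg (mul_nonneg hp hp) (mul_nonneg (Nat.cast_nonneg (α := ℝ) c) h0),
      mul_nonneg (mul_nonneg hp hp) h0]

/-- Scan points with multiplicities in the order of their distances, until one of them is marked:
the expected total multiplicity of the points passed. -/
lemma sum_mul_pow_le {ι α : Type*} [LinearOrder α] (d : ι → α) (c : ι → ℕ) {p : ℝ}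
    (hp : 0 ≤ p) (hp1 : p ≤ 1) (s : Finset ι) :
    p * ∑ y ∈ s, (c y : ℝ) * (1 - p) ^ (∑ z ∈ s with d z ≤ d y, c z) ≤
      1 - (1 - p) ^ ∑ z ∈ s, c z := by
  classical
  have hq : 0 ≤ 1 - p := by linarith
  have hq1 : 1 - p ≤ 1 := by linarith
  induction s using Finset.induction_on_max_value d with
  | empty => simp
  | insert a s ha hmax ih =>
    rw [Finset.sum_insert ha, Finset.sum_insert ha]
    -- The farthest point is added last, so its exponent counts everything. By `mul_mul_pow_le` its
    -- term is at most the increase of the right side; the other terms can only shrink.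
    have h1 : (insert a s).filter (fun z => d z ≤ d a) = insert a s :=
      Finset.filter_true_of_mem fun z hz => by
        rcases Finset.mem_insert.1 hz with rfl | hz
        · exact le_rfl
        · exact hmax z hz
    rw [h1, Finset.sum_insert ha]
    have h2 : ∑ y ∈ s, (c y : ℝ) * (1 - p) ^ (∑ z ∈ insert a s with d z ≤ d y, c z) ≤
        ∑ y ∈ s, (c y : ℝ) * (1 - p) ^ (∑ z ∈ s with d z ≤ d y, c z) := by
      refine Finset.sum_le_sum fun y _ => mul_le_mul_of_nonneg_left ?_ (Nat.cast_nonneg _)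
      refine pow_le_pow_of_le_one hq hq1 ?_
      exact Finset.sum_le_sum_of_subset
        (Finset.filter_subset_filter _ (Finset.subset_insert _ _))
    have h3 := mul_mul_pow_le hp hp1 (c a)
    have h4 : 0 ≤ (1 - p) ^ ∑ z ∈ s, c z := pow_nonneg hq _
    rw [pow_add]
    have h5 := mul_le_mul_of_nonneg_left h2 hp
    have h6 := mul_le_mul_of_nonneg_right h3 h4
    rw [mul_add]
    nlinarith

/-- The number of virtual copies of the vertices in a ball. -/
def ballCopies (G : SimpleGraph (Fin n)) (w : Sym2 (Fin n) → ℝ≥0) (L : Finset (Fin n))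
    (u : Fin n) : ℕ := ∑ v ∈ ball G w L u, numCopies G v

/-- By linearity: a vertex is in the ball only if no copy at its distance or closer is selected, and
the sum of these probabilities, weighted by copies, is bounded by `sum_mul_pow_le`. -/
theorem expect_ballCopies_le (hn : 1 ≤ n) (hk : 1 ≤ k) (u : Fin n) :
    expect G k (fun L => (ballCopies G w L u : ℝ)) ≤ 1 / (rho n k / n) := by
  classical
  have hp := rate_pos hn hk
  have hp1 := rate_le_one hn hk
  have hq : 0 ≤ 1 - rho n k / n := by linarith
  rw [le_div_iff₀' hp]
  have h1 := sum_mul_pow_le (wdist G w u) (numCopies G) hp.le hp1 Finset.univ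
  refine le_trans (mul_le_mul_of_nonneg_left ?_ hp.le)
    (h1.trans (sub_le_self _ (pow_nonneg hq _)))
  have h2 : ∀ L, (ballCopies G w L u : ℝ) = ∑ v, (numCopies G v : ℝ) *
      if v ∈ ball G w L u then 1 else 0 := by
    intro L
    simp [ballCopies, Finset.sum_ite_mem]
  simp only [h2]
  rw [expect_sum]
  refine Finset.sum_le_sum fun v _ => ?_
  rw [expect_mul]
  refine mul_le_mul_of_nonneg_left ?_ (Nat.cast_nonneg _)
  rw [← prob_disjoint]
  refine expect_mono hn hk fun L => ?_
  have := mem_ball_iff_disjoint (G := G) (w := w) (L := L) (u := u) (v := v)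
  split_ifs <;> first | tauto | norm_num

/-- A ball is contained in the set of vertices no farther than its farthest member, and this set
avoids the landmarks. There are only `n ^ 2` such sets. Each one with more than `K` copies avoids
them with probability at most `n ^ (-(c + 2))`, so a union bound suffices. -/
theorem ballCopies_whp (hn : 1 ≤ n) (hk : 1 ≤ k) (c : ℕ) :
    1 - ((n : ℝ) ^ c)⁻¹ ≤ prob G k fun L => ∀ u,
      (ballCopies G w L u : ℝ) ≤ (c + 2) * Real.log n / (rho n k / n) := by
  classical
  have hn' : (0 : ℝ) < n := by exact_mod_cast hn
  have hp := rate_pos hn hk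
  have hp1 := rate_le_one hn hk
  set K : ℝ := (c + 2) * Real.log n / (rho n k / n) with hK
  have hK0 : 0 ≤ K := by
    have := Real.log_natCast_nonneg n
    positivity
  let A : Fin n × Fin n → Finset (Fin n) := fun e =>
    Finset.univ.filter fun z => wdist G w e.1 z ≤ wdist G w e.1 e.2
  let s : Finset (Fin n × Fin n) := Finset.univ.filter fun e => K < (∑ z ∈ A e, numCopies G z : ℕ)
  have h1 : prob G k (fun L => ¬ ∀ u, (ballCopies G w L u : ℝ) ≤ K) ≤
      prob G k (fun L => ∃ e ∈ s, Disjoint (A e) L) := by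
    refine prob_mono hn hk fun L h => ?_
    push Not at h
    obtain ⟨u, hu⟩ := h
    have hne : (ball G w L u).Nonempty := by
      by_contra h
      rw [Finset.not_nonempty_iff_eq_empty] at h
      simp only [ballCopies, h] at hu
      simp at hu
      linarith
    obtain ⟨v, hv, hmax⟩ := Finset.exists_max_image _ (wdist G w u) hne
    refine ⟨(u, v), ?_, (mem_ball_iff_disjoint.1 hv).2⟩
    simp only [s, Finset.mem_filter, Finset.mem_univ, true_and]
    refine hu.trans_le ?_
    exact_mod_cast Finset.sum_le_sum_of_subset fun z hz =>
      Finset.mem_filter.2 ⟨Finset.mem_univ _, hmax z hz⟩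
  have h2 : prob G k (fun L => ∃ e ∈ s, Disjoint (A e) L) ≤ ((n : ℝ) ^ c)⁻¹ := by
    refine (prob_exists_le hn hk s _).trans ?_
    have h3 : ∀ e ∈ s, prob G k (fun L => Disjoint (A e) L) ≤ ((n : ℝ) ^ (c + 2))⁻¹ := by
      intro e he
      rw [prob_disjoint, ← exp_neg_mul_log hn]
      refine one_sub_pow_le hp1 ?_
      have := (Finset.mem_filter.1 he).2
      rw [hK, div_lt_iff₀' hp] at this
      push_cast
      push_cast at this
      exact this.le
    refine (Finset.sum_le_sum h3).trans ?_
    rw [Finset.sum_const, nsmul_eq_mul]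
    have h4 : (s.card : ℝ) ≤ (n : ℝ) ^ 2 := by
      have := s.card_le_univ
      rw [Fintype.card_prod, Fintype.card_fin] at this
      rw [sq]; exact_mod_cast this
    calc (s.card : ℝ) * ((n : ℝ) ^ (c + 2))⁻¹ ≤ (n : ℝ) ^ 2 * ((n : ℝ) ^ (c + 2))⁻¹ := by gcongr
      _ = _ := by rw [pow_add]; field_simp
  have := prob_add_not (G := G) (k := k) (fun L => ∀ u, (ballCopies G w L u : ℝ) ≤ K)
  linarith

/-- All vertices of the ball other than `u` are connected to `u`, hence have positive degree, and
`deg + 1 ≤ 2 * deg`; an isolated `u` accounts for the summand `1`. -/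
lemma workload_le (hn : 1 ≤ n) (hm : n ≤ 2 * numEdges G) (L : Finset (Fin n)) (u : Fin n) :
    (workload G w L u : ℝ) ≤ 1 + 2 * (density G * ballCopies G w L u) := by
  classical
  have h1 : ∀ v ∈ ball G w L u, (deg G v : ℝ) + 1 ≤
      2 * (density G * numCopies G v) + if v = u then 1 else 0 := by
    intro v hv
    have h2 := deg_le_copies hn hm v
    split_ifs with h
    · have : (0 : ℝ) ≤ deg G v := Nat.cast_nonneg _
      linarith
    · obtain ⟨p⟩ := (mem_ball_iff_disjoint.1 hv).1.symm
      have : 0 < deg G v := by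
        cases p with
        | nil => exact absurd rfl h
        | cons ha p => exact Nat.zero_lt_of_lt (lt_deg (nbrIdx_spec ha))
      have : (1 : ℝ) ≤ deg G v := by exact_mod_cast this
      linarith
  have h3 := Finset.sum_le_sum h1
  rw [Finset.sum_add_distrib, Finset.sum_add_distrib, ← Finset.mul_sum, ← Finset.mul_sum, Finset.sum_ite_eq'] at h3
  have h4 : (if u ∈ ball G w L u then (1 : ℝ) else 0) ≤ 1 := by split_ifs <;> norm_num
  simp only [workload, ballCopies]
  push_cast
  rw [Finset.sum_add_distrib]
  linarith

end bounds

end DistOracle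
end

/-! ### Size and query time: the final estimates -/

noncomputable section
namespace DistOracle

section main
variable {n k : ℕ} {G : SimpleGraph (Fin n)} {w : Sym2 (Fin n) → ℝ≥0}

/-- If the term with `rho` dominates, then `x ≤ 10 * rho n k`, and the exponent is `k/(2k+2) * (1 +
1/k) = 1/2`. Otherwise `x = O(log n)`, and since `1 + 1/k ≤ 2`, the bound `log n ≤ 4 * n ^ (1/4)` is
enough. -/
lemma rpow_mul_self_le (hn : 1 ≤ n) (hk : 1 ≤ k) {x c : ℝ} (hx : 1 ≤ x) (hc : 0 ≤ c)
    (h : x ≤ 5 * rho n k + 2 * c * Real.log n) :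
    x ^ ((k : ℝ)⁻¹) * x ≤ (100 + 256 * c ^ 2) * (n : ℝ) ^ ((1 : ℝ) / 2) := by
  have hn0 : (0 : ℝ) < n := by exact_mod_cast hn
  have hk1 : (1 : ℝ) ≤ k := by exact_mod_cast hk
  have hki : (k : ℝ)⁻¹ ≤ 1 := inv_le_one_of_one_le₀ hk1
  have hρ := rho_pos hn hk
  have hlog : 0 ≤ Real.log n := Real.log_natCast_nonneg n
  set s : ℝ := (n : ℝ) ^ ((1 : ℝ) / 2) with hs
  have hs0 : 0 ≤ s := by positivity
  rcases le_total (2 * c * Real.log n) (5 * rho n k) with h1 | h1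
  · have h2 : x ≤ 10 * rho n k := by linarith
    have h3 : rho n k ≤ (n : ℝ) ^ ((k : ℝ) / (2 * k + 2)) := div_le_self (by positivity) hk1
    have h4 : (n : ℝ) ^ ((k : ℝ) / (2 * k + 2) * (k : ℝ)⁻¹) * (n : ℝ) ^ ((k : ℝ) / (2 * k + 2)) = s := by
      rw [← Real.rpow_add hn0]
      congr 1
      field_simp
      ring
    calc x ^ ((k : ℝ)⁻¹) * x ≤ (10 * rho n k) ^ ((k : ℝ)⁻¹) * (10 * rho n k) := by gcongr
      _ = (10 : ℝ) ^ ((k : ℝ)⁻¹) * rho n k ^ ((k : ℝ)⁻¹) * (10 * rho n k) := by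
          rw [Real.mul_rpow (by norm_num) hρ.le]
      _ ≤ 10 * ((n : ℝ) ^ ((k : ℝ) / (2 * k + 2))) ^ ((k : ℝ)⁻¹) *
          (10 * (n : ℝ) ^ ((k : ℝ) / (2 * k + 2))) := by
          gcongr
          calc (10 : ℝ) ^ ((k : ℝ)⁻¹) ≤ 10 ^ (1 : ℝ) :=
                Real.rpow_le_rpow_of_exponent_le (by norm_num) hki
            _ = 10 := Real.rpow_one _
      _ = 100 * s := by
          rw [← Real.rpow_mul hn0.le, ← h4]; ring
      _ ≤ (100 + 256 * c ^ 2) * s := by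
          gcongr; nlinarith [sq_nonneg c]
  · have h2 : x ≤ 4 * c * Real.log n := by linarith
    have h3 : Real.log n ≤ 4 * (n : ℝ) ^ ((1 : ℝ) / 4) := by
      have := Real.log_le_rpow_div hn0.le (by norm_num : (0 : ℝ) < 1 / 4)
      linarith
    have h4 : ((n : ℝ) ^ ((1 : ℝ) / 4)) ^ 2 = s := by
      rw [← Real.rpow_natCast, ← Real.rpow_mul hn0.le]
      norm_num [hs]
    calc x ^ ((k : ℝ)⁻¹) * x ≤ x * x := by
          gcongr
          calc x ^ ((k : ℝ)⁻¹) ≤ x ^ (1 : ℝ) := Real.rpow_le_rpow_of_exponent_le hx hki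
            _ = x := Real.rpow_one _
      _ ≤ (4 * c * (4 * (n : ℝ) ^ ((1 : ℝ) / 4))) * (4 * c * (4 * (n : ℝ) ^ ((1 : ℝ) / 4))) := by
          have h5 : x ≤ 4 * c * (4 * (n : ℝ) ^ ((1 : ℝ) / 4)) := h2.trans (by gcongr)
          gcongr
      _ = 256 * c ^ 2 * s := by rw [← h4]; ring
      _ ≤ (100 + 256 * c ^ 2) * s := by gcongr; linarith

/-- If there are few landmarks, then the oracle is small. -/
lemma size_le (hn : 1 ≤ n) (hk : 1 ≤ k) {l N : ℕ} {c : ℝ} (hc : 0 ≤ c)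
    (hl : (l : ℝ) ≤ 5 * rho n k + 2 * c * Real.log n)
    (hN : ∀ d, l < d ^ k → N ≤ 51 * n + l ^ 2 + 12 * (2 * d * l) ^ 2) :
    (N : ℝ) ≤ (51 + 49 * (2 * (100 + 256 * c ^ 2)) ^ 2) * n := by
  have hn0 : (0 : ℝ) < n := by exact_mod_cast hn
  have hk0 : k ≠ 0 := by omega
  rcases Nat.eq_zero_or_pos l with rfl | hl0
  · have h1 := hN 1 (by simp)
    have h2 : (N : ℝ) ≤ 51 * n := by exact_mod_cast (by simpa using h1)
    refine h2.trans ?_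
    gcongr
    nlinarith [sq_nonneg (2 * (100 + 256 * c ^ 2))]
  · have hl1 : (1 : ℝ) ≤ l := by exact_mod_cast hl0
    have h1 := rpow_mul_self_le hn hk hl1 hc hl
    set x : ℝ := (l : ℝ) ^ ((k : ℝ)⁻¹) with hx
    have hx1 : 1 ≤ x := Real.one_le_rpow hl1 (by positivity)
    have hxk : x ^ k = l := Real.rpow_inv_natCast_pow (by positivity) hk0
    -- The degree parameter is the least natural number above `l ^ (1/k)`, which is at most twice
    -- this root.
    have h2 : l < (⌊x⌋₊ + 1) ^ k := by
      have : x ^ k < ((⌊x⌋₊ : ℝ) + 1) ^ k :=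
        pow_lt_pow_left₀ (Nat.lt_floor_add_one x) (by linarith) hk0
      rw [hxk] at this
      exact_mod_cast this
    have h3 : (N : ℝ) ≤ 51 * n + l ^ 2 + 12 * (2 * (⌊x⌋₊ + 1) * l) ^ 2 := by
      exact_mod_cast hN _ h2
    have h4 : (⌊x⌋₊ : ℝ) + 1 ≤ 2 * x := by
      have := Nat.floor_le (by linarith : (0 : ℝ) ≤ x)
      linarith
    set s : ℝ := (n : ℝ) ^ ((1 : ℝ) / 2) with hs
    have hs2 : s ^ 2 = n := by
      rw [hs, ← Real.rpow_natCast, ← Real.rpow_mul hn0.le]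
      norm_num
    set K : ℝ := 100 + 256 * c ^ 2 with hK
    have h5 : ((⌊x⌋₊ : ℝ) + 1) * l ≤ 2 * K * s := by
      calc ((⌊x⌋₊ : ℝ) + 1) * l ≤ 2 * x * l := by gcongr
        _ = 2 * (x * l) := by ring
        _ ≤ 2 * (K * s) := by gcongr
        _ = _ := by ring
    have h6 : (l : ℝ) ≤ ((⌊x⌋₊ : ℝ) + 1) * l := by
      have : (0 : ℝ) ≤ ⌊x⌋₊ := Nat.cast_nonneg _
      nlinarith
    have h7 : (l : ℝ) ^ 2 ≤ (2 * K * s) ^ 2 := by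
      gcongr; exact h6.trans h5
    have h8 : (((⌊x⌋₊ : ℝ) + 1) * l) ^ 2 ≤ (2 * K * s) ^ 2 := by gcongr
    have h9 : (2 * K * s) ^ 2 = (2 * K) ^ 2 * n := by rw [mul_pow, hs2]
    nlinarith

lemma two_le_of_le_numEdges (hn : 1 ≤ n) (hm : n ≤ 2 * numEdges G) : 2 ≤ n := by
  by_contra h
  have h0 : ∀ v, deg G v = 0 := fun v => by have := deg_lt G v; omega
  have := sum_deg G
  simp [h0] at this
  omega

/-- The constant for bounds with failure probability at most `n ^ (-c)`. -/
def whpConst (H : ℝ) (c : ℕ) : ℝ :=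
  51 + 49 * (2 * (100 + 256 * (c : ℝ) ^ 2)) ^ 2 + H * (15 + 4 * (c + 2))

/-- The oracles whose searches use a given priority queue. -/
theorem isOracle_of_isQueue (hn : 1 ≤ n) (hk : 1 ≤ k) (hm : n ≤ 2 * numEdges G) {upd pop : Cmd}
    {g : ℕ} {inv : (ℕ → ℕ) → (Fin n → ℝ≥0) → List (Fin n) → Finset (Fin n) → ℝ≥0 → Prop}
    (hQ : ∀ Λ : Layout n, Λ.E = ⟨G, w, n ^ 12⟩ → Λ.R = 2 * n → IsQueue Λ upd pop g inv)
    {H b : ℝ} (hb : 0 ≤ b) (hH : 0 ≤ H) (hg : 2 * g + 1000 ≤ H * b) :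
    IsOracle G w k (queryCmd upd pop).comp 12 (14 * H + 400) (whpConst H)
      (queryBound G k * b) := by
  unfold whpConst
  have hn2 := two_le_of_le_numEdges hn hm
  have hn0 : (0 : ℝ) < n := by exact_mod_cast hn
  have hp := rate_pos hn hk
  have hp1 := rate_le_one hn hk
  have hd := density_ge hn hm
  have hQB := queryBound_eq (G := G) hn hk
  set Q := queryBound G k with hQdef
  -- Lower bounds on `Q` and `log n` let the constant part of the running time be absorbed into the
  -- main terms.
  have hQ1 : 1 / 2 ≤ Q := by
    rw [hQB]
    exact hd.trans (le_div_self (by linarith) hp hp1)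
  have hlog : 2 / 3 ≤ Real.log n := by
    have h1 := Real.log_two_gt_d9
    have h2 : Real.log 2 ≤ Real.log n := Real.log_le_log (by norm_num) (by exact_mod_cast hn2)
    linarith
  choose M hM1 hM2 T o δ hA hC hT using fun L => exists_oracle hn2 G w L k hk hQ
  have hT' : ∀ L u v, (T L u v : ℝ) ≤ H * b * (5 + 2 * (density G * ballCopies G w L u) +
      2 * (density G * ballCopies G w L v)) + 400 * hops (o L u v) := by
    intro L u v
    have h1 : (T L u v : ℝ) ≤ (2 * g + 1000) * (workload G w L u + workload G w L v + 3) +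
        400 * hops (o L u v) := by exact_mod_cast hT L u v
    refine h1.trans (add_le_add ?_ le_rfl)
    have h2 := workload_le (w := w) hn hm L u
    have h3 := workload_le (w := w) hn hm L v
    refine mul_le_mul hg (by linarith) (by positivity) (by positivity)
  have hhops : ∀ L u v, 400 * (hops (o L u v) : ℝ) ≤ (14 * H + 400) * hops (o L u v) := by
    intro L u v
    gcongr
    linarith
  refine ⟨M, T, o, δ, hM1, hA, hC, fun c => ?_, fun u v => ?_, fun c => ?_⟩
  · refine (card_landmarks_whp hn hk hm c).trans (prob_mono hn hk fun L hL => ?_)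
    refine (size_le hn hk (Nat.cast_nonneg c) hL (hM2 L)).trans ?_
    gcongr
    have : 0 ≤ H * (15 + 4 * ((c : ℝ) + 2)) := by positivity
    linarith
  · have h1 : ∀ L, max 0 ((T L u v : ℝ) - (14 * H + 400) * hops (o L u v)) ≤
        H * b * 5 + (H * b * 2 * density G * ballCopies G w L u +
          H * b * 2 * density G * ballCopies G w L v) := by
      intro L
      have hd0 : 0 ≤ density G := by linarith
      refine max_le (by positivity) ?_
      have := hT' L u v
      have := hhops L u v
      linarith
    refine (expect_mono hn hk h1).trans ?_
    rw [expect_add, expect_add, expect_const, expect_mul, expect_mul]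
    have h2 : ∀ x : Fin n, H * b * 2 * density G *
        expect G k (fun L => (ballCopies G w L x : ℝ)) ≤ H * b * 2 * Q := by
      intro x
      have hd0 : 0 ≤ density G := by linarith
      have h3 := expect_ballCopies_le (G := G) (w := w) hn hk x
      calc _ ≤ H * b * 2 * density G * (1 / (rho n k / n)) := by gcongr
        _ = H * b * 2 * Q := by rw [hQB]; ring
    have h3 := h2 u
    have h4 := h2 v
    have h5 : 0 ≤ H * b := by positivity
    have h6 : 0 ≤ Q * b := by positivity
    -- With `5 ≤ 10 * Q`, the constant term and the two balls add up to `(10 + 2 + 2) * H * b * Q`,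
    -- whence the constant `14 * H`.
    nlinarith [mul_le_mul_of_nonneg_left hQ1 h5]
  · refine (ballCopies_whp (w := w) hn hk c).trans (prob_mono hn hk fun L hL u v => ?_)
    have hd0 : 0 ≤ density G := by linarith
    have h2 : ∀ x : Fin n, density G * ballCopies G w L x ≤ (c + 2) * Real.log n * Q := by
      intro x
      calc _ ≤ density G * ((c + 2) * Real.log n / (rho n k / n)) := by
            gcongr; exact hL x
        _ = _ := by rw [hQB]; ring
    have h3 := h2 u
    have h4 := h2 v
    have h5 : 0 ≤ H * b := by positivity
    have h6 : 5 ≤ 15 * (Real.log n * Q) := by nlinarith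
    have h7 : 5 + 2 * (density G * ballCopies G w L u) + 2 * (density G * ballCopies G w L v) ≤
        (15 + 4 * (c + 2)) * (Real.log n * Q) := by linarith
    refine (hT' L u v).trans (add_le_add ?_ (hhops L u v))
    calc _ ≤ H * b * ((15 + 4 * (c + 2)) * (Real.log n * Q)) := by gcongr
      _ = H * (15 + 4 * (c + 2)) * (Q * b * Real.log n) := by ring
      _ ≤ _ := by
        have : 0 ≤ Q * b * Real.log n := by positivity
        gcongr
        have : 0 ≤ 49 * (2 * (100 + 256 * (c : ℝ) ^ 2)) ^ 2 := by positivity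
        linarith

/-- Since `log n ≥ log 2`, both the binary logarithm of `2 * n` and the additive constants are
bounded by multiples of `log n`. -/
lemma tree_cost_le (hn : 2 ≤ n) :
    2 * ((100 * (Nat.log 2 (2 * n) + 2) : ℕ) : ℝ) + 1000 ≤ 2700 * Real.log n := by
  have h1 := Real.log_two_gt_d9
  have h2 : Real.log 2 ≤ Real.log n := Real.log_le_log (by norm_num) (by exact_mod_cast hn)
  have hn0 : (n : ℝ) ≠ 0 := by positivity
  have h3 : (Nat.log 2 (2 * n) : ℝ) * Real.log 2 ≤ Real.log 2 + Real.log n := by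
    rw [← Real.log_mul (by norm_num) hn0, ← Real.log_pow]
    refine Real.log_le_log (by positivity) ?_
    exact_mod_cast Nat.pow_log_le_self 2 (by omega : 2 * n ≠ 0)
  have h4 : (Nat.log 2 (2 * n) : ℝ) ≤ 3 * Real.log n := by
    have : (0 : ℝ) ≤ Nat.log 2 (2 * n) := Nat.cast_nonneg _
    nlinarith
  push_cast
  linarith

end main

end DistOracle
end

theorem corollary1 :
    (∃ (q : DistOracle.Prog) (a : ℕ) (C : ℝ) (C' : ℕ → ℝ),
      ∀ (n k : ℕ) (G : SimpleGraph (Fin n)), 1 ≤ n → 1 ≤ k → n ≤ 2 * DistOracle.numEdges G →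
        DistOracle.IsOracle G (fun _ => 1) k q a C C' (DistOracle.queryBound G k)) ∧
    (∃ (q : DistOracle.Prog) (a : ℕ) (C : ℝ) (C' : ℕ → ℝ),
      ∀ (n k : ℕ) (G : SimpleGraph (Fin n)) (w : Sym2 (Fin n) → NNReal),
        1 ≤ n → 1 ≤ k → n ≤ 2 * DistOracle.numEdges G →
        DistOracle.IsOracle G w k q a C C' (DistOracle.queryBound G k * Real.log n)) := by
  -- Here `1060 = 2 * 30 + 1000` comes from the cost `30` of a FIFO operation, and `2700` from
  -- `tree_cost_le`.
  refine ⟨⟨(DistOracle.queryCmd .skip DistOracle.fifoPop).comp, 12, 14 * 1060 + 400,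
      DistOracle.whpConst 1060, fun n k G hn hk hm => ?_⟩,
    ⟨(DistOracle.queryCmd DistOracle.treeUpd DistOracle.treePop).comp, 12, 14 * 2700 + 400,
      DistOracle.whpConst 2700, fun n k G w hn hk hm => ?_⟩⟩
  · rw [← mul_one (DistOracle.queryBound G k)]
    exact DistOracle.isOracle_of_isQueue hn hk hm
      (fun Λ hE _ => DistOracle.fifo_isQueue fun e => by rw [hE]) (H := 1060) zero_le_one
      (by norm_num) (by norm_num)
  · exact DistOracle.isOracle_of_isQueue hn hk hm
      (fun Λ _ hR => DistOracle.tree_isQueue hR.ge) (H := 2700) (Real.log_natCast_nonneg n)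
      (by norm_num) (DistOracle.tree_cost_le (DistOracle.two_le_of_le_numEdges hn hm))
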